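/- Let $M$ be a compact (Hausdorff, boundaryless) smooth manifold of even dimension $n$ with a Riemannian metric $g$, and put $N = 2^{n/2}$. **The Clifford bundle and $P$.** For $x\in M$ let $\mathrm{Cliff}(T_xM)$ be the complexified Clifford algebra of $(T_xM,g_x)$ with $v^2=-g(v,v)$ and $v^*=-v$ for $v\in T_xM$, and let $\tau$ be its transposition, i.e. the $\mathbb C$-linear anti-automorphism that is the identity on $T_xM$. Let $\mathrm{Cliff}(M)$ be the $C^*$-algebra of continuous sections of the bundle of these algebras. Let $P\to M$ be the $PU(N)$-principal bundle of trivializations of the Clifford bundle: the fibre $P_x$ is the set of $*$-isomorphisms $p^*\colon \mathrm{Cliff}(T_xM)\to M_N(\mathbb C)$, and $(pa)^*=\mathrm{Ad}_{a^{-1}}\circ p^*$. (If $M$ is oriented, this is the $PU(N)$-bundle induced from the oriented orthonormal frame bundle by $SO(n)\to \mathrm{Aut}(\mathrm{Cliff}(\mathbb R^n))\simeq PU(N)$.) The group $SU(N)$ acts on $P$ through $PU(N)$. **The crossed product and $J_{\mathrm{(nat)}}$.** Let $C(P)\rtimes SU(N)$ be the crossed product for the action $\alpha_a(\varphi)(p)=\varphi(pa)$,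 i.e. the enveloping $C^*$-algebra of $L^1(SU(N),C(P))$. Each $z$ in the centre of $SU(N)$ acts on $V^{\mathrm{(nat)}}=\mathbb C^N$ by a scalar $\chi(z)$. Let $J_{\mathrm{(nat)}}$ be the closure in $C(P)\rtimes SU(N)$ of $$\{f\in C(SU(N),C(P)) \mid f(az)=\overline{\chi(z)}\,f(a)\ \text{for all } a\in SU(N) \text{ and all } z\in Z(SU(N))\}.$$ This is the direct summand of $C(P)\rtimes SU(N)$ in which each $z\in Z(SU(N))$ acts as $\chi(z)$. **The module $\mathcal F$.** The algebra $\mathrm{Cliff}(M)$ acts on $C(P,\mathbb C^N)$ by $(c\,\xi)(p)=p^*(c_x)\,\xi(p)$ for $p\in P_x$, and there is a $\mathrm{Cliff}(M)$-valued inner product $(\xi,\eta)$ on $C(P,\mathbb C^N)$ given by $$p^*\big((\xi,\eta)_x\big)=\int_{PU(N)}\mathrm{Ad}_a\big(\eta_{pa}\otimes\xi_{pa}^*\big)\,da\qquad (p\in P_x),$$ where $da$ is normalized Haar measure. Let $\mathcal F$ be the completion of $C(P,\mathbb C^N)$ in the norm $\|\xi\|=\|(\xi,\xi)\|^{1/2}$.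 **Proposition.** The Banach space $\mathcal F$ carries the structure of a strong Morita equivalence (imprimitivity) bimodule between $J_{\mathrm{(nat)}}$ and $\mathrm{Cliff}(M)$. That is, it is a full left Hilbert $J_{\mathrm{(nat)}}$-module and a full right Hilbert $\mathrm{Cliff}(M)$-module, each algebra acts by adjointable operators for the inner product with values in the other one, and ${}_{J}\langle x,y\rangle\, z=x\,\langle y,z\rangle_{\mathrm{Cliff}(M)}$ for all $x,y,z\in\mathcal F$. For $\xi,\eta\in C(P,\mathbb C^N)$, this structure satisfies: 1. $\tau\big(\langle\xi,\eta\rangle_{\mathrm{Cliff}(M)}\big)=(\xi,\eta)$; 2. $\xi\cdot c=\tau(c)\,\xi$ for $c\in\mathrm{Cliff}(M)$; 3. $(f\xi)(p)=\int_{SU(N)} f(a,p)\,a\,\xi(pa)\,da$ for every $f$ in the dense subspace of $J_{\mathrm{(nat)}}$ displayed above. -/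

import Mathlib

open scoped TensorProduct Manifold ContDiff Matrix.Norms.L2Operator BoundedContinuousFunction ENNReal

noncomputable section

namespace ProjDirac

universe u

/-! ### The group `SU(N)`, `N = 2^{n/2}`, and its Haar measure -/

/-- The dimension `N = 2^{n/2}` of the spinor space in (even) dimension `n`. -/
abbrev spinDim (n : ℕ) : ℕ := 2 ^ (n / 2)

/-- The full matrix C⋆-algebra `M_N(ℂ)`, with its operator norm. -/
abbrev Mat (n : ℕ) : Type := Matrix (Fin (spinDim n)) (Fin (spinDim n)) ℂ

/-- The space `ℂ^N` of the natural representation of `SU(N)`. -/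
abbrev VNat (n : ℕ) : Type := Fin (spinDim n) → ℂ

/-- The group `SU(N)`. -/
abbrev SU (n : ℕ) : Type := Matrix.specialUnitaryGroup (Fin (spinDim n)) ℂ

instance (n : ℕ) : IsTopologicalGroup (SU n) where
  continuous_inv := by
    refine Continuous.subtype_mk ?_ _
    exact (continuous_subtype_val (p := fun A : Mat n => A ∈ Matrix.specialUnitaryGroup _ ℂ)).star

theorem norm_le_one_of_mem {n : ℕ} (A : Mat n) (h : star A * A = 1) : ‖A‖ ≤ 1 := by
  have h1 : ‖A‖ * ‖A‖ = ‖(1 : Mat n)‖ := by rw [← CStarRing.norm_star_mul_self, h]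
  have h2 : ‖(1 : Mat n)‖ ≤ 1 := by
    rw [Matrix.cstar_norm_def, map_one]
    exact ContinuousLinearMap.norm_id_le
  nlinarith [norm_nonneg A]

instance (n : ℕ) : CompactSpace (SU n) := by
  suffices h : IsCompact (Matrix.specialUnitaryGroup (Fin (spinDim n)) ℂ : Set (Mat n)) from
    isCompact_iff_compactSpace.mp h
  refine Metric.isCompact_of_isClosed_isBounded ?_ ?_
  · have : (Matrix.specialUnitaryGroup (Fin (spinDim n)) ℂ : Set (Mat n)) =
        {A | star A * A = 1} ∩ {A | A.det = 1} := by
      ext A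
      simp [Matrix.mem_specialUnitaryGroup_iff, Matrix.mem_unitaryGroup_iff']
    rw [this]
    exact (isClosed_eq (by fun_prop) (by fun_prop)).inter
      (isClosed_eq (Continuous.matrix_det continuous_id) (by fun_prop))
  · refine (Metric.isBounded_closedBall (x := (0 : Mat n)) (r := 1)).subset fun A hA => ?_
    rw [mem_closedBall_zero_iff]
    exact norm_le_one_of_mem A (Matrix.mem_unitaryGroup_iff'.mp
      (Matrix.mem_specialUnitaryGroup_iff.mp hA).1)

instance (n : ℕ) : MeasurableSpace (SU n) := borel _
instance (n : ℕ) : BorelSpace (SU n) := ⟨rfl⟩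

/-- The Haar measure on `SU(N)` of total mass one. -/
def haarSU (n : ℕ) : MeasureTheory.Measure (SU n) := MeasureTheory.Measure.haarMeasure ⊤

instance (n : ℕ) : (haarSU n).IsHaarMeasure := by unfold haarSU; infer_instance

instance (n : ℕ) : MeasureTheory.IsProbabilityMeasure (haarSU n) :=
  ⟨by simpa [haarSU] using
    MeasureTheory.Measure.haarMeasure_self (K₀ := (⊤ : TopologicalSpace.PositiveCompacts (SU n)))⟩

theorem integrable_haarSU {n : ℕ} {E : Type*} [NormedAddCommGroup E] 
    {F : SU n → E} (hF : Continuous F) : MeasureTheory.Integrable F (haarSU n) := by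
  refine MeasureTheory.integrableOn_univ.mp (hF.continuousOn.integrableOn_compact isCompact_univ)

theorem norm_integral_haarSU_le {n : ℕ} {E : Type*} [NormedAddCommGroup E] [NormedSpace ℝ E]
    {F : SU n → E} {C : ℝ} (hF : ∀ a, ‖F a‖ ≤ C) : ‖∫ a, F a ∂haarSU n‖ ≤ C := by
  simpa using MeasureTheory.norm_integral_le_of_norm_le_const (μ := haarSU n)
    (MeasureTheory.ae_of_all _ hF)

theorem continuous_integral_haarSU {n : ℕ} {X E : Type*} [TopologicalSpace X]
    [NormedAddCommGroup E] [NormedSpace ℝ E] {F : X → SU n → E}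
    (hF : Continuous fun q : X × SU n => F q.1 q.2) :
    Continuous fun x => ∫ a, F x a ∂haarSU n := by
  let c : C(X × SU n, E) := ⟨_, hF⟩
  have hI : Continuous fun f : C(SU n, E) => ∫ a, f a ∂haarSU n := by
    refine LipschitzWith.continuous (K := 1) (LipschitzWith.of_dist_le_mul fun f h => ?_)
    rw [dist_eq_norm, ← MeasureTheory.integral_sub (integrable_haarSU f.continuous)
      (integrable_haarSU h.continuous), NNReal.coe_one, one_mul]
    refine norm_integral_haarSU_le fun a => ?_
    rw [← dist_eq_norm]
    exact ContinuousMap.dist_apply_le_dist a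
  exact hI.comp c.curry.continuous

/-! ### The Clifford bundle and the principal bundle `P` of its trivializations -/

section Geometry

variable {n : ℕ} {M : Type u} [TopologicalSpace M] [ChartedSpace (EuclideanSpace ℝ (Fin n)) M]
  [IsManifold (𝓡 n) ∞ M]

variable (n M) in
/-- Smooth Riemannian metrics on the `n`-dimensional manifold `M`. -/
abbrev RiemMetric : Type u :=
  Bundle.ContMDiffRiemannianMetric (𝓡 n) ∞ (EuclideanSpace ℝ (Fin n))
    (fun x : M => TangentSpace (𝓡 n) x)

variable (g : RiemMetric n M)

/-- The quadratic form `v ↦ -g(v, v)` on `T_x M`. -/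
def cliffForm (x : M) : QuadraticForm ℝ (TangentSpace (𝓡 n) x) :=
  -(LinearMap.BilinMap.toQuadraticMap (g.inner x).toLinearMap₁₂)

instance {V : Type*} [AddCommGroup V] [Module ℝ V] (Q : QuadraticForm ℝ V) :
    StarModule ℝ (CliffordAlgebra Q) where
  star_smul r a := by rw [CliffordAlgebra.star_smul]; simp

/-- The complex Clifford algebra `Cliff(T_x M)`: the complexification of the real Clifford algebra
with `v * v = -g(v, v)`. Its involution is the conjugate-linear one with `star v = -v`. -/
abbrev CliffFibre (x : M) : Type := ℂ ⊗[ℝ] CliffordAlgebra (cliffForm g x)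

/-- The inclusion `T_x M → Cliff(T_x M)`. -/
def cliffVec (x : M) (v : TangentSpace (𝓡 n) x) : CliffFibre g x :=
  (1 : ℂ) ⊗ₜ[ℝ] CliffordAlgebra.ι (cliffForm g x) v

/-- The transposition of `Cliff(T_x M)`: the complex linear anti-automorphism which is the
identity on `T_x M`. -/
def cliffTranspose (x : M) : CliffFibre g x →ₗ[ℂ] CliffFibre g x :=
  LinearMap.baseChange ℂ CliffordAlgebra.reverse

/-- A point of the total space `P`: a point `x` of `M` and a trivialization
`Cliff(T_x M) ≃ M_N(ℂ)`, i.e. an isomorphism of ⋆-algebras. -/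
structure Triv where
  /-- The base point. -/
  base : M
  /-- The isomorphism `p^* : Cliff(T_x M) → M_N(ℂ)`. -/
  iso : CliffFibre g base ≃⋆ₐ[ℂ] Mat n

variable (n M) in
/-- Continuous vector fields on `M`. -/
def VectorField : Type u :=
  {X : ∀ x : M, TangentSpace (𝓡 n) x //
    Continuous fun x => (⟨x, X x⟩ : TangentBundle (𝓡 n) M)}

/-- The topology of `P`: the coarsest one for which the projection to `M` is continuous and
`p ↦ p^*(X)` is continuous for each continuous vector field `X`. In terms of a local frame
`e_1, …, e_n` of `TM` this is the topology given by the base point and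
the matrices `p^*(e_1), …, p^*(e_n)`. -/
instance trivTopology : TopologicalSpace (Triv g) :=
  TopologicalSpace.induced
    (fun p => (p.base, fun X : VectorField n M => p.iso (cliffVec g p.base (X.1 p.base))))
    inferInstance

variable {g}

theorem continuous_triv_iff {Z : Type*} [TopologicalSpace Z] {F : Z → Triv g} :
    Continuous F ↔ Continuous (fun z => (F z).base) ∧ ∀ X : VectorField n M,
      Continuous fun z => (F z).iso (cliffVec g (F z).base (X.1 (F z).base)) := by
  rw [continuous_induced_rng, ← continuous_pi_iff, ← continuous_prodMk]
  rfl

/-- The automorphism `Ad_a` of `M_N(ℂ)`, for `a ∈ SU(N)`. -/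
def adIso (a : SU n) : Mat n ≃⋆ₐ[ℂ] Mat n :=
  Unitary.conjStarAlgAut ℂ (Mat n) ⟨a.1, Matrix.specialUnitaryGroup_le_unitaryGroup a.2⟩

theorem adIso_apply (a : SU n) (A : Mat n) : adIso a A = (a : Mat n) * A * star (a : Mat n) := rfl

/-- The right action of `SU(N)` (through `PU(N)`) on `P`: `(p a)^* = Ad_{a⁻¹} ∘ p^*`. -/
def Triv.act (p : Triv g) (a : SU n) : Triv g := ⟨p.base, p.iso.trans (adIso a⁻¹)⟩

theorem Triv.act_act (p : Triv g) (a b : SU n) : (p.act a).act b = p.act (a * b) := by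
  unfold Triv.act
  congr 1
  ext1 x
  simp [adIso_apply, mul_assoc, StarAlgEquiv.trans_apply, ← Matrix.star_eq_inv]

theorem Triv.act_one (p : Triv g) : p.act 1 = p := by
  obtain ⟨x, φ⟩ := p
  unfold Triv.act
  congr 1
  ext1 y
  simp [adIso_apply]

theorem Triv.act_scalar (p : Triv g) (z : SU n) (c : ℂ) (hz : (z : Mat n) = c • 1) :
    p.act z = p := by
  obtain ⟨x, φ⟩ := p
  unfold Triv.act
  congr 1
  ext1 y
  have h' : star (z : Mat n) * (z : Mat n) = 1 :=
    Matrix.mem_unitaryGroup_iff'.mp (Matrix.mem_specialUnitaryGroup_iff.mp z.2).1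
  have : star (z : Mat n) * φ y * z = φ y := by
    have hc : φ y * (z : Mat n) = z * φ y := by rw [hz]; simp
    rw [mul_assoc, hc, ← mul_assoc, h', one_mul]
  simpa [adIso_apply, ← Matrix.star_eq_inv] using this

theorem continuous_act : Continuous fun q : Triv g × SU n => q.1.act q.2 := by
  have hid : Continuous fun q : Triv g × SU n => q.1 := continuous_fst
  rw [continuous_triv_iff] at hid ⊢
  refine ⟨hid.1, fun X => ?_⟩
  have h1 : Continuous fun q : Triv g × SU n => ((q.2⁻¹ : SU n) : Mat n) := by fun_prop
  exact (h1.mul (hid.2 X)).mul h1.star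

variable (g)

/-! ### The C⋆-algebra `Cliff(M)` -/

/-- The C⋆-algebra `Cliff(M)` of continuous sections of the Clifford bundle. A section
`s : ∀ x, Cliff(T_x M)` is continuous when its expression `p ↦ p^*(s_x)` in the trivializations
`p` of the bundle is a continuous function on `P`, and its norm is the supremum of the norms
`‖p^*(s_x)‖`; so the C⋆-algebra is realized by these functions. -/
def CliffAlg : StarSubalgebra ℂ (Triv g →ᵇ Mat n) where
  carrier := {a | ∃ s : ∀ x, CliffFibre g x, ∀ p : Triv g, a p = p.iso (s p.base)}
  mul_mem' := by
    rintro a b ⟨s, hs⟩ ⟨t, ht⟩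
    exact ⟨fun x => s x * t x, fun p => by simp [hs p, ht p]⟩
  add_mem' := by
    rintro a b ⟨s, hs⟩ ⟨t, ht⟩
    exact ⟨fun x => s x + t x, fun p => by simp [hs p, ht p]⟩
  algebraMap_mem' := fun c => ⟨fun x => c • 1, fun p => by
    simp [Algebra.algebraMap_eq_smul_one]⟩
  star_mem' := by
    rintro a ⟨s, hs⟩
    exact ⟨fun x => star (s x), fun p => by simp [hs p, map_star]⟩

variable {g} in
/-- The section of the Clifford bundle underlying an element of `Cliff(M)`; it is unique, as all
fibres have trivializations when `n` is even. -/
def sect (a : CliffAlg g) : ∀ x, CliffFibre g x := a.2.choose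

variable {g} in
theorem sect_spec (a : CliffAlg g) (p : Triv g) : p.iso (sect a p.base) = a.1 p :=
  (a.2.choose_spec p).symm

variable {g} in
/-- The expression `p^*(τ(b_x))` in the trivialization `p` (over `x`) of the transposed section
`τ(b)`, for `b` in `Cliff(M)`. -/
def transposeAt (b : CliffAlg g) (p : Triv g) : Mat n :=
  p.iso (cliffTranspose g p.base (sect b p.base))

instance : IsClosed (CliffAlg g : Set (Triv g →ᵇ Mat n)) := by
  have key : (CliffAlg g : Set (Triv g →ᵇ Mat n)) =
      ⋂ (p : Triv g) (φ : CliffFibre g p.base ≃⋆ₐ[ℂ] Mat n),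
        {a | a ⟨p.base, φ⟩ = φ (p.iso.symm (a p))} := by
    ext a
    simp only [SetLike.mem_coe, Set.mem_iInter, Set.mem_ofPred_eq]
    constructor
    · rintro ⟨s, hs⟩ p φ
      rw [hs p, hs ⟨p.base, φ⟩]
      simp
    · intro h
      classical
      refine ⟨fun x => if hx : Nonempty (CliffFibre g x ≃⋆ₐ[ℂ] Mat n) then
        hx.some.symm (a ⟨x, hx.some⟩) else 0, fun p => ?_⟩
      have hx : Nonempty (CliffFibre g p.base ≃⋆ₐ[ℂ] Mat n) := ⟨p.iso⟩
      simp only [dif_pos hx]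
      exact h ⟨p.base, hx.some⟩ p.iso
  rw [key]
  refine isClosed_iInter fun p => isClosed_iInter fun φ => ?_
  refine isClosed_eq ((BoundedContinuousFunction.lipschitz_eval_const _).continuous) ?_
  let L : Mat n →ₗ[ℂ] Mat n :=
    { toFun := fun A => φ (p.iso.symm A)
      map_add' := fun A B => by simp
      map_smul' := fun c A => by simp }
  exact (LinearMap.continuous_of_finiteDimensional L).comp
    (BoundedContinuousFunction.lipschitz_eval_const _).continuous

/-! ### The crossed product `C(P) ⋊ SU(N)` and its ideal `J_(nat)` -/

/-- The space `C(SU(N), C(P)) = C(SU(N) × P)`; `P` is compact as soon as `M` is. -/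
abbrev ConvAlg : Type u := (SU n × Triv g) →ᵇ ℂ

variable {g}

/-- The convolution product `(f₁ * f₂)(a) = ∫ f₁(b) α_b(f₂(b⁻¹ a)) db`, where `α` is the action
`α_b(φ)(p) = φ(p b)` of `SU(N)` on `C(P)`. -/
def conv (f₁ f₂ : ConvAlg g) : ConvAlg g :=
  BoundedContinuousFunction.ofNormedAddCommGroup
    (fun q => ∫ b, f₁ (b, q.2) * f₂ (b⁻¹ * q.1, q.2.act b) ∂haarSU n)
    (by
      refine continuous_integral_haarSU ?_
      refine (f₁.continuous.comp (by fun_prop)).mul (f₂.continuous.comp ?_)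
      refine (by fun_prop : Continuous fun q : (SU n × Triv g) × SU n => q.2⁻¹ * q.1.1).prodMk ?_
      exact continuous_act.comp (by fun_prop : Continuous fun q : (SU n × Triv g) × SU n =>
        (q.1.2, q.2)))
    (‖f₁‖ * ‖f₂‖)
    (fun q => norm_integral_haarSU_le fun b => by
      rw [norm_mul]
      exact mul_le_mul (f₁.norm_coe_le_norm _) (f₂.norm_coe_le_norm _) (norm_nonneg _)
        (norm_nonneg _))

/-- The involution `f^⋆(a) = α_a(conj f(a⁻¹))`. -/
def convStar (f : ConvAlg g) : ConvAlg g :=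
  BoundedContinuousFunction.ofNormedAddCommGroup
    (fun q => star (f (q.1⁻¹, q.2.act q.1)))
    (by
      refine (f.continuous.comp ?_).star
      refine (by fun_prop : Continuous fun q : SU n × Triv g => q.1⁻¹).prodMk ?_
      exact continuous_act.comp (by fun_prop : Continuous fun q : SU n × Triv g => (q.2, q.1)))
    ‖f‖
    (fun q => by rw [norm_star]; exact f.norm_coe_le_norm _)

/-- The norm of `L¹(SU(N), C(P))`. -/
def l1Norm (f : ConvAlg g) : ℝ := ∫ a, ⨆ p : Triv g, ‖f (a, p)‖ ∂haarSU n

variable (g) in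
/-- A ⋆-homomorphism, contractive for the norm of `L¹(SU(N), C(P))`, from the convolution algebra
to a C⋆-algebra. -/
structure CrossRep where
  /-- The target C⋆-algebra. -/
  B : Type u
  [cstar : NonUnitalCStarAlgebra B]
  /-- The homomorphism. -/
  toLin : ConvAlg g →ₗ[ℂ] B
  map_conv : ∀ f₁ f₂, toLin (conv f₁ f₂) = toLin f₁ * toLin f₂
  map_convStar : ∀ f, toLin (convStar f) = star (toLin f)
  norm_le : ∀ f, ‖toLin f‖ ≤ l1Norm f

instance (ρ : CrossRep g) : NonUnitalCStarAlgebra ρ.B := ρ.cstar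

variable (g) in
/-- The `ℓ^∞`-product of all targets. -/
abbrev UnivTarget : Type (u + 1) := lp (fun ρ : CrossRep g => ρ.B) ∞

/-- The product of all contractive ⋆-homomorphisms of the convolution algebra to C⋆-algebras;
so `‖univRep f‖` is the norm of `f` in the enveloping C⋆-algebra of `L¹(SU(N), C(P))`. -/
def univRep : ConvAlg g →ₗ[ℂ] UnivTarget g where
  toFun f := ⟨fun ρ => ρ.toLin f, memℓp_infty ⟨l1Norm f, by
    rintro _ ⟨ρ, rfl⟩
    exact ρ.norm_le f⟩⟩
  map_add' f₁ f₂ := by ext ρ; exact map_add _ _ _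
  map_smul' c f := by ext ρ; simp

theorem univRep_conv (f₁ f₂ : ConvAlg g) : univRep (conv f₁ f₂) = univRep f₁ * univRep f₂ := by
  ext ρ
  exact ρ.map_conv f₁ f₂

theorem univRep_convStar (f : ConvAlg g) : univRep (convStar f) = star (univRep f) := by
  ext ρ
  exact ρ.map_convStar f

/-- The image of a subspace of the convolution algebra that is closed under convolution and
involution. -/
def imageSubalg (S : Submodule ℂ (ConvAlg g)) (h₁ : ∀ f₁ ∈ S, ∀ f₂ ∈ S, conv f₁ f₂ ∈ S)
    (h₂ : ∀ f ∈ S, convStar f ∈ S) : NonUnitalStarSubalgebra ℂ (UnivTarget g) where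
  carrier := S.map univRep
  add_mem' := (S.map univRep).add_mem
  zero_mem' := (S.map univRep).zero_mem
  smul_mem' := fun c _ h => (S.map univRep).smul_mem c h
  mul_mem' := by
    rintro _ _ ⟨f₁, hf₁, rfl⟩ ⟨f₂, hf₂, rfl⟩
    exact ⟨conv f₁ f₂, h₁ f₁ hf₁ f₂ hf₂, univRep_conv f₁ f₂⟩
  star_mem' := by
    rintro _ ⟨f, hf, rfl⟩
    exact ⟨convStar f, h₂ f hf, univRep_convStar f⟩

variable (g) in
/-- The (full) crossed product C⋆-algebra `C(P) ⋊ SU(N)`: the enveloping C⋆-algebra of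
`L¹(SU(N), C(P))`. -/
def CrossedProduct : NonUnitalStarSubalgebra ℂ (UnivTarget g) :=
  (imageSubalg ⊤ (fun _ _ _ _ => trivial) (fun _ _ => trivial)).topologicalClosure

variable (g) in
/-- The functions `f ∈ C(SU(N), C(P))` with `f(a z) = conj(χ(z)) f(a)` for `z` in the centre of
`SU(N)`, where `χ` is the central character of the natural representation: `z` acts on `ℂ^N` as
the scalar `χ(z)`. -/
def natFun : Submodule ℂ (ConvAlg g) where
  carrier := {f | ∀ z ∈ Subgroup.center (SU n), ∀ c : ℂ, (z : Mat n) = c • 1 →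
    ∀ (a : SU n) (p : Triv g), f (a * z, p) = star c * f (a, p)}
  add_mem' := fun h₁ h₂ z hz c hc a p => by
    simp [h₁ z hz c hc a p, h₂ z hz c hc a p, mul_add]
  zero_mem' := fun z hz c hc a p => by simp
  smul_mem' := fun r f h z hz c hc a p => by
    simp [h z hz c hc a p, mul_left_comm]

theorem conv_mem_natFun (f₁ : ConvAlg g) (_ : f₁ ∈ natFun g) (f₂ : ConvAlg g)
    (h₂ : f₂ ∈ natFun g) : conv f₁ f₂ ∈ natFun g := by
  intro z hz c hc a p
  change ∫ b, f₁ (b, p) * f₂ (b⁻¹ * (a * z), p.act b) ∂haarSU n =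
    star c * ∫ b, f₁ (b, p) * f₂ (b⁻¹ * a, p.act b) ∂haarSU n
  rw [← MeasureTheory.integral_const_mul]
  refine MeasureTheory.integral_congr_ae (MeasureTheory.ae_of_all _ fun b => ?_)
  simp only
  rw [← mul_assoc, h₂ z hz c hc]
  ring

theorem convStar_mem_natFun (f : ConvAlg g) (h : f ∈ natFun g) : convStar f ∈ natFun g := by
  intro z hz c hc a p
  change star (f ((a * z)⁻¹, p.act (a * z))) = star c * star (f (a⁻¹, p.act a))
  have hz' : z⁻¹ ∈ Subgroup.center (SU n) := inv_mem hz
  have hc' : ((z⁻¹ : SU n) : Mat n) = star c • 1 := by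
    rw [← Matrix.star_eq_inv, Matrix.specialUnitaryGroup.coe_star, hc, star_smul, star_one]
  have e : (a * z)⁻¹ = a⁻¹ * z⁻¹ := by
    rw [← mul_inv_rev, Subgroup.mem_center_iff.mp hz a]
  rw [e, h _ hz' _ hc', ← Triv.act_act, Triv.act_scalar _ z c hc, star_mul', star_star]

instance : IsClosed (CrossedProduct g : Set (UnivTarget g)) :=
  NonUnitalStarSubalgebra.isClosed_topologicalClosure _

variable (g) in
/-- The ideal `J_(nat)` of the crossed product: the closure in `C(P) ⋊ SU(N)` of the image of
`natFun`. -/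
def JNat : NonUnitalStarSubalgebra ℂ (CrossedProduct g) :=
  ((imageSubalg (natFun g) conv_mem_natFun convStar_mem_natFun).comap
    (NonUnitalStarSubalgebraClass.subtype (CrossedProduct g))).topologicalClosure

instance : IsClosed (JNat g : Set (CrossedProduct g)) :=
  NonUnitalStarSubalgebra.isClosed_topologicalClosure _

/-- The element of `C(P) ⋊ SU(N)` given by a function in `C(SU(N), C(P))`. -/
def toCross (f : ConvAlg g) : CrossedProduct g :=
  ⟨univRep f, NonUnitalStarSubalgebra.le_topologicalClosure _ ⟨f, trivial, rfl⟩⟩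

/-- The element of `J_(nat)` given by a function in `natFun`. -/
def toJNat (f : ConvAlg g) (hf : f ∈ natFun g) : JNat g :=
  ⟨toCross f, NonUnitalStarSubalgebra.le_topologicalClosure _ ⟨f, hf, rfl⟩⟩

/-! ### The Hilbert module `ℱ` -/

theorem norm_mulVec_le (a : SU n) (v : VNat n) :
    ‖(a : Mat n).mulVec v‖ ≤ spinDim n * ‖v‖ := by
  refine (pi_norm_le_iff_of_nonneg (by positivity)).mpr fun i => ?_
  calc ‖∑ j, (a : Mat n) i j * v j‖ ≤ ∑ j, ‖(a : Mat n) i j * v j‖ := norm_sum_le _ _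
    _ ≤ ∑ _j : Fin (spinDim n), ‖v‖ := by
        refine Finset.sum_le_sum fun j _ => ?_
        rw [norm_mul]
        refine (mul_le_mul (entry_norm_bound_of_unitary
          (Matrix.mem_specialUnitaryGroup_iff.mp a.2).1 i j) (norm_le_pi_norm v j)
          (norm_nonneg _) zero_le_one).trans (one_mul _).le
    _ = spinDim n * ‖v‖ := by simp

/-- The action of the convolution algebra on `C(P, ℂ^N)`, the integrated form of the
multiplication by `C(P)` and the representation `(a • ξ)(p) = a ξ(p a)` of `SU(N)`:
`(f ξ)(p) = ∫ f(a, p) a ξ(p a) da`. -/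
def convAct (f : ConvAlg g) (ξ : Triv g →ᵇ VNat n) : Triv g →ᵇ VNat n :=
  BoundedContinuousFunction.ofNormedAddCommGroup
    (fun p => ∫ a, f (a, p) • ((a : Mat n).mulVec (ξ (p.act a))) ∂haarSU n)
    (by
      refine continuous_integral_haarSU ?_
      refine (f.continuous.comp (by fun_prop)).smul ?_
      exact (by fun_prop : Continuous fun q : Triv g × SU n => (q.2 : Mat n)).matrix_mulVec
        (ξ.continuous.comp continuous_act))
    (‖f‖ * (spinDim n * ‖ξ‖))
    (fun p => norm_integral_haarSU_le fun a => by
      rw [norm_smul]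
      exact mul_le_mul (f.norm_coe_le_norm _) ((norm_mulVec_le a _).trans
        (mul_le_mul_of_nonneg_left (ξ.norm_coe_le_norm _) (Nat.cast_nonneg _)))
        (norm_nonneg _) (norm_nonneg _))

/-- The value `p^*((ξ, η)_x) = ∫ Ad_a(η_{pa} ⊗ ξ_{pa}^*) da` of the `Cliff(M)`-valued inner product
in a trivialization `p` over `x`. The integrand depends only on the class of `a` in `PU(N)`. -/
def ipAt (ξ η : Triv g →ᵇ VNat n) (p : Triv g) : Mat n :=
  ∫ a, adIso a (Matrix.vecMulVec (η (p.act a)) (star (ξ (p.act a)))) ∂haarSU n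

variable (g) in
/-- The space `C(P, ℂ^N)`, to be equipped with the seminorm `ξ ↦ ‖(ξ, ξ)‖^{1/2}`. -/
def PreMod : Type u := Triv g →ᵇ VNat n

instance : AddCommGroup (PreMod g) := inferInstanceAs (AddCommGroup (Triv g →ᵇ VNat n))
instance : Module ℂ (PreMod g) := inferInstanceAs (Module ℂ (Triv g →ᵇ VNat n))

/-- The identification of `C(P, ℂ^N)` with its seminormed copy. -/
def toPre : (Triv g →ᵇ VNat n) ≃ₗ[ℂ] PreMod g := LinearEquiv.refl ℂ _

instance : Norm (PreMod g) :=
  ⟨fun ξ => √(⨆ p : Triv g, ‖ipAt (toPre.symm ξ) (toPre.symm ξ) p‖)⟩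

/-- An operator `T` with `(ξ, ξ) = T^* T` at `p`. -/
def ipOp (ξ : Triv g →ᵇ VNat n) (p : Triv g) :
    EuclideanSpace ℂ (Fin (spinDim n)) →L[ℂ] MeasureTheory.Lp ℂ 2 (haarSU n) :=
  LinearMap.toContinuousLinearMap
    { toFun := fun w => ContinuousMap.toLp (E := ℂ) 2 (haarSU n) ℂ
        ⟨fun a => star ((a : Mat n).mulVec (ξ (p.act a))) ⬝ᵥ w.ofLp, by
          have h : Continuous fun a : SU n => p.act a :=
            continuous_act.comp (by fun_prop : Continuous fun a : SU n => (p, a))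
          have h' : Continuous fun a : SU n => (a : Mat n).mulVec (ξ (p.act a)) :=
            (by fun_prop : Continuous fun a : SU n => (a : Mat n)).matrix_mulVec
              (ξ.continuous.comp h)
          exact h'.star.dotProduct continuous_const⟩
      map_add' := fun v w => by
        rw [← map_add]
        congr 1
        ext a
        simp [dotProduct_add]
      map_smul' := fun c w => by
        rw [RingHom.id_apply, ← map_smul]
        congr 1
        ext a
        simp }

theorem ipOp_add (ξ η : Triv g →ᵇ VNat n) (p : Triv g) : ipOp (ξ + η) p = ipOp ξ p + ipOp η p := by
  ext1 w
  change ContinuousMap.toLp (E := ℂ) 2 (haarSU n) ℂ _ =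
    ContinuousMap.toLp (E := ℂ) 2 (haarSU n) ℂ _ + ContinuousMap.toLp (E := ℂ) 2 (haarSU n) ℂ _
  rw [← map_add]
  congr 1
  ext a
  simp [Matrix.mulVec_add, add_dotProduct]

theorem ipOp_smul (c : ℂ) (ξ : Triv g →ᵇ VNat n) (p : Triv g) :
    ipOp (c • ξ) p = star c • ipOp ξ p := by
  ext1 w
  change ContinuousMap.toLp (E := ℂ) 2 (haarSU n) ℂ _ =
    star c • ContinuousMap.toLp (E := ℂ) 2 (haarSU n) ℂ _
  rw [← map_smul]
  congr 1
  ext a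
  simp [Matrix.mulVec_smul]

theorem continuous_act_right (p : Triv g) : Continuous fun a : SU n => p.act a :=
  continuous_act.comp (by fun_prop : Continuous fun a : SU n => (p, a))

theorem continuous_ipAt_integrand (ξ η : Triv g →ᵇ VNat n) (p : Triv g) :
    Continuous fun a : SU n =>
      adIso a (Matrix.vecMulVec (η (p.act a)) (star (ξ (p.act a)))) := by
  have h := continuous_act_right p
  have ha : Continuous fun a : SU n => (a : Mat n) := by fun_prop
  exact (ha.mul ((η.continuous.comp h).matrix_vecMulVec (ξ.continuous.comp h).star)).mul ha.star

theorem norm_ipAt (ξ : Triv g →ᵇ VNat n) (p : Triv g) : ‖ipAt ξ ξ p‖ = ‖ipOp ξ p‖ ^ 2 := by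
  have key : Matrix.toEuclideanCLM (n := Fin (spinDim n)) (𝕜 := ℂ) (ipAt ξ ξ p) =
      ContinuousLinearMap.adjoint (ipOp ξ p) ∘L ipOp ξ p := by
    ext1 w
    refine ext_inner_left ℂ fun v => ?_
    rw [ContinuousLinearMap.comp_apply, ContinuousLinearMap.adjoint_inner_right]
    let L : Mat n →ₗ[ℂ] ℂ :=
      { toFun := fun A => (A.mulVec w.ofLp) ⬝ᵥ star v.ofLp
        map_add' := fun A B => by simp [Matrix.add_mulVec, add_dotProduct]
        map_smul' := fun c A => by simp [Matrix.smul_mulVec] }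
    have hL : inner ℂ v (Matrix.toEuclideanCLM (n := Fin (spinDim n)) (𝕜 := ℂ) (ipAt ξ ξ p) w) =
        LinearMap.toContinuousLinearMap L (ipAt ξ ξ p) := by
      rw [EuclideanSpace.inner_eq_star_dotProduct]
      rfl
    rw [hL, ipAt, ← ContinuousLinearMap.integral_comp_comm _
      (integrable_haarSU (continuous_ipAt_integrand ξ ξ p))]
    refine Eq.trans ?_ (MeasureTheory.ContinuousMap.inner_toLp (haarSU n) _ _).symm
    refine MeasureTheory.integral_congr_ae (MeasureTheory.ae_of_all _ fun a => ?_)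
    change ((adIso a (Matrix.vecMulVec (ξ (p.act a)) (star (ξ (p.act a))))).mulVec w.ofLp) ⬝ᵥ
      star v.ofLp = (star ((a : Mat n).mulVec (ξ (p.act a))) ⬝ᵥ w.ofLp) *
        (starRingEnd ℂ) (star ((a : Mat n).mulVec (ξ (p.act a))) ⬝ᵥ v.ofLp)
    have e : adIso a (Matrix.vecMulVec (ξ (p.act a)) (star (ξ (p.act a)))) =
        Matrix.vecMulVec ((a : Mat n).mulVec (ξ (p.act a)))
          (star ((a : Mat n).mulVec (ξ (p.act a)))) := by
      rw [adIso_apply, Matrix.mul_vecMulVec, Matrix.vecMulVec_mul, Matrix.star_mulVec,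
        Matrix.star_eq_conjTranspose]
    rw [e, Matrix.vecMulVec_mulVec]
    generalize (a : Mat n).mulVec (ξ (p.act a)) = u
    have e' : (starRingEnd ℂ) (star u ⬝ᵥ v.ofLp) = u ⬝ᵥ star v.ofLp := by
      simp [dotProduct, mul_comm]
    rw [e']
    simp
  rw [Matrix.cstar_norm_def, key, ContinuousLinearMap.norm_adjoint_comp_self, sq]

theorem bddAbove_ipAt (ξ : Triv g →ᵇ VNat n) :
    BddAbove (Set.range fun p : Triv g => ‖ipAt ξ ξ p‖) := by
  have hK : IsCompact (Metric.closedBall (0 : VNat n) ‖ξ‖ ×ˢ (Set.univ : Set (SU n))) :=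
    (isCompact_closedBall _ _).prod isCompact_univ
  have hc : Continuous fun q : VNat n × SU n =>
      ‖adIso q.2 (Matrix.vecMulVec q.1 (star q.1))‖ := by
    have ha : Continuous fun q : VNat n × SU n => (q.2 : Mat n) := by fun_prop
    exact ((ha.mul (continuous_fst.matrix_vecMulVec continuous_fst.star)).mul ha.star).norm
  obtain ⟨C, hC⟩ := hK.bddAbove_image hc.continuousOn
  refine ⟨C, ?_⟩
  rintro _ ⟨p, rfl⟩
  refine norm_integral_haarSU_le fun a => hC ⟨(ξ (p.act a), a), ⟨?_, trivial⟩, rfl⟩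
  rw [mem_closedBall_zero_iff]
  exact ξ.norm_coe_le_norm _

theorem norm_ipOp_le (ξ : PreMod g) (p : Triv g) : ‖ipOp (toPre.symm ξ) p‖ ≤ ‖ξ‖ := by
  change _ ≤ √(⨆ p : Triv g, ‖ipAt (toPre.symm ξ) (toPre.symm ξ) p‖)
  refine Real.le_sqrt_of_sq_le ?_
  rw [← norm_ipAt]
  exact le_ciSup (bddAbove_ipAt _) p

theorem norm_le_of_ipOp (ξ : PreMod g) (C : ℝ) (hC : 0 ≤ C) (h : ∀ p, ‖ipOp (toPre.symm ξ) p‖ ≤ C) :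
    ‖ξ‖ ≤ C := by
  change √(⨆ p : Triv g, ‖ipAt (toPre.symm ξ) (toPre.symm ξ) p‖) ≤ C
  refine Real.sqrt_le_iff.mpr ⟨hC, Real.iSup_le (fun p => ?_) (sq_nonneg C)⟩
  rw [norm_ipAt]
  exact pow_le_pow_left₀ (norm_nonneg _) (h p) 2

theorem norm_smul_le' (c : ℂ) (ξ : PreMod g) : ‖c • ξ‖ ≤ ‖c‖ * ‖ξ‖ := by
  refine norm_le_of_ipOp _ _ (mul_nonneg (norm_nonneg c) (Real.sqrt_nonneg _)) fun p => ?_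
  rw [map_smul, ipOp_smul, norm_smul, norm_star]
  exact mul_le_mul_of_nonneg_left (norm_ipOp_le ξ p) (norm_nonneg c)

theorem preModCore : SeminormedSpace.Core ℂ (PreMod g) where
  norm_nonneg _ := Real.sqrt_nonneg _
  norm_triangle ξ η := by
    refine norm_le_of_ipOp _ _ (add_nonneg (Real.sqrt_nonneg _) (Real.sqrt_nonneg _)) fun p => ?_
    rw [map_add, ipOp_add]
    exact (norm_add_le _ _).trans (add_le_add (norm_ipOp_le ξ p) (norm_ipOp_le η p))
  norm_smul c ξ := by
    refine le_antisymm (norm_smul_le' c ξ) ?_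
    rcases eq_or_ne c 0 with rfl | hc
    · rw [norm_zero, zero_mul]
      exact Real.sqrt_nonneg _
    · have h := norm_smul_le' c⁻¹ (c • ξ)
      rw [smul_smul, inv_mul_cancel₀ hc, one_smul, norm_inv] at h
      have hc' : 0 < ‖c‖ := norm_pos_iff.mpr hc
      calc ‖c‖ * ‖ξ‖ ≤ ‖c‖ * (‖c‖⁻¹ * ‖c • ξ‖) := mul_le_mul_of_nonneg_left h hc'.le
        _ = ‖c • ξ‖ := by rw [← mul_assoc, mul_inv_cancel₀ hc'.ne', one_mul]

instance : SeminormedAddCommGroup (PreMod g) := SeminormedAddCommGroup.ofCore preModCore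
instance : NormedSpace ℂ (PreMod g) where
  norm_smul_le c ξ := norm_smul_le' c ξ

variable (g) in
/-- The completion `ℱ` of `C(P, ℂ^N)` with respect to the norm `‖(ξ, ξ)‖^{1/2}`. -/
abbrev ModF : Type u := UniformSpace.Completion (PreMod g)

/-- The canonical map `C(P, ℂ^N) → ℱ`. -/
def toF (ξ : Triv g →ᵇ VNat n) : ModF g := (toPre ξ : UniformSpace.Completion (PreMod g))

end Geometry

/-! ### Strong Morita equivalence -/

/-- The structure of a strong Morita equivalence bimodule (imprimitivity bimodule) between the
C⋆-algebras `A` and `B` on the Banach space `X`: it is a full left Hilbert `A`-module and a full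
right Hilbert `B`-module, `A` and `B` act by adjointable operators for the inner product
with values in the other algebra, and `⟨x, y⟩_A z = x ⟨y, z⟩_B`. -/
structure MoritaBimodule (A B X : Type*) [NonUnitalCStarAlgebra A] [NonUnitalCStarAlgebra B]
    [NormedAddCommGroup X] [NormedSpace ℂ X] [CompleteSpace X] where
  /-- The left action, `lsmul a x = a x`. -/
  lsmul : A →ₗ[ℂ] X →ₗ[ℂ] X
  /-- The right action, `rsmul b x = x b`. -/
  rsmul : B →ₗ[ℂ] X →ₗ[ℂ] X
  /-- The left inner product, linear in the first variable. -/
  linner : X →ₗ[ℂ] X →ₗ⋆[ℂ] A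
  /-- The right inner product, linear in the second variable. -/
  rinner : X →ₗ⋆[ℂ] X →ₗ[ℂ] B
  mul_lsmul : ∀ a a' x, lsmul (a * a') x = lsmul a (lsmul a' x)
  mul_rsmul : ∀ b b' x, rsmul (b * b') x = rsmul b' (rsmul b x)
  lsmul_rsmul : ∀ a b x, lsmul a (rsmul b x) = rsmul b (lsmul a x)
  linner_lsmul : ∀ a x y, linner (lsmul a x) y = a * linner x y
  rinner_rsmul : ∀ b x y, rinner x (rsmul b y) = rinner x y * b
  star_linner : ∀ x y, star (linner x y) = linner y x
  star_rinner : ∀ x y, star (rinner x y) = rinner y x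
  linner_self_nonneg : ∀ x, ∃ a, linner x x = star a * a
  rinner_self_nonneg : ∀ x, ∃ b, rinner x x = star b * b
  norm_linner_self : ∀ x, ‖linner x x‖ = ‖x‖ ^ 2
  norm_rinner_self : ∀ x, ‖rinner x x‖ = ‖x‖ ^ 2
  linner_full : Dense (Submodule.span ℂ {a | ∃ x y, a = linner x y} : Set A)
  rinner_full : Dense (Submodule.span ℂ {b | ∃ x y, b = rinner x y} : Set B)
  rinner_lsmul : ∀ a x y, rinner (lsmul a x) y = rinner x (lsmul (star a) y)
  linner_rsmul : ∀ b x y, linner (rsmul b x) y = linner x (rsmul (star b) y)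
  linner_lsmul_eq : ∀ x y z, lsmul (linner x y) z = rsmul (rinner y z) x

end ProjDirac
end

noncomputable section
namespace ProjDirac

/-! ### Completion of a pre-imprimitivity bimodule -/

section Abstract

variable {A B X₀ A₀ E F : Type*} [NonUnitalCStarAlgebra A] [NonUnitalCStarAlgebra B]
  [SeminormedAddCommGroup X₀] [NormedSpace ℂ X₀] [AddCommGroup A₀] [Module ℂ A₀]
  [AddCommGroup E] [Module ℂ E] [NormedAddCommGroup F] [NormedSpace ℂ F] [CompleteSpace F]

/-! The bimodule is first built on $C(P,\mathbb C^N)$ and then completed. The left inner product is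
the function $\theta_{\xi,\eta}(a,p)=\langle a\eta(pa),\xi(p)\rangle$ (`rankOne`), conjugate linear
in $\eta$. Since $(\xi,c\eta)=c(\xi,\eta)$, the Clifford algebra acts naturally from the left; the
$*$-preserving anti-automorphism $\tau$ turns this into a right Hilbert module with inner product
$\tau((\xi,\eta))$. The imprimitivity relation becomes $\theta_{\xi,\eta}\zeta=(\eta,\zeta)\xi$
(`convAct_rankOne`). It is the identity $\langle
a\eta,\xi\rangle\,a\zeta=(a\zeta\otimes(a\eta)^*)\xi$, integrated over $a$.

Everything must be bounded for the norm of $\mathcal F$. At each $p$ one has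
$(\xi,\eta)=T_\eta^*T_\xi$ with $T_\xi$ valued in $L^2(SU(N))$, whence Cauchy–Schwarz and positivity
(`toEuclideanCLM_ipAt`). The convolution algebra acts on matrix coefficients along an orbit of $P$
by a representation on $L^2(SU(N))$. That representation is one of those defining the enveloping
norm, so the action is contractive (`norm_convAct_le`). Conversely,
$\theta_{\xi,\eta}^*\theta_{\xi,\eta}=\theta_{(\xi,\xi)\eta,\eta}$. Together with the C*-identity
this bounds $\theta_{\xi,\eta}$ in every representation at once, without classifying representations
(`norm_univRep_rankOne_self`).

The right inner product is full because $\sum_i(e_i,e_i)=1$. For the left one, two points $(a,p)$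
have the same image under $(a,p)\mapsto(p,pa)$ only if they differ by the centre of $SU(N)$. An
element of `natFun` times a matrix entry therefore descends to the image in $P\times P$, where
Stone–Weierstrass approximates it by sums of $\varphi(p)\psi(q)$, and these give rank one functions
(`exists_mem_rankOneSpan_near`). This uses that $P$ is compact Hausdorff.

The remaining axioms on the completion, including positivity of the left inner product, follow
formally from the imprimitivity relation (`PreMorita.exists_completion`). -/

/-- The bound `N a` makes each `Φ a` extend along the dense isometry `e`; linearity in `a` survives
because both sides agree on the range of `e`. Allowing semilinear maps lets one lemma serve both
actions and both inner products. -/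
theorem exists_extend_right {X : Type*} [NormedAddCommGroup X] [NormedSpace ℂ X] {e : X₀ →ₗ[ℂ] X}
    (he : DenseRange e) (he' : ∀ ξ, ‖e ξ‖ = ‖ξ‖) {σ₁ σ₂ : ℂ →+* ℂ} [RingHomIsometric σ₂]
    (Φ : E →ₛₗ[σ₁] X₀ →ₛₗ[σ₂] F) (N : E → ℝ) (h : ∀ a ξ, ‖Φ a ξ‖ ≤ N a * ‖ξ‖) :
    ∃ Ψ : E →ₛₗ[σ₁] (X →SL[σ₂] F), (∀ a ξ, Ψ a (e ξ) = Φ a ξ) ∧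
      ∀ a x, ‖Ψ a x‖ ≤ N a * ‖x‖ := by
  have h' : ∀ a ξ, ‖Φ a ξ‖ ≤ N a * ‖e ξ‖ := fun a ξ => by
    rw [he']; exact h a ξ
  have key : ∀ a ξ, (Φ a).extendOfNorm e (e ξ) = Φ a ξ := fun a ξ =>
    LinearMap.extendOfNorm_eq he ⟨N a, h' a⟩ ξ
  refine ⟨⟨⟨fun a => (Φ a).extendOfNorm e, fun a₁ a₂ => ?_⟩, fun c a => ?_⟩,
    fun a ξ => key a ξ, fun a x => LinearMap.norm_extendOfNorm_apply_le he _ (h' a) x⟩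
  · refine ContinuousLinearMap.coeFn_injective (he.equalizer
      (map_continuous _) (map_continuous _) (funext fun ξ => ?_))
    rw [Function.comp_apply, Function.comp_apply, key, add_apply, key, key, map_add,
      LinearMap.add_apply]
  · refine ContinuousLinearMap.coeFn_injective (he.equalizer
      (map_continuous _) (map_continuous _) (funext fun ξ => ?_))
    rw [Function.comp_apply, Function.comp_apply, key, smul_apply, key, map_smulₛₗ,
      LinearMap.smul_apply]

variable (A B X₀ A₀) in
/-- Pre-imprimitivity bimodules: `A₀` maps onto a dense subspace of `A` and acts on the seminormed
space `X₀`, on which `B` acts from the right; the completion of `X₀` is an imprimitivity bimodule,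
see `PreMorita.exists_completion`. -/
structure PreMorita where
  /-- The map to `A`. -/
  ι : A₀ →ₗ[ℂ] A
  dense : DenseRange ι
  /-- The left action. -/
  l : A₀ →ₗ[ℂ] X₀ →ₗ[ℂ] X₀
  /-- The right action. -/
  r : B →ₗ[ℂ] X₀ →ₗ[ℂ] X₀
  /-- The left inner product. -/
  li : X₀ →ₗ[ℂ] X₀ →ₗ⋆[ℂ] A
  /-- The right inner product. -/
  ri : X₀ →ₗ⋆[ℂ] X₀ →ₗ[ℂ] B
  norm_l : ∀ f ξ, ‖l f ξ‖ ≤ ‖ι f‖ * ‖ξ‖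
  norm_r : ∀ b ξ, ‖r b ξ‖ ≤ ‖b‖ * ‖ξ‖
  norm_li : ∀ ξ η, ‖li ξ η‖ ≤ ‖ξ‖ * ‖η‖
  norm_ri : ∀ ξ η, ‖ri ξ η‖ ≤ ‖ξ‖ * ‖η‖
  norm_ri_self : ∀ ξ, ‖ri ξ ξ‖ = ‖ξ‖ ^ 2
  r_mul : ∀ b b' ξ, r (b * b') ξ = r b' (r b ξ)
  li_l : ∀ f ξ η, li (l f ξ) η = ι f * li ξ η
  li_r : ∀ b ξ η, li (r b ξ) η = li ξ (r (star b) η)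
  ri_r : ∀ b ξ η, ri ξ (r b η) = ri ξ η * b
  star_li : ∀ ξ η, star (li ξ η) = li η ξ
  star_ri : ∀ ξ η, star (ri ξ η) = ri η ξ
  ri_self : ∀ ξ, ∃ b, ri ξ ξ = star b * b
  li_full : Dense (Submodule.span ℂ {a | ∃ x y, a = li x y} : Set A)
  ri_full : Dense (Submodule.span ℂ {b | ∃ x y, b = ri x y} : Set B)
  exists_li : ∀ ξ η, ∃ f, ι f = li ξ η ∧ ∀ ζ, l f ζ = r (ri η ζ) ξ

/-- The extensions of the four operations to a completion `X` of `X₀`. -/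
theorem PreMorita.exists_extensions (D : PreMorita A B X₀ A₀) {X : Type*} [NormedAddCommGroup X]
    [NormedSpace ℂ X] [CompleteSpace X] {e : X₀ →ₗ[ℂ] X}
    (he : DenseRange e) (he' : ∀ ξ, ‖e ξ‖ = ‖ξ‖) :
    ∃ (L : A →L[ℂ] X →L[ℂ] X) (R : B →L[ℂ] X →L[ℂ] X)
      (I : X →L[ℂ] X →L⋆[ℂ] A) (J : X →L⋆[ℂ] X →L[ℂ] B),
      (∀ f ξ, L (D.ι f) (e ξ) = e (D.l f ξ)) ∧ (∀ b ξ, R b (e ξ) = e (D.r b ξ)) ∧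
      (∀ ξ η, I (e ξ) (e η) = D.li ξ η) ∧ (∀ ξ η, J (e ξ) (e η) = D.ri ξ η) ∧
      (∀ a x, ‖L a x‖ ≤ ‖a‖ * ‖x‖) ∧ (∀ x y, ‖I x y‖ ≤ ‖x‖ * ‖y‖) ∧
      ∀ x y, ‖J x y‖ ≤ ‖x‖ * ‖y‖ := by
  obtain ⟨L₀, hL₀, hL₀'⟩ := exists_extend_right he he'
    (D.l.compr₂ e) (fun f => ‖D.ι f‖) (fun f ξ => by
      rw [LinearMap.compr₂_apply, he']; exact D.norm_l f ξ)
  obtain ⟨R₀, hR₀, hR₀'⟩ := exists_extend_right he he'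
    (D.r.compr₂ e) (fun b => ‖b‖) (fun b ξ => by
      rw [LinearMap.compr₂_apply, he']; exact D.norm_r b ξ)
  obtain ⟨I₀, hI₀, hI₀'⟩ := exists_extend_right he he' D.li (fun ξ => ‖ξ‖) D.norm_li
  obtain ⟨J₀, hJ₀, hJ₀'⟩ := exists_extend_right he he' D.ri (fun ξ => ‖ξ‖) D.norm_ri
  -- Now the first variable is extended. The operator norm is controlled by `‖D.ι f‖` alone, so `L₀`
  -- factors through `D.ι` although `D.ι` is not assumed injective.
  have bL : ∀ f, ‖L₀ f‖ ≤ 1 * ‖D.ι f‖ := fun f => by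
    rw [one_mul]; exact (L₀ f).opNorm_le_bound (norm_nonneg _) (hL₀' f)
  have bI : ∀ ξ, ‖I₀ ξ‖ ≤ 1 * ‖e ξ‖ := fun ξ => by
    rw [one_mul, he']
    exact (I₀ ξ).opNorm_le_bound (norm_nonneg ξ) (hI₀' ξ)
  have bJ : ∀ ξ, ‖J₀ ξ‖ ≤ 1 * ‖e ξ‖ := fun ξ => by
    rw [one_mul, he']
    exact (J₀ ξ).opNorm_le_bound (norm_nonneg ξ) (hJ₀' ξ)
  refine ⟨L₀.extendOfNorm D.ι, R₀.mkContinuous 1 fun b => ?_, I₀.extendOfNorm e,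
    J₀.extendOfNorm e, fun f ξ => ?_, hR₀, fun ξ η => ?_, fun ξ η => ?_,
    fun a x => ?_, fun x y => ?_, fun x y => ?_⟩
  · rw [one_mul]; exact (R₀ b).opNorm_le_bound (norm_nonneg _) (hR₀' b)
  · rw [LinearMap.extendOfNorm_eq D.dense ⟨1, bL⟩]; exact hL₀ f ξ
  · rw [LinearMap.extendOfNorm_eq he ⟨1, bI⟩]
    exact hI₀ ξ _
  · rw [LinearMap.extendOfNorm_eq he ⟨1, bJ⟩]
    exact hJ₀ ξ _
  · refine ((L₀.extendOfNorm D.ι a).le_opNorm x).trans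
      (mul_le_mul_of_nonneg_right ?_ (norm_nonneg x))
    simpa using LinearMap.norm_extendOfNorm_apply_le D.dense 1 bL a
  · refine ((I₀.extendOfNorm e x).le_opNorm y).trans
      (mul_le_mul_of_nonneg_right ?_ (norm_nonneg y))
    simpa using LinearMap.norm_extendOfNorm_apply_le he 1 bI x
  · refine ((J₀.extendOfNorm e x).le_opNorm y).trans
      (mul_le_mul_of_nonneg_right ?_ (norm_nonneg y))
    simpa using LinearMap.norm_extendOfNorm_apply_le he 1 bJ x

/-- An element `a` of a C⋆-algebra which is annihilated from the left by a dense subspace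
vanishes. -/
theorem eq_zero_of_dense_mul {S : Submodule ℂ B} (hS : Dense (S : Set B)) {b : B}
    (h : ∀ s ∈ S, s * b = 0) : b = 0 := by
  have : ∀ s : B, s * b = 0 := fun s =>
    hS.induction (P := fun s => s * b = 0) h (isClosed_eq (by fun_prop) (by fun_prop)) s
  exact CStarRing.star_mul_self_eq_zero_iff b |>.mp (this _)

/-- In an imprimitivity bimodule, positivity of the left inner product follows from that of the
right one. -/
theorem exists_eq_star_mul_self_of_imprimitivity {X : Type*} [NormedAddCommGroup X] [NormedSpace ℂ X]
    (L : A →L[ℂ] X →L[ℂ] X) (R : B →L[ℂ] X →L[ℂ] X) (I : X →L[ℂ] X →L⋆[ℂ] A)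
    (J : X →L⋆[ℂ] X →L[ℂ] B) (mulL : ∀ a a' x, L (a * a') x = L a (L a' x))
    (IL : ∀ a x y, I (L a x) y = a * I x y) (JR : ∀ b x y, J x (R b y) = J x y * b)
    (starI : ∀ x y, star (I x y) = I y x) (JL : ∀ a x y, J (L a x) y = J x (L (star a) y))
    (Jpos : ∀ x, ∃ b, J x x = star b * b) (nI : ∀ x y, ‖I x y‖ ≤ ‖x‖ * ‖y‖)
    (nJ : ∀ x, ‖J x x‖ = ‖x‖ ^ 2) (LI : ∀ x y z, L (I x y) z = R (J y z) x) (x : X) :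
    ∃ a, I x x = star a * a := by
  let _ := CStarAlgebra.spectralOrder A
  have := CStarAlgebra.spectralOrderedRing A
  let _ := CStarAlgebra.spectralOrder B
  have := CStarAlgebra.spectralOrderedRing B
  have hsa : IsSelfAdjoint (I x x) := starI x x
  set h := I x x with hh
  set k := h⁻ with hk
  have hk0 : 0 ≤ k := CFC.negPart_nonneg h
  have hksa : star k = k := (IsSelfAdjoint.of_nonneg hk0)
  -- The positive and negative parts of `h` are orthogonal, so multiplication by `k` sees only `-k`.
  -- Testing on `y = k x` then gives `I y y = k h k = -k³`.
  have e : k * h = -(k * k) := by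
    conv_lhs => rw [← CFC.posPart_sub_negPart h hsa, mul_sub, hk, CFC.negPart_mul_posPart, zero_sub]
  obtain ⟨t, ht⟩ := CStarAlgebra.nonneg_iff_eq_star_mul_self.mp hk0
  set y := L k x with hy
  have hyy : I y y = -(k * k * k) := by
    have : I x y = h * k := by rw [← starI y x, hy, IL, star_mul, hksa, hsa]
    rw [hy, IL, ← hy, this, ← mul_assoc, e, neg_mul]
  -- By imprimitivity `J y y * J y y = J y (I y y · y)`. Writing `k = t* t` gives `k³ = (t k)* (t
  -- k)`, which moves across `J` and exhibits the square as minus a positive element.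
  have hJ : J y y * J y y = - J (L (t * k) y) (L (t * k) y) := by
    have : star (t * k) * (t * k) = k * k * k := by
      rw [star_mul, hksa, mul_assoc k, ← mul_assoc (star t), ← ht, mul_assoc]
    rw [← JR, ← LI, hyy, JL (t * k), ← mulL (star (t * k)), this, map_neg]
    simp
  obtain ⟨b, hb⟩ := Jpos y
  obtain ⟨c, hc⟩ := Jpos (L (t * k) y)
  have hJsa : star (J y y) = J y y := by rw [hb, star_mul, star_star]
  -- The square of the self-adjoint `J y y` is both nonnegative and nonpositive. Hence `y = 0`, so
  -- `k³ = 0`, and the C*-identity lowers the power until `k = 0`.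
  have h0 : star (J y y) * J y y = 0 := by
    refine le_antisymm ?_ (star_mul_self_nonneg _)
    rw [hJsa, hJ, hc, neg_nonpos]
    exact star_mul_self_nonneg _
  have hy0 : ‖y‖ ^ 2 = 0 := by rw [← nJ, (CStarRing.star_mul_self_eq_zero_iff _).mp h0, norm_zero]
  have hk3 : k * k * k = 0 := by
    have : ‖I y y‖ ≤ 0 := (nI y y).trans (by rw [← sq, hy0])
    rw [hyy, norm_neg] at this
    exact norm_le_zero_iff.mp this
  have hk2 : k * k = 0 := by
    have : star (k * k) * (k * k) = 0 := by rw [star_mul, hksa, ← mul_assoc, hk3, zero_mul]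
    exact (CStarRing.star_mul_self_eq_zero_iff _).mp this
  have hk1 : k = 0 := by
    refine (CStarRing.star_mul_self_eq_zero_iff _).mp ?_
    rw [hksa, hk2]
  refine CStarAlgebra.nonneg_iff_eq_star_mul_self.mp ?_
  rw [← CFC.posPart_sub_negPart h hsa, ← hk, hk1, sub_zero]
  exact CFC.posPart_nonneg h

theorem PreMorita.exists_completion (D : PreMorita A B X₀ A₀) {X : Type*} [NormedAddCommGroup X]
    [NormedSpace ℂ X] [CompleteSpace X] {e : X₀ →ₗ[ℂ] X}
    (he : DenseRange e) (he' : ∀ ξ, ‖e ξ‖ = ‖ξ‖) :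
    ∃ S : MoritaBimodule A B X, (∀ ξ η, S.rinner (e ξ) (e η) = D.ri ξ η) ∧
      (∀ b ξ, S.rsmul b (e ξ) = e (D.r b ξ)) ∧ ∀ f ξ, S.lsmul (D.ι f) (e ξ) = e (D.l f ξ) := by
  obtain ⟨L, R, I, J, hL, hR, hI, hJ, nL, nI, nJ⟩ := D.exists_extensions he he'
  have ind : ∀ {P : X → Prop}, IsClosed {x | P x} → (∀ ξ, P (e ξ)) → ∀ x, P x :=
    fun hc h x => he.induction_on x hc h
  have indA : ∀ {P : A → Prop}, IsClosed {x | P x} → (∀ f, P (D.ι f)) → ∀ a, P a :=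
    fun hc h a => D.dense.induction_on a hc h
  have mulR : ∀ b b' x, R (b * b') x = R b' (R b x) := fun b b' =>
    ind (isClosed_eq (by fun_prop) (by fun_prop)) fun ξ => by rw [hR, hR, hR, D.r_mul]
  have IL : ∀ a x y, I (L a x) y = a * I x y := fun a x y => by
    revert a
    refine indA (isClosed_eq (by fun_prop) (by fun_prop)) fun f => ?_
    revert x
    refine ind (isClosed_eq (by fun_prop) (by fun_prop)) fun ξ => ?_
    revert y
    refine ind (isClosed_eq (by fun_prop) (by fun_prop)) fun η => ?_
    rw [hL, hI, hI, D.li_l]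
  have IR : ∀ b x y, I (R b x) y = I x (R (star b) y) := fun b x y => by
    revert x
    refine ind (isClosed_eq (by fun_prop) (by fun_prop)) fun ξ => ?_
    revert y
    refine ind (isClosed_eq (by fun_prop) (by fun_prop)) fun η => ?_
    rw [hR, hR, hI, hI, D.li_r]
  have JR : ∀ b x y, J x (R b y) = J x y * b := fun b x y => by
    revert x
    refine ind (isClosed_eq (by fun_prop) (by fun_prop)) fun ξ => ?_
    revert y
    refine ind (isClosed_eq (by fun_prop) (by fun_prop)) fun η => ?_
    rw [hR, hJ, hJ, D.ri_r]
  have starI : ∀ x y, star (I x y) = I y x := fun x y => by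
    revert x
    refine ind (isClosed_eq (by fun_prop) (by fun_prop)) fun ξ => ?_
    revert y
    refine ind (isClosed_eq (by fun_prop) (by fun_prop)) fun η => ?_
    rw [hI, hI, D.star_li]
  have starJ : ∀ x y, star (J x y) = J y x := fun x y => by
    revert x
    refine ind (isClosed_eq (by fun_prop) (by fun_prop)) fun ξ => ?_
    revert y
    refine ind (isClosed_eq (by fun_prop) (by fun_prop)) fun η => ?_
    rw [hJ, hJ, D.star_ri]
  have LI : ∀ x y z, L (I x y) z = R (J y z) x := fun x y z => by
    revert x
    refine ind (isClosed_eq (by fun_prop) (by fun_prop)) fun ξ => ?_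
    revert y
    refine ind (isClosed_eq (by fun_prop) (by fun_prop)) fun η => ?_
    revert z
    refine ind (isClosed_eq (by fun_prop) (by fun_prop)) fun ζ => ?_
    obtain ⟨f, hf, hf'⟩ := D.exists_li ξ η
    rw [hI, hJ, hR, ← hf, hL, hf']
  have nJs : ∀ x, ‖J x x‖ = ‖x‖ ^ 2 :=
    ind (isClosed_eq (by fun_prop) (by fun_prop)) fun ξ => by
      rw [hJ, he', D.norm_ri_self]
  have Jpos : ∀ x, ∃ b, J x x = star b * b := by
    let _ := CStarAlgebra.spectralOrder B
    have := CStarAlgebra.spectralOrderedRing B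
    intro x
    rw [← CStarAlgebra.nonneg_iff_eq_star_mul_self]
    revert x
    refine ind (isClosed_le (by fun_prop) (by fun_prop)) fun ξ => ?_
    rw [hJ, CStarAlgebra.nonneg_iff_eq_star_mul_self]
    exact D.ri_self ξ
  have fullI : Dense (Submodule.span ℂ {a | ∃ x y, a = I x y} : Set A) := by
    refine D.li_full.mono (Submodule.span_mono ?_)
    rintro _ ⟨ξ, η, rfl⟩
    exact ⟨e ξ, e η, (hI ξ η).symm⟩
  have fullJ : Dense (Submodule.span ℂ {a | ∃ x y, a = J x y} : Set B) := by
    refine D.ri_full.mono (Submodule.span_mono ?_)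
    rintro _ ⟨ξ, η, rfl⟩
    exact ⟨e ξ, e η, (hJ ξ η).symm⟩
  -- If `x` is left-orthogonal to everything, then `(J x x)² = J x (R (J x x) x) = J x (L (I x x) x)
  -- = 0`, hence `x = 0`. Identities in `X` can thus be tested by pairing with `I`, where they
  -- reduce to the algebra of `A`.
  have sep : ∀ x, (∀ y, I x y = 0) → x = 0 := fun x hx => by
    have h1 : R (J x x) x = 0 := by rw [← LI, hx]; simp
    have h2 : star (J x x) * J x x = 0 := by rw [starJ, ← JR, h1, map_zero]
    have h3 := nJs x
    rw [(CStarRing.star_mul_self_eq_zero_iff _).mp h2, norm_zero] at h3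
    exact norm_eq_zero.mp (by simpa using h3.symm)
  have sep' : ∀ x x', (∀ y, I x y = I x' y) → x = x' := fun x x' hx =>
    sub_eq_zero.mp (sep _ fun y => by simp [hx y])
  have mulL : ∀ a a' x, L (a * a') x = L a (L a' x) := fun a a' x => sep' _ _ fun y => by
    rw [IL, IL, IL, mul_assoc]
  have LR : ∀ a b x, L a (R b x) = R b (L a x) := fun a b x => sep' _ _ fun y => by
    rw [IL, IR, IR, IL]
  have IL' : ∀ a x y, I x (L a y) = I x y * star a := fun a x y => by
    rw [← starI, IL, star_mul, starI]
  -- Multiplying the difference by some `J w z` on the left gives a `J w` of a vector that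
  -- imprimitivity rewrites through `I`; there adjointness is known. Fullness of `J` removes the
  -- multiplier.
  have JL : ∀ a x y, J (L a x) y = J x (L (star a) y) := fun a x y => by
    rw [← sub_eq_zero]
    refine eq_zero_of_dense_mul fullJ fun s hs => ?_
    refine Submodule.span_induction ?_ (zero_mul _) (fun s t _ _ hs ht => ?_) (fun c s _ hs => ?_) hs
    · rintro _ ⟨w, z, rfl⟩
      rw [← JR, map_sub, sub_apply, ← LI, ← LI, IL', mulL, sub_self, map_zero]
    · rw [add_mul, hs, ht, add_zero]
    · rw [smul_mul_assoc, hs, smul_zero]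
  refine ⟨{
    lsmul := (ContinuousLinearMap.coeLM ℂ).comp L.toLinearMap
    rsmul := (ContinuousLinearMap.coeLM ℂ).comp R.toLinearMap
    linner := LinearMap.mk₂'ₛₗ (RingHom.id ℂ) (starRingEnd ℂ) (fun x y => I x y)
      (fun x x' y => by simp) (fun c x y => by simp) (fun x y y' => by simp) (fun c x y => by simp)
    rinner := LinearMap.mk₂'ₛₗ (starRingEnd ℂ) (RingHom.id ℂ) (fun x y => J x y)
      (fun x x' y => by simp) (fun c x y => by simp) (fun x y y' => by simp) (fun c x y => by simp)
    mul_lsmul := mulL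
    mul_rsmul := mulR
    lsmul_rsmul := LR
    linner_lsmul := IL
    rinner_rsmul := JR
    star_linner := starI
    star_rinner := starJ
    linner_self_nonneg :=
      exists_eq_star_mul_self_of_imprimitivity L R I J mulL IL JR starI JL Jpos nI nJs LI
    rinner_self_nonneg := Jpos
    norm_linner_self := fun x => ?_
    norm_rinner_self := nJs
    linner_full := fullI
    rinner_full := fullJ
    rinner_lsmul := JL
    linner_rsmul := IR
    linner_lsmul_eq := LI }, hJ, hR, hL⟩
  refine le_antisymm ((nI x x).trans (sq _).ge) ?_
  rcases eq_or_ne x 0 with rfl | hx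
  · simp
  -- The reverse norm inequality: `‖x‖⁴ = ‖J x x‖² = ‖J x (I x x · x)‖ ≤ ‖I x x‖ ‖x‖²`.
  have h1 : ‖x‖ ^ 2 * ‖x‖ ^ 2 = ‖J x (L (I x x) x)‖ := by
    rw [← nJs, ← CStarRing.norm_star_mul_self, starJ, LI, JR]
  have h2 : ‖J x (L (I x x) x)‖ ≤ ‖I x x‖ * ‖x‖ ^ 2 := by
    refine (nJ _ _).trans ?_
    calc ‖x‖ * ‖L (I x x) x‖ ≤ ‖x‖ * (‖I x x‖ * ‖x‖) :=
          mul_le_mul_of_nonneg_left (nL _ _) (norm_nonneg _)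
      _ = ‖I x x‖ * ‖x‖ ^ 2 := by ring
  rw [← h1] at h2
  exact le_of_mul_le_mul_right h2 (by positivity)

end Abstract

end ProjDirac
end

noncomputable section
namespace ProjDirac

/-! ### The Clifford algebra of a tangent space -/

section CliffordFibre

universe u

variable {n : ℕ} {M : Type u} [TopologicalSpace M] [ChartedSpace (EuclideanSpace ℝ (Fin n)) M]
  [IsManifold (𝓡 n) ∞ M] {g : RiemMetric n M} {x : M}

theorem cliffForm_apply (v : TangentSpace (𝓡 n) x) : cliffForm g x v = -g.inner x v v := rfl

theorem cliffVec_add (v w : TangentSpace (𝓡 n) x) :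
    cliffVec g x (v + w) = cliffVec g x v + cliffVec g x w := by
  simp [cliffVec, TensorProduct.tmul_add]

theorem cliffVec_sub (v w : TangentSpace (𝓡 n) x) :
    cliffVec g x (v - w) = cliffVec g x v - cliffVec g x w := by
  simp [cliffVec, TensorProduct.tmul_sub]

theorem cliffVec_smul (r : ℝ) (v : TangentSpace (𝓡 n) x) :
    cliffVec g x (r • v) = (r : ℂ) • cliffVec g x v := by
  rw [cliffVec, cliffVec, map_smul, TensorProduct.tmul_smul, TensorProduct.smul_tmul',
    TensorProduct.smul_tmul']
  simp

instance : StarModule ℂ (CliffFibre g x) where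
  star_smul z c := by
    induction c using TensorProduct.induction_on with
    | zero => simp
    | tmul w a => simp [TensorProduct.smul_tmul']
    | add a b ha hb => rw [smul_add, star_add, star_add, smul_add, ha, hb]

theorem cliffVec_mul_self (v : TangentSpace (𝓡 n) x) :
    cliffVec g x v * cliffVec g x v = algebraMap ℂ _ (-(g.inner x v v : ℂ)) := by
  rw [cliffVec, Algebra.TensorProduct.tmul_mul_tmul, CliffordAlgebra.ι_sq_scalar, mul_one,
    Algebra.algebraMap_eq_smul_one (A := CliffordAlgebra _), TensorProduct.tmul_smul,
    cliffForm_apply, Algebra.TensorProduct.algebraMap_apply, TensorProduct.smul_tmul']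
  congr 1
  simp [Algebra.smul_def]

theorem star_cliffVec (v : TangentSpace (𝓡 n) x) : star (cliffVec g x v) = -cliffVec g x v := by
  simp [cliffVec, TensorProduct.tmul_neg]

theorem cliffFibre_induction {C : CliffFibre g x → Prop} (algebraMap : ∀ z, C (algebraMap ℂ _ z))
    (vec : ∀ v, C (cliffVec g x v)) (mul : ∀ a b, C a → C b → C (a * b))
    (add : ∀ a b, C a → C b → C (a + b)) (c : CliffFibre g x) : C c := by
  have h1 : ∀ a : CliffordAlgebra (cliffForm g x), C ((1 : ℂ) ⊗ₜ[ℝ] a) := fun a => by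
    induction a using CliffordAlgebra.induction with
    | algebraMap r =>
      convert algebraMap r
      rw [Algebra.algebraMap_eq_smul_one, TensorProduct.tmul_smul,
        Algebra.TensorProduct.algebraMap_apply, TensorProduct.smul_tmul']
      simp [Algebra.smul_def]
    | ι v => exact vec v
    | mul a b ha hb => simpa using mul _ _ ha hb
    | add a b ha hb => simpa [TensorProduct.tmul_add] using add _ _ ha hb
  induction c using TensorProduct.induction_on with
  | zero => simpa using algebraMap 0
  | tmul z a => simpa [Algebra.TensorProduct.algebraMap_apply] using mul _ _ (algebraMap z) (h1 a)
  | add a b ha hb => exact add _ _ ha hb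

theorem cliffFibre_hom_ext {B F₁ F₂ : Type*} [Ring B] [Algebra ℂ B]
    [FunLike F₁ (CliffFibre g x) B] [AlgHomClass F₁ ℂ (CliffFibre g x) B]
    [FunLike F₂ (CliffFibre g x) B] [AlgHomClass F₂ ℂ (CliffFibre g x) B] (φ : F₁) (ψ : F₂)
    (h : ∀ v, φ (cliffVec g x v) = ψ (cliffVec g x v)) (c : CliffFibre g x) : φ c = ψ c := by
  induction c using cliffFibre_induction with
  | algebraMap z => rw [AlgHomClass.commutes, AlgHomClass.commutes]
  | vec v => exact h v
  | mul a b ha hb => rw [map_mul, map_mul, ha, hb]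
  | add a b ha hb => rw [map_add, map_add, ha, hb]

/-- The universal property of `Cliff(T_x M)` for ⋆-algebras. -/
theorem exists_cliffHom {B : Type*} [Ring B] [Algebra ℂ B] [StarRing B] [StarModule ℂ B]
    (L : TangentSpace (𝓡 n) x →+ B) (hL : ∀ (r : ℝ) v, L (r • v) = (r : ℂ) • L v)
    (hmul : ∀ v, L v * L v = algebraMap ℂ B (-(g.inner x v v : ℂ)))
    (hstar : ∀ v, star (L v) = -L v) :
    ∃ φ : CliffFibre g x →⋆ₐ[ℂ] B, ∀ v, φ (cliffVec g x v) = L v := by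
  let _ : Algebra ℝ B := Algebra.compHom B (algebraMap ℝ ℂ)
  have : IsScalarTower ℝ ℂ B := IsScalarTower.of_algebraMap_eq fun r => rfl
  let L' : TangentSpace (𝓡 n) x →ₗ[ℝ] B :=
    { L with map_smul' := fun r v => hL r v }
  let ψ : CliffordAlgebra (cliffForm g x) →ₐ[ℝ] B := CliffordAlgebra.lift _ ⟨L', fun v => by
    rw [cliffForm_apply]
    refine (hmul v).trans ?_
    rw [IsScalarTower.algebraMap_apply ℝ ℂ B]
    simp⟩
  let φ : CliffFibre g x →ₐ[ℂ] B :=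
    Algebra.TensorProduct.lift (Algebra.ofId ℂ B) ψ fun z a => Algebra.commutes z (ψ a)
  have hφ : ∀ v, φ (cliffVec g x v) = L v := fun v => by
    refine (Algebra.TensorProduct.lift_tmul _ _ _ _ _).trans ?_
    rw [map_one, one_mul]
    exact CliffordAlgebra.lift_ι_apply _ _ _
  refine ⟨{ φ with map_star' := fun c => ?_ }, hφ⟩
  change φ (star c) = star (φ c)
  induction c using cliffFibre_induction with
  | algebraMap z => rw [← algebraMap_star_comm, AlgHom.commutes, AlgHom.commutes,
      algebraMap_star_comm]
  | vec v => rw [star_cliffVec, map_neg, hφ, hstar]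
  | mul a b ha hb => rw [star_mul, map_mul, map_mul, star_mul, ha, hb]
  | add a b ha hb => rw [star_add, map_add, map_add, star_add, ha, hb]

open scoped Bundle in
variable (g) in
/-- All tangent spaces of a Riemannian manifold are isometric. -/
theorem exists_isometry_tangentSpace (x y : M) :
    ∃ e : TangentSpace (𝓡 n) x ≃ₗ[ℝ] TangentSpace (𝓡 n) y,
      ∀ v, g.inner y (e v) (e v) = g.inner x v v := by
  let _ : Bundle.RiemannianBundle (fun x : M => TangentSpace (𝓡 n) x) := ⟨g.toRiemannianMetric⟩
  have fin : ∀ z : M, Module.finrank ℝ (TangentSpace (𝓡 n) z) = n := fun z =>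
    finrank_euclideanSpace_fin
  have (z : M) : FiniteDimensional ℝ (TangentSpace (𝓡 n) z) :=
    inferInstanceAs (FiniteDimensional ℝ (EuclideanSpace ℝ (Fin n)))
  let e : TangentSpace (𝓡 n) x ≃ₗᵢ[ℝ] TangentSpace (𝓡 n) y :=
    (stdOrthonormalBasis ℝ (TangentSpace (𝓡 n) x)).equiv
      (stdOrthonormalBasis ℝ (TangentSpace (𝓡 n) y)) (finCongr ((fin x).trans (fin y).symm))
  exact ⟨e.toLinearEquiv, fun v => e.inner_map_map v v⟩

variable (g) in
-- An isometry of tangent spaces induces a ⋆-homomorphism by the universal property, and the inverse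
-- isometry induces its inverse. Consequently one trivialization over a single point controls all
-- fibres.
theorem nonempty_cliffFibre_equiv (x y : M) : Nonempty (CliffFibre g x ≃⋆ₐ[ℂ] CliffFibre g y) := by
  have key : ∀ (x y : M) (e : TangentSpace (𝓡 n) x ≃ₗ[ℝ] TangentSpace (𝓡 n) y),
      (∀ v, g.inner y (e v) (e v) = g.inner x v v) →
      ∃ φ : CliffFibre g x →⋆ₐ[ℂ] CliffFibre g y,
        ∀ v, φ (cliffVec g x v) = cliffVec g y (e v) := fun x y e he =>
    exists_cliffHom ⟨⟨fun v => cliffVec g y (e v), by simp [cliffVec]⟩, fun v w => by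
      simp [cliffVec_add]⟩ (fun r v => by simp [cliffVec_smul]) (fun v => by
        simp only [AddMonoidHom.coe_mk, ZeroHom.coe_mk, cliffVec_mul_self, he])
      (fun v => star_cliffVec _)
  obtain ⟨e, he⟩ := exists_isometry_tangentSpace g x y
  obtain ⟨φ, hφ⟩ := key x y e he
  obtain ⟨ψ, hψ⟩ := key y x e.symm fun v => by rw [← he, e.apply_symm_apply]
  refine ⟨StarAlgEquiv.ofBijective φ
    (Function.bijective_iff_has_inverse.mpr ⟨ψ, fun c => ?_, fun c => ?_⟩)⟩
  · exact cliffFibre_hom_ext (ψ.comp φ) (StarAlgHom.id ℂ _) (fun v => by simp [hφ, hψ]) c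
  · exact cliffFibre_hom_ext (φ.comp ψ) (StarAlgHom.id ℂ _) (fun v => by simp [hφ, hψ]) c

end CliffordFibre

end ProjDirac
end

noncomputable section
namespace ProjDirac

/-! ### The topology of `P` -/

section Topology

universe u

variable {n : ℕ} {M : Type u} [TopologicalSpace M] [ChartedSpace (EuclideanSpace ℝ (Fin n)) M]
  [IsManifold (𝓡 n) ∞ M] {g : RiemMetric n M}

open Filter Topology

/-- A local extension of `v` is cut off by a bump function equal to `1` at `x`. This is why testing
against global vector fields determines a trivialization. -/
theorem exists_vectorField [T2Space M] (x : M) (v : TangentSpace (𝓡 n) x) :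
    ∃ X : VectorField n M, X.1 x = v := by
  obtain ⟨s, hs, hs'⟩ := FiberBundle.exists_contMDiffOn_extend (k := 1) (𝓡 n)
    (EuclideanSpace ℝ (Fin n)) (V := fun x : M => TangentSpace (𝓡 n) x) v
  obtain ⟨u, hus, hu, hxu⟩ := mem_nhds_iff.mp hs
  obtain ⟨f, -, hf⟩ := ((SmoothBumpFunction.nhds_basis_tsupport (I := 𝓡 n) x).mem_iff).mp
    (hu.mem_nhds hxu)
  have h := ContMDiffOn.smul_section_of_tsupport (V := fun x : M => TangentSpace (𝓡 n) x)
    (f.contMDiff.of_le (by norm_num)).contMDiffOn hu hf (hs'.mono hus)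
  refine ⟨⟨_, h.continuous⟩, ?_⟩
  change f x • _ = v
  rw [f.eq_one, one_smul, FiberBundle.extend_apply_self]

open scoped Bundle in
theorem continuous_inner_vectorField (g : RiemMetric n M) (X Y : VectorField n M) :
    Continuous fun x => g.inner x (X.1 x) (Y.1 x) := by
  let _ : Bundle.RiemannianBundle (fun x : M => TangentSpace (𝓡 n) x) := ⟨g.toRiemannianMetric⟩
  have : IsContinuousRiemannianBundle (EuclideanSpace ℝ (Fin n))
      (fun x : M => TangentSpace (𝓡 n) x) := ⟨⟨g.inner, g.contMDiff.continuous, fun _ _ _ => rfl⟩⟩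
  exact Continuous.inner_bundle (F := EuclideanSpace ℝ (Fin n))
    (E := fun x : M => TangentSpace (𝓡 n) x) X.2 Y.2

/-- The C*-identity together with `v* v = -v² = g(v, v)`: the operator norm of the image of a
tangent vector is its Riemannian length, whatever the trivialization. This uniform bound is the
source of compactness of `P`. -/
theorem norm_iso_cliffVec (p : Triv g) (v : TangentSpace (𝓡 n) p.base) :
    ‖p.iso (cliffVec g p.base v)‖ ^ 2 = g.inner p.base v v := by
  have h0 : 0 ≤ g.inner p.base v v := by
    rcases eq_or_ne v 0 with rfl | hv
    · simp
    · exact (g.pos _ v hv).le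
  rw [sq, ← CStarRing.norm_star_mul_self, ← map_star, star_cliffVec, map_neg, neg_mul,
    ← map_mul, cliffVec_mul_self, AlgHomClass.commutes, norm_neg, norm_algebraMap', norm_neg,
    Complex.norm_real, Real.norm_of_nonneg h0]

theorem continuous_iso_vectorField (X : VectorField n M) :
    Continuous fun p : Triv g => p.iso (cliffVec g p.base (X.1 p.base)) :=
  (continuous_triv_iff.mp continuous_id).2 X

theorem Triv.ext_cliffVec {p q : Triv g} (h : p.base = q.base)
    (h' : ∀ v : TangentSpace (𝓡 n) p.base,
      p.iso (cliffVec g p.base v) = q.iso (cliffVec g q.base (h ▸ v))) : p = q := by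
  obtain ⟨x, φ⟩ := p
  obtain ⟨y, ψ⟩ := q
  obtain rfl : x = y := h
  congr 1
  ext1 c
  exact cliffFibre_hom_ext φ ψ h' c

instance [T2Space M] : T2Space (Triv g) := by
  refine T2Space.of_injective_continuous (Y := M × (VectorField n M → Mat n))
    (f := fun p : Triv g => (p.base, fun X : VectorField n M =>
      p.iso (cliffVec g p.base (X.1 p.base)))) (fun p q h => ?_) continuous_induced_dom
  obtain ⟨h1, h2⟩ := Prod.mk.inj h
  refine Triv.ext_cliffVec h1 fun v => ?_
  obtain ⟨X, rfl⟩ := exists_vectorField p.base v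
  refine (congrFun h2 X).trans ?_
  congr 2
  obtain ⟨x, φ⟩ := p
  obtain ⟨y, ψ⟩ := q
  obtain rfl : x = y := h1
  rfl

/-- Along an ultrafilter on `P`, the matrices of a vector field converge. -/
theorem exists_tendsto_iso_vectorField (l : Ultrafilter (Triv g)) {x : M}
    (hx : Tendsto Triv.base (l : Filter (Triv g)) (𝓝 x)) (X : VectorField n M) :
    ∃ A : Mat n, Tendsto (fun p : Triv g => p.iso (cliffVec g p.base (X.1 p.base))) l (𝓝 A) := by
  have hc := ((continuous_inner_vectorField g X X).tendsto x).comp hx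
  have hev := hc.eventually (Iio_mem_nhds (lt_add_one _))
  have : ProperSpace (Mat n) := FiniteDimensional.proper ℂ (Mat n)
  set R := g.inner x (X.1 x) (X.1 x) + 1
  -- Near `x` the squared length of `X` stays below its value at `x` plus one, so the ultrafilter
  -- lives on a compact ball of matrices.
  have hmem : Metric.closedBall (0 : Mat n) √R ∈
      l.map fun p : Triv g => p.iso (cliffVec g p.base (X.1 p.base)) := by
    rw [Ultrafilter.mem_map]
    filter_upwards [hev] with p hp
    rw [Set.mem_preimage, mem_closedBall_zero_iff]
    refine Real.le_sqrt_of_sq_le ?_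
    rw [norm_iso_cliffVec]
    exact hp.le
  obtain ⟨A, -, hA⟩ := (isCompact_closedBall (0 : Mat n) √R).ultrafilter_le_nhds' _ hmem
  exact ⟨A, hA⟩

/-- The norm of the combination is the length of `X + r • Y - Z`, a continuous function on `M` that
vanishes at `x`. Limits of vector fields therefore depend linearly on their values at `x`. -/
theorem tendsto_iso_combination (l : Ultrafilter (Triv g)) {x : M}
    (hx : Tendsto Triv.base (l : Filter (Triv g)) (𝓝 x)) (X Y Z : VectorField n M) (r : ℝ)
    (h : X.1 x + r • Y.1 x = Z.1 x) :
    Tendsto (fun p : Triv g => p.iso (cliffVec g p.base (X.1 p.base)) +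
      (r : ℂ) • p.iso (cliffVec g p.base (Y.1 p.base)) -
        p.iso (cliffVec g p.base (Z.1 p.base))) l (𝓝 0) := by
  let q : M → ℝ := fun y => g.inner y (X.1 y + r • Y.1 y - Z.1 y) (X.1 y + r • Y.1 y - Z.1 y)
  have hq : Continuous q := by
    simp only [q, map_add, map_sub, map_smul, add_apply, sub_apply, smul_apply]
    have := continuous_inner_vectorField g
    fun_prop (disch := exact this _ _)
  have hq0 : q x = 0 := by simp only [q, h, sub_self, map_zero]
  have hc := (hq.tendsto x).comp hx
  rw [hq0] at hc
  have hs := (Real.continuous_sqrt.tendsto _).comp hc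
  rw [Real.sqrt_zero] at hs
  refine tendsto_zero_iff_norm_tendsto_zero.mpr (hs.congr fun p => ?_)
  rw [Function.comp_apply, Function.comp_apply, ← map_smul, ← map_add, ← map_sub, ← cliffVec_smul,
    ← cliffVec_add, ← cliffVec_sub]
  simp only [q]
  rw [← norm_iso_cliffVec, Real.sqrt_sq (norm_nonneg _)]

theorem le_nhds_triv {l : Filter (Triv g)} {q : Triv g} (h : Tendsto Triv.base l (𝓝 q.base))
    (h' : ∀ X : VectorField n M, Tendsto (fun p : Triv g => p.iso (cliffVec g p.base (X.1 p.base)))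
      l (𝓝 (q.iso (cliffVec g q.base (X.1 q.base))))) : l ≤ 𝓝 q := by
  rw [nhds_induced, ← tendsto_iff_comap, nhds_prod_eq]
  exact h.prodMk (tendsto_pi_nhds.mpr h')

/-- Since the Clifford algebras of all tangent spaces are isomorphic, a homomorphism from one of
them to the matrix algebra is bijective as soon as `P` has a point. -/
theorem bijective_cliffHom (p : Triv g) {x : M} (φ : CliffFibre g x →⋆ₐ[ℂ] Mat n) :
    Function.Bijective φ := by
  obtain ⟨e⟩ := nonempty_cliffFibre_equiv g x p.base
  let ψ : Mat n →ₐ[ℂ] Mat n :=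
    (φ : CliffFibre g x →ₐ[ℂ] Mat n).comp ((e.trans p.iso).symm : Mat n →ₐ[ℂ] CliffFibre g x)
  -- The matrix algebra is simple, so a unital endomorphism is injective, and by dimension it is
  -- surjective.
  have hψ : Function.Injective ψ := ψ.toRingHom.injective
  have hψ' : Function.Surjective ψ := LinearMap.surjective_of_injective (f := ψ.toLinearMap) hψ
  have h1 : (φ : CliffFibre g x → Mat n) = ψ ∘ (e.trans p.iso) := by
    ext1 c
    simp [ψ]
  rw [h1]
  exact Function.Bijective.comp ⟨hψ, hψ'⟩ (e.trans p.iso).bijective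

/-- Along an ultrafilter the base points converge to some `x` and the matrices of each vector field
converge. The limits define a linear map on the tangent space at `x` satisfying the Clifford
relations, hence a ⋆-homomorphism; it is bijective and is the limit point in `P`. -/
instance [T2Space M] [CompactSpace M] : CompactSpace (Triv g) := by
  refine ⟨isCompact_iff_ultrafilter_le_nhds'.mpr fun l _ => ?_⟩
  obtain ⟨x, -, hx⟩ := isCompact_univ.ultrafilter_le_nhds' (l.map Triv.base) univ_mem
  change Tendsto Triv.base (l : Filter (Triv g)) (𝓝 x) at hx
  choose A hA using exists_tendsto_iso_vectorField l hx
  choose E hE using fun v => exists_vectorField (n := n) (M := M) x v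
  have comb : ∀ X Y Z : VectorField n M, ∀ r : ℝ, X.1 x + r • Y.1 x = Z.1 x →
      A X + (r : ℂ) • A Y = A Z := fun X Y Z r h => by
    rw [← sub_eq_zero]
    exact tendsto_nhds_unique (((hA X).add ((hA Y).const_smul (r : ℂ))).sub (hA Z))
      (tendsto_iso_combination l hx X Y Z r h)
  have smul : ∀ (r : ℝ) v, A (E (r • v)) = (r : ℂ) • A (E v) := fun r v => by
    have h1 := comb (E 0) (E v) (E (r • v)) r (by simp [hE])
    -- This says `A (E 0) + A (E 0) = A (E 0)`, so the constant term in `h1` vanishes.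
    have h2 := comb (E 0) (E 0) (E 0) 1 (by simp [hE])
    rw [← h1]
    simpa using h2
  have add : ∀ v w, A (E (v + w)) = A (E v) + A (E w) := fun v w => by
    rw [← comb (E v) (E w) (E (v + w)) 1 (by simp [hE])]
    simp
  -- Taking `r = 0` shows that the limit depends only on the value of the field at `x`, so the
  -- arbitrary choice `E` is harmless.
  have eqA : ∀ X : VectorField n M, A (E (X.1 x)) = A X := fun X => by
    rw [← comb (E (X.1 x)) (E 0) X 0 (by simp [hE])]
    simp
  obtain ⟨φ, hφ⟩ := exists_cliffHom (g := g) (B := Mat n)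
    ⟨⟨fun v => A (E v), by simpa using smul 0 0⟩, add⟩ smul (fun v => by
      have h2 := (continuous_inner_vectorField g (E v) (E v)).tendsto x |>.comp hx
      rw [hE] at h2
      have h3 := ((continuous_algebraMap ℂ (Mat n)).tendsto _).comp
        ((Complex.continuous_ofReal.tendsto _).comp h2).neg
      refine tendsto_nhds_unique ((hA (E v)).mul (hA (E v))) (h3.congr fun p => ?_)
      simp only [Function.comp_apply]
      rw [← map_mul, cliffVec_mul_self, AlgHomClass.commutes]) (fun v => by
      refine tendsto_nhds_unique (hA (E v)).star ((hA (E v)).neg.congr fun p => ?_)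
      rw [← map_star, star_cliffVec, map_neg])
  obtain ⟨p⟩ : Nonempty (Triv g) := l.neBot.nonempty
  refine ⟨⟨x, StarAlgEquiv.ofBijective φ (bijective_cliffHom p φ)⟩, trivial,
    le_nhds_triv hx fun X => ?_⟩
  have h : Tendsto (fun p : Triv g => p.iso (cliffVec g p.base (X.1 p.base))) l
      (𝓝 (φ (cliffVec g x (X.1 x)))) := by
    rw [hφ]
    change Tendsto _ _ (𝓝 (A (E (X.1 x))))
    rw [eqA]
    exact hA X
  exact h

end Topology

end ProjDirac
end

noncomputable section
namespace ProjDirac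

/-! ### The transposition of `Cliff(M)` -/

section Transpose

universe u

variable {n : ℕ} {M : Type u} [TopologicalSpace M] [ChartedSpace (EuclideanSpace ℝ (Fin n)) M]
  [IsManifold (𝓡 n) ∞ M] {g : RiemMetric n M} {x : M}

open Filter Topology

theorem cliffTranspose_algebraMap (z : ℂ) :
    cliffTranspose g x (algebraMap ℂ _ z) = algebraMap ℂ _ z := by
  rw [Algebra.TensorProduct.algebraMap_apply]
  refine (LinearMap.baseChange_tmul _ _ _).trans ?_
  rw [CliffordAlgebra.reverse.map_one]

theorem cliffTranspose_vec (v : TangentSpace (𝓡 n) x) :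
    cliffTranspose g x (cliffVec g x v) = cliffVec g x v := by
  refine (LinearMap.baseChange_tmul _ _ _).trans ?_
  rw [CliffordAlgebra.reverse_ι, cliffVec]

theorem cliffTranspose_mul (a b : CliffFibre g x) :
    cliffTranspose g x (a * b) = cliffTranspose g x b * cliffTranspose g x a := by
  have tm : ∀ (z : ℂ) (a : CliffordAlgebra (cliffForm g x)),
      cliffTranspose g x (z ⊗ₜ[ℝ] a) = z ⊗ₜ[ℝ] CliffordAlgebra.reverse a := fun z a =>
    LinearMap.baseChange_tmul _ _ _
  induction a using TensorProduct.induction_on with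
  | zero => simp
  | add a a' ha ha' => rw [add_mul, map_add, map_add, mul_add, ha, ha']
  | tmul z a =>
    induction b using TensorProduct.induction_on with
    | zero => simp
    | add b b' hb hb' => rw [mul_add, map_add, map_add, add_mul, hb, hb']
    | tmul w b =>
      rw [Algebra.TensorProduct.tmul_mul_tmul, tm, tm, tm, CliffordAlgebra.reverse.map_mul,
        Algebra.TensorProduct.tmul_mul_tmul, mul_comm z w]

theorem cliffTranspose_cliffTranspose (c : CliffFibre g x) :
    cliffTranspose g x (cliffTranspose g x c) = c := by
  induction c using cliffFibre_induction with
  | algebraMap z => rw [cliffTranspose_algebraMap, cliffTranspose_algebraMap]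
  | vec v => rw [cliffTranspose_vec, cliffTranspose_vec]
  | mul a b ha hb => rw [cliffTranspose_mul, cliffTranspose_mul, ha, hb]
  | add a b ha hb => rw [map_add, map_add, ha, hb]

theorem cliffTranspose_star (c : CliffFibre g x) :
    cliffTranspose g x (star c) = star (cliffTranspose g x c) := by
  induction c using cliffFibre_induction with
  | algebraMap z =>
    rw [← algebraMap_star_comm, cliffTranspose_algebraMap, cliffTranspose_algebraMap,
      algebraMap_star_comm]
  | vec v => rw [star_cliffVec, cliffTranspose_vec, star_cliffVec, map_neg, cliffTranspose_vec]
  | mul a b ha hb => rw [star_mul, cliffTranspose_mul, cliffTranspose_mul, star_mul, ha, hb]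
  | add a b ha hb => rw [star_add, map_add, map_add, star_add, ha, hb]

variable (g x) in
/-- The product at `x` of a list of vector fields. -/
def cliffWord (w : List (VectorField n M)) : CliffFibre g x :=
  (w.map fun X => cliffVec g x (X.1 x)).prod

theorem cliffTranspose_word (w : List (VectorField n M)) :
    cliffTranspose g x (cliffWord g x w) = cliffWord g x w.reverse := by
  induction w with
  | nil =>
    have h := cliffTranspose_algebraMap (g := g) (x := x) 1
    rwa [map_one] at h
  | cons X w ih =>
    have : cliffWord g x (X :: w) = cliffVec g x (X.1 x) * cliffWord g x w := by simp [cliffWord]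
    rw [this, cliffTranspose_mul, ih, cliffTranspose_vec]
    simp [cliffWord]

theorem continuous_iso_word (w : List (VectorField n M)) :
    Continuous fun p : Triv g => p.iso (cliffWord g p.base w) := by
  simp only [cliffWord, map_list_prod, List.map_map]
  exact continuous_list_prod _ fun X _ => continuous_iso_vectorField X

theorem span_cliffWord [T2Space M] (x : M) :
    Submodule.span ℂ (Set.range (cliffWord g x)) = ⊤ := by
  refine eq_top_iff.mpr fun c _ => ?_
  induction c using cliffFibre_induction with
  | algebraMap z =>
    rw [Algebra.algebraMap_eq_smul_one]
    exact Submodule.smul_mem _ _ (Submodule.subset_span ⟨[], by simp [cliffWord]⟩)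
  | vec v =>
    obtain ⟨X, rfl⟩ := exists_vectorField x v
    exact Submodule.subset_span ⟨[X], by simp [cliffWord]⟩
  | mul a b ha hb =>
    have h := Submodule.mul_mem_mul (ha trivial) (hb trivial)
    rw [Submodule.span_mul_span] at h
    refine Submodule.span_mono ?_ h
    rintro _ ⟨_, ⟨w, rfl⟩, _, ⟨w', rfl⟩, rfl⟩
    exact ⟨w ++ w', by simp [cliffWord]⟩
  | add a b ha hb => exact add_mem (ha trivial) (hb trivial)

theorem sect_eq_of_iso {b : CliffAlg g} (p : Triv g) {c : CliffFibre g p.base}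
    (h : b.1 p = p.iso c) : sect b p.base = c :=
  p.iso.injective ((sect_spec b p).trans h)

/-- The coefficients of a continuous function with respect to a continuous family of bases. -/
theorem exists_continuousAt_coeff {Z V κ : Type*} [TopologicalSpace Z] [NormedAddCommGroup V]
    [NormedSpace ℂ V] [FiniteDimensional ℂ V] [Fintype κ] (B : Module.Basis κ ℂ V) {F : κ → Z → V}
    (hF : ∀ k, Continuous (F k)) {z₀ : Z} (h₀ : ∀ k, F k z₀ = B k) {b : Z → V}
    (hb : Continuous b) :
    ∃ β : Z → κ → ℂ, ContinuousAt β z₀ ∧ ∀ᶠ z in 𝓝 z₀, b z = ∑ k, β z k • F k z := by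
  classical
  let T : Z → Matrix κ κ ℂ := fun z => .of fun j k => B.repr (F k z) j
  have hrepr : ∀ j, Continuous fun A : V => B.repr A j := fun j =>
    LinearMap.continuous_of_finiteDimensional (B.coord j)
  have hT : Continuous T := continuous_matrix fun j k => (hrepr j).comp (hF k)
  have hT0 : (T z₀).det ≠ 0 := by
    have : T z₀ = 1 := by
      ext j k
      simp [T, h₀, Finsupp.single_apply, Matrix.one_apply, eq_comm]
    rw [this]
    simp
  -- Cramer's rule: `T z` expresses the family at `z` in the basis `B` and is the identity at `z₀`,
  -- so its inverse is continuous there.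
  refine ⟨fun z => (T z).det⁻¹ • ((T z).adjugate.mulVec fun j => B.repr (b z) j),
    (hT.matrix_det.continuousAt.inv₀ hT0).smul (hT.matrix_adjugate.matrix_mulVec
      (continuous_pi fun j => (hrepr j).comp hb)).continuousAt, ?_⟩
  filter_upwards [hT.matrix_det.continuousAt.eventually_ne hT0] with z hz
  set β := (T z).det⁻¹ • ((T z).adjugate.mulVec fun j => B.repr (b z) j) with hβ
  have h1 : (T z).mulVec β = fun j => B.repr (b z) j := by
    rw [hβ, Matrix.mulVec_smul, Matrix.mulVec_mulVec, Matrix.mul_adjugate, Matrix.smul_mulVec,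
      Matrix.one_mulVec, smul_smul, inv_mul_cancel₀ hz, one_smul]
  refine B.ext_elem fun j => ?_
  rw [← congrFun h1 j]
  simp [Matrix.mulVec, dotProduct, T, mul_comm]

/-- Near a point the section is a combination of words in vector fields with coefficients continuous
at that point. Transposition is linear and only reverses words, so the same coefficients express the
transposed section through continuous functions. -/
theorem continuous_transposeAt [T2Space M] (b : CliffAlg g) :
    Continuous fun p : Triv g => transposeAt b p := by
  refine continuous_iff_continuousAt.mpr fun p₀ => ?_
  obtain ⟨κ, a, -, hspan, hli⟩ := exists_linearIndependent' ℂ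
    fun w => p₀.iso (cliffWord g p₀.base w)
  have hspan' : Submodule.span ℂ (Set.range fun w => p₀.iso (cliffWord g p₀.base w)) = ⊤ := by
    let e : CliffFibre g p₀.base →ₗ[ℂ] Mat n :=
      (p₀.iso : CliffFibre g p₀.base →ₐ[ℂ] Mat n).toLinearMap
    have h1 : (fun w => p₀.iso (cliffWord g p₀.base w)) = e ∘ cliffWord g p₀.base := rfl
    have h2 : Function.Surjective e := p₀.iso.surjective
    rw [h1, Set.range_comp, ← Submodule.map_span, span_cliffWord, Submodule.map_top,
      LinearMap.range_eq_top.mpr h2]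
  let B : Module.Basis κ ℂ (Mat n) := Module.Basis.mk hli (hspan.trans hspan').ge
  have : Fintype κ := FiniteDimensional.fintypeBasisIndex B
  obtain ⟨β, hβ, hev⟩ := exists_continuousAt_coeff B
    (F := fun k (p : Triv g) => p.iso (cliffWord g p.base (a k)))
    (fun k => continuous_iso_word (a k)) (z₀ := p₀) (fun k => by simp [B]) b.1.continuous
  have hev' : ∀ᶠ p in 𝓝 p₀, transposeAt b p =
      ∑ k, β p k • p.iso (cliffWord g p.base (a k).reverse) := by
    filter_upwards [hev] with p hp
    have h2 : b.1 p = p.iso (∑ k, β p k • cliffWord g p.base (a k)) := by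
      rw [map_sum]
      simpa only [map_smul] using hp
    rw [transposeAt, sect_eq_of_iso p h2, map_sum, map_sum]
    simp only [map_smul, cliffTranspose_word]
  refine ContinuousAt.congr ?_ (hev'.mono fun _ h => h.symm)
  exact tendsto_finsetSum _ fun k _ => ((continuous_apply k).continuousAt.comp hβ).smul
    (continuous_iso_word _).continuousAt

/-! ### The transposition as an isometric anti-automorphism of the section algebra -/

variable [T2Space M] [CompactSpace M]

/-- The transposition of `Cliff(M)`. -/
def cliffAlgTranspose : CliffAlg g →ₗ[ℂ] CliffAlg g where
  toFun b := ⟨BoundedContinuousFunction.mkOfCompact ⟨_, continuous_transposeAt b⟩,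
    fun x => cliffTranspose g x (sect b x), fun p => rfl⟩
  map_add' b c := by
    ext1; ext1 p
    have : sect (b + c) p.base = sect b p.base + sect c p.base := sect_eq_of_iso p (by
      rw [map_add, sect_spec, sect_spec]; rfl)
    change transposeAt _ p = transposeAt _ p + transposeAt _ p
    simp [transposeAt, this]
  map_smul' z b := by
    ext1; ext1 p
    have : sect (z • b) p.base = z • sect b p.base := sect_eq_of_iso p (by
      rw [map_smul, sect_spec]; rfl)
    change transposeAt _ p = z • transposeAt _ p
    simp [transposeAt, this]

theorem sect_cliffAlgTranspose (b : CliffAlg g) (p : Triv g) :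
    sect (cliffAlgTranspose b) p.base = cliffTranspose g p.base (sect b p.base) :=
  sect_eq_of_iso p rfl

theorem transposeAt_cliffAlgTranspose (b : CliffAlg g) (p : Triv g) :
    transposeAt (cliffAlgTranspose b) p = b.1 p := by
  rw [transposeAt, sect_cliffAlgTranspose, cliffTranspose_cliffTranspose, sect_spec]

theorem cliffAlgTranspose_cliffAlgTranspose (b : CliffAlg g) :
    cliffAlgTranspose (cliffAlgTranspose b) = b := by
  ext1; ext1 p
  exact transposeAt_cliffAlgTranspose b p

theorem cliffAlgTranspose_mul (b c : CliffAlg g) :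
    cliffAlgTranspose (b * c) = cliffAlgTranspose c * cliffAlgTranspose b := by
  ext1; ext1 p
  have : sect (b * c) p.base = sect b p.base * sect c p.base := sect_eq_of_iso p (by
    rw [map_mul, sect_spec, sect_spec]; rfl)
  change transposeAt _ p = transposeAt _ p * transposeAt _ p
  simp only [transposeAt, this, cliffTranspose_mul, map_mul]

theorem cliffAlgTranspose_star (b : CliffAlg g) :
    cliffAlgTranspose (star b) = star (cliffAlgTranspose b) := by
  ext1; ext1 p
  have : sect (star b) p.base = star (sect b p.base) := sect_eq_of_iso p (by
    rw [map_star, sect_spec]; rfl)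
  change transposeAt _ p = star (transposeAt _ p)
  simp only [transposeAt, this, cliffTranspose_star, map_star]

/-- Viewed as a ⋆-homomorphism into the opposite C*-algebra, the transposition is contractive; being
its own inverse, it is isometric. -/
theorem norm_cliffAlgTranspose (b : CliffAlg g) : ‖cliffAlgTranspose b‖ = ‖b‖ := by
  let φ : CliffAlg g →⋆ₙₐ[ℂ] (CliffAlg g)ᵐᵒᵖ :=
    { toFun := fun b => MulOpposite.op (cliffAlgTranspose b)
      map_smul' := fun z b => by rw [map_smul]; rfl
      map_zero' := by rw [map_zero]; rfl
      map_add' := fun b c => by rw [map_add]; rfl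
      map_mul' := fun b c => by rw [cliffAlgTranspose_mul]; rfl
      map_star' := fun b => by rw [cliffAlgTranspose_star]; rfl }
  have h : ∀ b : CliffAlg g, ‖cliffAlgTranspose b‖ ≤ ‖b‖ := fun b =>
    NonUnitalStarAlgHom.norm_apply_le φ b
  refine le_antisymm (h b) ?_
  conv_lhs => rw [← cliffAlgTranspose_cliffAlgTranspose b]
  exact h _

end Transpose

end ProjDirac
end

noncomputable section
namespace ProjDirac

/-! ### The action of `SU(N)` on the fibres of `P` -/

section Fibres

universe u

variable {n : ℕ}

theorem coe_inv_SU (a : SU n) : ((a⁻¹ : SU n) : Mat n) = star (a : Mat n) := by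
  rw [← Matrix.star_eq_inv, Matrix.specialUnitaryGroup.coe_star]

theorem star_mul_SU (a : SU n) : star (a : Mat n) * (a : Mat n) = 1 :=
  Matrix.mem_unitaryGroup_iff'.mp (Matrix.mem_specialUnitaryGroup_iff.mp a.2).1

theorem mul_star_SU (a : SU n) : (a : Mat n) * star (a : Mat n) = 1 :=
  Matrix.mem_unitaryGroup_iff.mp (Matrix.mem_specialUnitaryGroup_iff.mp a.2).1

/-- A matrix which commutes with all matrices is scalar. -/
theorem exists_eq_smul_one_of_forall_commute {S : Mat n} (h : ∀ A : Mat n, S * A = A * S) :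
    ∃ c : ℂ, S = c • 1 := by
  have : S ∈ Subalgebra.center ℂ (Mat n) :=
    Subalgebra.mem_center_iff.mpr fun A => (h A).symm
  rw [Algebra.IsCentral.center_eq_bot, Algebra.mem_bot] at this
  obtain ⟨c, rfl⟩ := this
  exact ⟨c, Algebra.algebraMap_eq_smul_one c⟩

/-- Rescaling of an invertible matrix with `S^* S` scalar to an element of `SU(N)`. -/
theorem exists_SU_eq_smul {S : Mat n} (hS : S.det ≠ 0) {c : ℂ} (hc : star S * S = c • 1) :
    ∃ (u : SU n) (z : ℂ), (u : Mat n) = z • S := by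
  have hN : 0 < spinDim n := by positivity
  -- Dividing by an `N`-th root of the determinant normalizes the determinant to one.
  obtain ⟨l, hl⟩ := IsAlgClosed.exists_pow_nat_eq S.det hN
  have hl0 : l ≠ 0 := by rintro rfl; exact hS (by rw [← hl, zero_pow hN.ne'])
  set u : Mat n := l⁻¹ • S with hu
  have hdet : u.det = 1 := by
    rw [hu, Matrix.det_smul, Fintype.card_fin, inv_pow, hl, inv_mul_cancel₀ hS]
  obtain ⟨d, hd⟩ : ∃ d : ℂ, star u * u = d • 1 := by
    refine ⟨star l⁻¹ * l⁻¹ * c, ?_⟩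
    rw [hu, star_smul, smul_mul_smul_comm, hc, smul_smul]
  -- Determinants force `d ^ N = 1`, while a diagonal entry of `star u * u` shows that `d` is a
  -- nonnegative real; together they give `d = 1`.
  have hd1 : d ^ spinDim n = 1 := by
    have h := congrArg Matrix.det hd
    rw [Matrix.det_mul, Matrix.star_eq_conjTranspose, Matrix.det_conjTranspose, hdet,
      Matrix.det_smul] at h
    simpa using h.symm
  have hd2 : d = ∑ i, (‖u i ⟨0, hN⟩‖ ^ 2 : ℝ) := by
    have h := congrFun (congrFun hd ⟨0, hN⟩) ⟨0, hN⟩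
    rw [Matrix.smul_apply, Matrix.one_apply_eq, smul_eq_mul, mul_one] at h
    rw [← h, Matrix.mul_apply, Complex.ofReal_sum]
    refine Finset.sum_congr rfl fun i _ => ?_
    rw [Matrix.star_apply, Complex.star_def, Complex.conj_mul', Complex.ofReal_pow]
  have hd3 : d = 1 := by
    rw [hd2] at hd1 ⊢
    have h0 : (0 : ℝ) ≤ ∑ i, ‖u i ⟨0, hN⟩‖ ^ 2 := by positivity
    rw [← Complex.ofReal_pow, Complex.ofReal_eq_one] at hd1
    rw [Complex.ofReal_eq_one]
    exact (pow_eq_one_iff_of_nonneg h0 hN.ne').mp hd1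
  refine ⟨⟨u, Matrix.mem_specialUnitaryGroup_iff.mpr
    ⟨Matrix.mem_unitaryGroup_iff'.mpr (by rw [hd, hd3, one_smul]), hdet⟩⟩, l⁻¹, hu⟩

/-- Every ⋆-automorphism of the matrix algebra is inner. -/
theorem exists_eq_adIso (φ : Mat n ≃⋆ₐ[ℂ] Mat n) : ∃ a : SU n, ∀ A, φ A = adIso a A := by
  let e : Mat n ≃ₐ[ℂ] Module.End ℂ (VNat n) := Matrix.toLinAlgEquiv'
  -- Automorphisms of an endomorphism algebra are conjugations. Compatibility with the involution
  -- then makes `star S * S` central, hence scalar, so `S` can be rescaled into `SU(N)`.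
  obtain ⟨T, hT⟩ := ((e.symm.trans φ.toAlgEquiv).trans e).eq_linearEquivConjAlgEquiv
  let S : Mat n := e.symm T.toLinearMap
  let S' : Mat n := e.symm T.symm.toLinearMap
  have hSS' : S' * S = 1 := by
    have h : T.symm.toLinearMap * T.toLinearMap = (1 : Module.End ℂ (VNat n)) :=
      LinearMap.ext fun v => T.symm_apply_apply v
    exact (map_mul e.symm _ _).symm.trans ((congrArg e.symm h).trans (map_one _))
  have hφ : ∀ A, φ A * S = S * A := fun A => by
    have h := congrArg e.symm (DFunLike.congr_fun hT (e A))
    have h0 : e.symm (e (φ (e.symm (e A)))) = φ A := by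
      rw [AlgEquiv.symm_apply_apply, AlgEquiv.symm_apply_apply]
    replace h := h0.symm.trans h
    have h' : φ A = S * A * S' := by
      refine h.trans ?_
      apply e.injective
      rw [AlgEquiv.apply_symm_apply, map_mul, map_mul]
      simp only [S, S', AlgEquiv.apply_symm_apply]
      rfl
    rw [h', mul_assoc, hSS', mul_one]
  have hφ' : ∀ A, star S * φ A = A * star S := fun A => by
    have h := congrArg star (hφ (star A))
    rwa [star_mul, star_mul, map_star, star_star, star_star] at h
  obtain ⟨c, hc⟩ := exists_eq_smul_one_of_forall_commute (S := star S * S) fun A => by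
    rw [mul_assoc, ← hφ, ← mul_assoc, hφ', mul_assoc]
  have hdet : S.det ≠ 0 := fun h => by
    have := congrArg Matrix.det hSS'
    rw [Matrix.det_mul, h, mul_zero, Matrix.det_one] at this
    exact zero_ne_one this
  obtain ⟨a, z, ha⟩ := exists_SU_eq_smul hdet hc
  refine ⟨a, fun A => ?_⟩
  rw [adIso_apply]
  have : φ A * a = a * A := by rw [ha, mul_smul_comm, hφ, smul_mul_assoc]
  rw [← this, mul_assoc, mul_star_SU, mul_one]

variable {M : Type u} [TopologicalSpace M] [ChartedSpace (EuclideanSpace ℝ (Fin n)) M]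
  [IsManifold (𝓡 n) ∞ M] {g : RiemMetric n M}

/-- `SU(N)` acts transitively on the fibres of `P`. -/
theorem exists_act_eq {p q : Triv g} (h : p.base = q.base) : ∃ a : SU n, p.act a = q := by
  obtain ⟨x, φ⟩ := p
  obtain ⟨y, ψ⟩ := q
  obtain rfl : x = y := h
  obtain ⟨a, ha⟩ := exists_eq_adIso (φ.symm.trans ψ)
  refine ⟨a⁻¹, ?_⟩
  unfold Triv.act
  congr 1
  ext1 c
  have := ha (φ c)
  simp only [StarAlgEquiv.trans_apply, StarAlgEquiv.symm_apply_apply] at this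
  rw [StarAlgEquiv.trans_apply, inv_inv, this]

/-- Two elements of `SU(N)` which act in the same way on a point of `P` differ by an element of the
centre. -/
theorem exists_center_of_act_eq {p : Triv g} {a b : SU n} (h : p.act a = p.act b) :
    ∃ z ∈ Subgroup.center (SU n), ∃ c : ℂ, (z : Mat n) = c • 1 ∧ b = a * z := by
  have h1 : ∀ A : Mat n, adIso a⁻¹ A = adIso b⁻¹ A := fun A => by
    have h2 : p.iso.trans (adIso a⁻¹) = p.iso.trans (adIso b⁻¹) := by
      unfold Triv.act at h
      simpa using h
    simpa using DFunLike.congr_fun h2 (p.iso.symm A)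
  obtain ⟨c, hc⟩ := exists_eq_smul_one_of_forall_commute
    (S := ((a⁻¹ * b : SU n) : Mat n)) fun A => by
      -- Evaluating at `a A a*` turns equality of the two conjugations into the statement that `a⁻¹
      -- b` commutes with `A`.
      have h3 := h1 (a * A * star (a : Mat n))
      rw [adIso_apply, adIso_apply, coe_inv_SU, coe_inv_SU, star_star, star_star] at h3
      have h4 : star (a : Mat n) * (a * A * star (a : Mat n)) * a = A := by
        rw [← mul_assoc, ← mul_assoc, star_mul_SU, one_mul, mul_assoc, star_mul_SU, mul_one]
      rw [h4] at h3
      have h5 := congrArg (fun B => star (a : Mat n) * (b : Mat n) * B) h3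
      rw [Submonoid.coe_mul, coe_inv_SU, h5]
      have h6 : star (a : Mat n) * (b : Mat n) *
          (star (b : Mat n) * (a * A * star (a : Mat n)) * b) =
          star (a : Mat n) * ((b : Mat n) * star (b : Mat n)) * a * A * (star (a : Mat n) * b) := by
        noncomm_ring
      rw [h6, mul_star_SU, mul_one, star_mul_SU, one_mul]
  refine ⟨a⁻¹ * b, Subgroup.mem_center_iff.mpr fun d => Subtype.ext ?_, c, hc, by simp⟩
  change (d : Mat n) * ((a⁻¹ * b : SU n) : Mat n) = ((a⁻¹ * b : SU n) : Mat n) * (d : Mat n)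
  rw [hc]
  simp

theorem cliffAlg_act (b : CliffAlg g) (p : Triv g) (a : SU n) :
    b.1 (p.act a) = star (a : Mat n) * b.1 p * a := by
  have h : b.1 (p.act a) = adIso a⁻¹ (b.1 p) := by
    rw [← sect_spec b, ← sect_spec b]
    rfl
  rw [h, adIso_apply, coe_inv_SU, star_star]

/-- Since `SU(N)` is transitive on each fibre of `P`, equivariance lets one trivialization define
the value of the section consistently for all others. -/
theorem mem_cliffAlg_of_act {f : Triv g →ᵇ Mat n}
    (h : ∀ p (a : SU n), f (p.act a) = star (a : Mat n) * f p * a) : f ∈ CliffAlg g := by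
  have key : ∀ x : M, ∃ c : CliffFibre g x, ∀ φ : CliffFibre g x ≃⋆ₐ[ℂ] Mat n,
      f ⟨x, φ⟩ = φ c := fun x => by
    by_cases hx : Nonempty (CliffFibre g x ≃⋆ₐ[ℂ] Mat n)
    · obtain ⟨φ₀⟩ := hx
      refine ⟨φ₀.symm (f ⟨x, φ₀⟩), fun φ => ?_⟩
      obtain ⟨a, ha⟩ := exists_act_eq (p := ⟨x, φ₀⟩) (q := ⟨x, φ⟩) rfl
      have ha' : φ₀.trans (adIso a⁻¹) = φ := by
        unfold Triv.act at ha
        simpa using ha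
      rw [← ha, h, ← ha', StarAlgEquiv.trans_apply, StarAlgEquiv.apply_symm_apply, adIso_apply,
        coe_inv_SU, star_star]
    · exact ⟨0, fun φ => (hx ⟨φ⟩).elim⟩
  choose s hs using key
  exact ⟨s, fun p => hs p.base p.iso⟩

/-! ### The `Cliff(M)`-valued inner product -/

theorem continuous_ipAt (ξ η : Triv g →ᵇ VNat n) : Continuous (ipAt ξ η) := by
  refine continuous_integral_haarSU ?_
  have ha : Continuous fun q : Triv g × SU n => (q.2 : Mat n) := by fun_prop
  exact (ha.mul ((η.continuous.comp continuous_act).matrix_vecMulVec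
    (ξ.continuous.comp continuous_act).star)).mul ha.star

theorem adIso_vecMulVec (a : SU n) (v w : VNat n) :
    adIso a (Matrix.vecMulVec v (star w)) =
      Matrix.vecMulVec ((a : Mat n).mulVec v) (star ((a : Mat n).mulVec w)) := by
  rw [adIso_apply, Matrix.mul_vecMulVec, Matrix.vecMulVec_mul, Matrix.star_mulVec,
    Matrix.star_eq_conjTranspose]

theorem ipAt_eq (ξ η : Triv g →ᵇ VNat n) (p : Triv g) :
    ipAt ξ η p = ∫ a, Matrix.vecMulVec ((a : Mat n).mulVec (η (p.act a)))
      (star ((a : Mat n).mulVec (ξ (p.act a)))) ∂haarSU n := by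
  simp only [ipAt, adIso_vecMulVec]

/-- The left and right multiplication by matrices, as a continuous linear map. -/
def mulMulCLM (A B : Mat n) : Mat n →L[ℂ] Mat n :=
  ((ContinuousLinearMap.mul ℂ (Mat n)).flip B).comp (ContinuousLinearMap.mul ℂ (Mat n) A)

theorem mulMulCLM_apply (A B C : Mat n) : mulMulCLM A B C = A * C * B := rfl

/-- Left invariance of Haar measure under `a ↦ b a`. With `mem_cliffAlg_of_act` it shows that the
inner product is a section of the Clifford bundle. -/
theorem ipAt_act (ξ η : Triv g →ᵇ VNat n) (p : Triv g) (b : SU n) :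
    ipAt ξ η (p.act b) = star (b : Mat n) * ipAt ξ η p * b := by
  calc ipAt ξ η (p.act b) = ∫ a, mulMulCLM (star (b : Mat n)) b (adIso (b * a)
        (Matrix.vecMulVec (η (p.act (b * a))) (star (ξ (p.act (b * a)))))) ∂haarSU n := by
        refine MeasureTheory.integral_congr_ae (MeasureTheory.ae_of_all _ fun a => ?_)
        simp only [mulMulCLM_apply, adIso_apply, Triv.act_act, Submonoid.coe_mul, star_mul]
        generalize Matrix.vecMulVec (η (p.act (b * a))) (star (ξ (p.act (b * a)))) = A
        have h : star (b : Mat n) * (b * a * A * (star (a : Mat n) * star (b : Mat n))) * b =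
            (star (b : Mat n) * b) * a * A * star (a : Mat n) * (star (b : Mat n) * b) := by
          noncomm_ring
        rw [h, star_mul_SU, one_mul, mul_one]
    _ = ∫ a, mulMulCLM (star (b : Mat n)) b (adIso a
        (Matrix.vecMulVec (η (p.act a)) (star (ξ (p.act a))))) ∂haarSU n :=
      MeasureTheory.integral_mul_left_eq_self (fun a => mulMulCLM (star (b : Mat n)) b (adIso a
        (Matrix.vecMulVec (η (p.act a)) (star (ξ (p.act a)))))) b
    _ = star (b : Mat n) * ipAt ξ η p * b :=
      ContinuousLinearMap.integral_comp_comm _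
        (integrable_haarSU (continuous_ipAt_integrand ξ η p))

end Fibres

end ProjDirac
end

noncomputable section
namespace ProjDirac

/-! ### The representation of the crossed product on `L²(SU(N))` given by an orbit in `P` -/

section OrbitRep

universe u

variable {n : ℕ}

open MeasureTheory

/-- A right translate of Haar measure is again a Haar probability measure, so uniqueness applies. -/
instance : (haarSU n).IsMulRightInvariant where
  map_mul_right_eq_self a :=
    have : IsProbabilityMeasure ((haarSU n).map (· * a)) :=
      Measure.isProbabilityMeasure_map (measurable_mul_const a).aemeasurable
    Measure.isHaarMeasure_eq_of_isProbabilityMeasure _ _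

variable (n) in
/-- The Hilbert space `L²(SU(N))`. -/
abbrev L2SU : Type := Lp ℂ 2 (haarSU n)

variable (n) in
/-- The inclusion of the continuous functions into `L²(SU(N))`. -/
def toL2 : C(SU n, ℂ) →L[ℂ] L2SU n := ContinuousMap.toLp (E := ℂ) 2 (haarSU n) ℂ

theorem denseRange_toL2 : DenseRange (toL2 n : C(SU n, ℂ) →ₗ[ℂ] L2SU n) :=
  ContinuousMap.toLp_denseRange ℂ (haarSU n) ℂ (by norm_num)

theorem inner_toL2 (h k : C(SU n, ℂ)) :
    inner ℂ (toL2 n h) (toL2 n k) = ∫ a, k a * (starRingEnd ℂ) (h a) ∂haarSU n :=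
  ContinuousMap.inner_toLp (haarSU n) h k

theorem norm_toL2_sq (h : C(SU n, ℂ)) : ‖toL2 n h‖ ^ 2 = ∫ a, ‖h a‖ ^ 2 ∂haarSU n := by
  have h1 := inner_self_eq_norm_sq_to_K (𝕜 := ℂ) (toL2 n h)
  rw [inner_toL2] at h1
  simp only [Complex.mul_conj'] at h1
  have h2 : ∫ a, ((‖h a‖ : ℂ)) ^ 2 ∂haarSU n = ((∫ a, ‖h a‖ ^ 2 ∂haarSU n : ℝ) : ℂ) := by
    rw [← integral_complex_ofReal]
    simp
  rw [h2] at h1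
  apply Complex.ofReal_injective
  rw [Complex.ofReal_pow]
  exact h1.symm

theorem integral_integral_swap_haarSU {F : SU n → SU n → ℂ}
    (hF : Continuous fun q : SU n × SU n => F q.1 q.2) :
    ∫ a, ∫ b, F a b ∂haarSU n ∂haarSU n = ∫ b, ∫ a, F a b ∂haarSU n ∂haarSU n := by
  refine integral_integral_swap ?_
  exact integrableOn_univ.mp (hF.continuousOn.integrableOn_compact isCompact_univ)

variable {M : Type u} [TopologicalSpace M] [ChartedSpace (EuclideanSpace ℝ (Fin n)) M]
  [IsManifold (𝓡 n) ∞ M] {g : RiemMetric n M}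

theorem continuous_convAlg_act (f : ConvAlg g) (p : Triv g) :
    Continuous fun q : SU n × SU n => f (q.1, p.act q.2) :=
  f.continuous.comp (continuous_fst.prodMk ((continuous_act_right p).comp continuous_snd))

/-- The integrand of `orbitOp`. -/
def orbitIntegrand (f : ConvAlg g) (p : Triv g) (h : C(SU n, ℂ)) : C(SU n, C(SU n, ℂ)) :=
  ContinuousMap.curry ⟨fun q : SU n × SU n => f (q.1, p.act q.2) * h (q.2 * q.1),
    (continuous_convAlg_act f p).mul (h.continuous.comp (by fun_prop))⟩

/-- The action of `f` on continuous functions on the orbit of `p`. -/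
def orbitOp (f : ConvAlg g) (p : Triv g) : C(SU n, ℂ) →ₗ[ℂ] C(SU n, ℂ) where
  toFun h := ∫ a, orbitIntegrand f p h a ∂haarSU n
  map_add' h k := by
    rw [← integral_add (integrable_haarSU (orbitIntegrand f p h).continuous)
      (integrable_haarSU (orbitIntegrand f p k).continuous)]
    congr 1; ext a b
    simp [orbitIntegrand, mul_add]
  map_smul' c h := by
    rw [RingHom.id_apply, ← integral_smul]
    congr 1; ext a b
    simp [orbitIntegrand, mul_left_comm]

theorem orbitOp_apply (f : ConvAlg g) (p : Triv g) (h : C(SU n, ℂ)) (b : SU n) :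
    orbitOp f p h b = ∫ a, f (a, p.act b) * h (b * a) ∂haarSU n :=
  ContinuousMap.integral_apply (integrable_haarSU (orbitIntegrand f p h).continuous) b

/-- The substitution `c = b a` exhibits an integral operator with kernel `f (b⁻¹ c, p b)`. In this
form convolution is composition of kernels. -/
theorem orbitOp_apply' (f : ConvAlg g) (p : Triv g) (h : C(SU n, ℂ)) (b : SU n) :
    orbitOp f p h b = ∫ c, f (b⁻¹ * c, p.act b) * h c ∂haarSU n := by
  rw [orbitOp_apply, ← integral_mul_left_eq_self (fun c => f (b⁻¹ * c, p.act b) * h c) b]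
  simp

theorem orbitOp_conv (f₁ f₂ : ConvAlg g) (p : Triv g) (h : C(SU n, ℂ)) :
    orbitOp (conv f₁ f₂) p h = orbitOp f₁ p (orbitOp f₂ p h) := by
  ext b
  rw [orbitOp_apply', orbitOp_apply]
  simp only [orbitOp_apply', ← integral_const_mul]
  have e : ∀ c, conv f₁ f₂ (b⁻¹ * c, p.act b) * h c =
      ∫ a, f₁ (a, p.act b) * (f₂ ((b * a)⁻¹ * c, p.act (b * a)) * h c) ∂haarSU n := fun c => by
    change (∫ a, f₁ (a, p.act b) * f₂ (a⁻¹ * (b⁻¹ * c), (p.act b).act a) ∂haarSU n) * h c = _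
    rw [← integral_mul_const]
    simp only [Triv.act_act, mul_inv_rev, mul_assoc]
  simp only [e]
  refine integral_integral_swap_haarSU ?_
  have h1 : Continuous fun q : SU n × SU n => f₁ (q.2, p.act b) :=
    f₁.continuous.comp (by fun_prop)
  refine h1.mul (Continuous.mul ?_ (by fun_prop))
  exact (continuous_convAlg_act f₂ p).comp
    (by fun_prop : Continuous fun q : SU n × SU n => ((b * q.2)⁻¹ * q.1, b * q.2))

/-- The kernel of `convStar f` is the conjugate transpose of that of `f`; Fubini does the rest. -/
theorem inner_orbitOp (f : ConvAlg g) (p : Triv g) (h k : C(SU n, ℂ)) :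
    inner ℂ (toL2 n (orbitOp f p h)) (toL2 n k) =
      inner ℂ (toL2 n h) (toL2 n (orbitOp (convStar f) p k)) := by
  rw [inner_toL2, inner_toL2]
  simp only [orbitOp_apply', ← integral_conj, ← integral_const_mul, ← integral_mul_const]
  have e : ∀ b c, convStar f (b⁻¹ * c, p.act b) =
      (starRingEnd ℂ) (f (c⁻¹ * b, p.act c)) := fun b c => by
    change star (f ((b⁻¹ * c)⁻¹, (p.act b).act (b⁻¹ * c))) = _
    rw [Triv.act_act, mul_inv_rev, inv_inv, mul_inv_cancel_left]
    rfl
  simp only [e]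
  rw [integral_integral_swap_haarSU]
  · refine integral_congr_ae (ae_of_all _ fun b => integral_congr_ae (ae_of_all _ fun c => ?_))
    simp only [map_mul]
    ring
  · have h1 := (continuous_convAlg_act f p).comp
      (by fun_prop : Continuous fun q : SU n × SU n => (q.1⁻¹ * q.2, q.1))
    refine Continuous.mul (by fun_prop) (Complex.continuous_conj.comp (h1.mul (by fun_prop)))

theorem norm_le_iSup_norm (f : ConvAlg g) (a : SU n) (p : Triv g) :
    ‖f (a, p)‖ ≤ ⨆ p : Triv g, ‖f (a, p)‖ :=
  le_ciSup (f := fun p => ‖f (a, p)‖)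
    ⟨‖f‖, by rintro _ ⟨p, rfl⟩; exact f.norm_coe_le_norm _⟩ p

theorem l1Norm_nonneg (f : ConvAlg g) : 0 ≤ l1Norm f :=
  integral_nonneg fun _ => Real.iSup_nonneg fun _ => norm_nonneg _

/-- Right translation by `a` is isometric on $L^2$, and multiplication by `f (a, ·)` costs at most
its supremum. Integrating over `a` yields the $L^1$ bound. -/
theorem norm_orbitIntegrand_le (f : ConvAlg g) (p : Triv g) (h : C(SU n, ℂ)) (a : SU n) :
    ‖toL2 n (orbitIntegrand f p h a)‖ ≤ (⨆ p : Triv g, ‖f (a, p)‖) * ‖toL2 n h‖ := by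
  have h0 : 0 ≤ ⨆ p : Triv g, ‖f (a, p)‖ := Real.iSup_nonneg fun p => norm_nonneg _
  refine le_of_sq_le_sq ?_ (mul_nonneg h0 (norm_nonneg _))
  rw [mul_pow, norm_toL2_sq, norm_toL2_sq, ← integral_mul_right_eq_self (fun b => ‖h b‖ ^ 2) a,
    ← integral_const_mul]
  refine integral_mono (integrable_haarSU (by fun_prop)) (integrable_haarSU (by fun_prop))
    fun b => ?_
  change ‖f (a, p.act b) * h (b * a)‖ ^ 2 ≤ _
  rw [norm_mul, mul_pow]
  exact mul_le_mul_of_nonneg_right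
    (pow_le_pow_left₀ (norm_nonneg _) (norm_le_iSup_norm f a _) 2) (sq_nonneg _)

theorem l1Norm_le_norm (f : ConvAlg g) : l1Norm f ≤ ‖f‖ := by
  refine (Real.le_norm_self _).trans (norm_integral_haarSU_le fun a => ?_)
  rw [Real.norm_of_nonneg (Real.iSup_nonneg fun _ => norm_nonneg _)]
  exact Real.iSup_le (fun p => f.norm_coe_le_norm _) (norm_nonneg _)

/-! ### Boundedness on $L^2$ and comparison with the enveloping norm -/

variable [T2Space M] [CompactSpace M]

/-- On compact `P` the supremum is the norm of the curried map from `SU(N)` to `C(P)`, which is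
continuous. This supplies the integrability behind `l1Norm`. -/
theorem continuous_iSup_norm (f : ConvAlg g) : Continuous fun a => ⨆ p : Triv g, ‖f (a, p)‖ := by
  have h := (ContinuousMap.curry f.toContinuousMap).continuous.norm
  simp only [ContinuousMap.norm_eq_iSup_norm] at h
  exact h

theorem norm_orbitOp_le (f : ConvAlg g) (p : Triv g) (h : C(SU n, ℂ)) :
    ‖toL2 n (orbitOp f p h)‖ ≤ l1Norm f * ‖toL2 n h‖ := by
  change ‖toL2 n (∫ a, orbitIntegrand f p h a ∂haarSU n)‖ ≤ _
  rw [← ContinuousLinearMap.integral_comp_comm _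
    (integrable_haarSU (orbitIntegrand f p h).continuous), l1Norm, ← integral_mul_const]
  refine (norm_integral_le_integral_norm _).trans (integral_mono ?_ ?_
    (norm_orbitIntegrand_le f p h))
  · exact integrable_haarSU (by fun_prop)
  · exact integrable_haarSU ((continuous_iSup_norm f).mul continuous_const)

/-- The operator on `L²(SU(N))` given by `f`. -/
def orbitRep (f : ConvAlg g) (p : Triv g) : L2SU n →L[ℂ] L2SU n :=
  ((toL2 n : C(SU n, ℂ) →ₗ[ℂ] L2SU n) ∘ₗ orbitOp f p).extendOfNorm (toL2 n : C(SU n, ℂ) →ₗ[ℂ] L2SU n)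

theorem orbitRep_toL2 (f : ConvAlg g) (p : Triv g) (h : C(SU n, ℂ)) :
    orbitRep f p (toL2 n h) = toL2 n (orbitOp f p h) :=
  LinearMap.extendOfNorm_eq denseRange_toL2 ⟨_, norm_orbitOp_le f p⟩ h

theorem norm_orbitRep_le (f : ConvAlg g) (p : Triv g) : ‖orbitRep f p‖ ≤ l1Norm f :=
  LinearMap.opNorm_extendOfNorm_le denseRange_toL2 (l1Norm_nonneg f) (norm_orbitOp_le f p)

theorem orbitRep_ext {S T : L2SU n →L[ℂ] L2SU n} (h : ∀ k, S (toL2 n k) = T (toL2 n k)) : S = T :=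
  ContinuousLinearMap.coeFn_injective
    (denseRange_toL2.equalizer S.continuous T.continuous (funext h))

variable (g) in
/-- The direct product of the representations of the convolution algebra given by all orbits. -/
def orbitCrossRep : CrossRep g where
  B := lp (fun _ : Triv g => L2SU n →L[ℂ] L2SU n) ∞
  toLin :=
    { toFun := fun f => ⟨fun p => orbitRep f p, memℓp_infty ⟨l1Norm f, by
        rintro _ ⟨p, rfl⟩
        exact norm_orbitRep_le f p⟩⟩
      map_add' := fun f₁ f₂ => by
        ext1; ext1 p
        refine orbitRep_ext fun k => ?_
        change orbitRep (f₁ + f₂) p (toL2 n k) = orbitRep f₁ p (toL2 n k) + orbitRep f₂ p (toL2 n k)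
        rw [orbitRep_toL2, orbitRep_toL2, orbitRep_toL2, ← map_add]
        congr 1; ext b
        have hc : ∀ f : ConvAlg g, Continuous fun a => f (a, p.act b) * k (b * a) := fun f =>
          (f.continuous.comp (by fun_prop)).mul (by fun_prop)
        rw [ContinuousMap.add_apply, orbitOp_apply, orbitOp_apply, orbitOp_apply,
          ← integral_add (integrable_haarSU (hc f₁)) (integrable_haarSU (hc f₂))]
        simp [add_mul]
      map_smul' := fun c f => by
        ext1; ext1 p
        refine orbitRep_ext fun k => ?_
        change orbitRep (c • f) p (toL2 n k) = c • orbitRep f p (toL2 n k)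
        rw [orbitRep_toL2, orbitRep_toL2, ← map_smul]
        congr 1; ext b
        rw [ContinuousMap.smul_apply, orbitOp_apply, orbitOp_apply, ← integral_smul]
        simp [mul_assoc] }
  map_conv f₁ f₂ := by
    ext1; ext1 p
    refine orbitRep_ext fun k => ?_
    change orbitRep (conv f₁ f₂) p (toL2 n k) = orbitRep f₁ p (orbitRep f₂ p (toL2 n k))
    rw [orbitRep_toL2, orbitRep_toL2, orbitRep_toL2, orbitOp_conv]
  map_convStar f := by
    ext1; ext1 p
    change orbitRep (convStar f) p = ContinuousLinearMap.adjoint (orbitRep f p)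
    refine (ContinuousLinearMap.eq_adjoint_iff _ _).mpr fun h k => ?_
    refine denseRange_toL2.induction_on h (isClosed_eq (by fun_prop) (by fun_prop)) fun h => ?_
    refine denseRange_toL2.induction_on k (isClosed_eq (by fun_prop) (by fun_prop)) fun k => ?_
    -- Applied to `convStar f`, whose own adjoint is `f` because the involution has order two.
    have e := inner_orbitOp (convStar f) p h k
    have e' : convStar (convStar f) = f := by
      ext ⟨a, q⟩
      change star (star (f (a⁻¹⁻¹, (q.act a).act a⁻¹))) = _
      rw [star_star, inv_inv, Triv.act_act, mul_inv_cancel, Triv.act_one]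
    rw [e', ← orbitRep_toL2, ← orbitRep_toL2] at e
    exact e
  norm_le f := lp.norm_le_of_forall_le (l1Norm_nonneg f) (norm_orbitRep_le f)

/-- The product over all orbits is one of the representations over which the enveloping norm is a
supremum. -/
theorem norm_orbitRep_le_univRep (f : ConvAlg g) (p : Triv g) : ‖orbitRep f p‖ ≤ ‖univRep f‖ :=
  (lp.norm_apply_le_norm ENNReal.top_ne_zero ((orbitCrossRep g).toLin f) p).trans
    (lp.norm_apply_le_norm ENNReal.top_ne_zero (univRep f) (orbitCrossRep g))

end OrbitRep

end ProjDirac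
end

noncomputable section
namespace ProjDirac

/-! ### Operations on `C(P, ℂ^N)` -/

section Operations

universe u

variable {n : ℕ}

open MeasureTheory

variable {M : Type u} [TopologicalSpace M] [ChartedSpace (EuclideanSpace ℝ (Fin n)) M]
  [IsManifold (𝓡 n) ∞ M] {g : RiemMetric n M}

theorem continuous_mulVec_act (ξ : Triv g →ᵇ VNat n) (p : Triv g) :
    Continuous fun a : SU n => (a : Mat n).mulVec (ξ (p.act a)) :=
  (by fun_prop : Continuous fun a : SU n => (a : Mat n)).matrix_mulVec
    (ξ.continuous.comp (continuous_act_right p))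

/-- The matrix coefficient `a ↦ ⟨w, a ξ(p a)⟩`. -/
def orbitFun (ξ : Triv g →ᵇ VNat n) (p : Triv g) (w : VNat n) : C(SU n, ℂ) :=
  ⟨fun a => star w ⬝ᵥ (a : Mat n).mulVec (ξ (p.act a)),
    continuous_const.dotProduct (continuous_mulVec_act ξ p)⟩

theorem norm_ipOp_apply (ξ : Triv g →ᵇ VNat n) (p : Triv g) (w : EuclideanSpace ℂ (Fin (spinDim n))) :
    ‖ipOp ξ p w‖ = ‖toL2 n (orbitFun ξ p w.ofLp)‖ := by
  rw [← sq_eq_sq₀ (norm_nonneg _) (norm_nonneg _), norm_toL2_sq]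
  refine (norm_toL2_sq _).trans (integral_congr_ae (ae_of_all _ fun a => ?_))
  change ‖star ((a : Mat n).mulVec (ξ (p.act a))) ⬝ᵥ w.ofLp‖ ^ 2 =
    ‖star w.ofLp ⬝ᵥ (a : Mat n).mulVec (ξ (p.act a))‖ ^ 2
  rw [← norm_star (star w.ofLp ⬝ᵥ _), Matrix.star_dotProduct]

/-- The linear functional `v ↦ w ⬝ᵥ A v`. -/
def dotMulVecCLM (w : VNat n) (A : Mat n) : VNat n →L[ℂ] ℂ :=
  LinearMap.toContinuousLinearMap
    { toFun := fun v => Matrix.vecMul w A ⬝ᵥ v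
      map_add' := fun _ _ => dotProduct_add _ _ _
      map_smul' := fun _ _ => dotProduct_smul _ _ _ }

theorem dotMulVecCLM_apply (w : VNat n) (A : Mat n) (v : VNat n) :
    dotMulVecCLM w A v = w ⬝ᵥ A.mulVec v := (Matrix.dotProduct_mulVec w A v).symm

theorem continuous_convAct_integrand (f : ConvAlg g) (ξ : Triv g →ᵇ VNat n) (p : Triv g) :
    Continuous fun a : SU n => f (a, p) • (a : Mat n).mulVec (ξ (p.act a)) :=
  (f.continuous.comp (by fun_prop)).smul (continuous_mulVec_act ξ p)

/-- Matrix coefficients intertwine the action on $C(P,\mathbb C^N)$ with the orbit operators, since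
the factor `b` can be moved under the integral and merged with `a`. -/
theorem orbitFun_convAct (f : ConvAlg g) (ξ : Triv g →ᵇ VNat n) (p : Triv g) (w : VNat n) :
    orbitFun (convAct f ξ) p w = orbitOp f p (orbitFun ξ p w) := by
  ext b
  rw [orbitOp_apply]
  change star w ⬝ᵥ (b : Mat n).mulVec (∫ a, f (a, p.act b) •
    ((a : Mat n).mulVec (ξ ((p.act b).act a))) ∂haarSU n) = _
  rw [← dotMulVecCLM_apply, ← ContinuousLinearMap.integral_comp_comm _
    (integrable_haarSU (continuous_convAct_integrand f ξ (p.act b)))]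
  refine integral_congr_ae (ae_of_all _ fun a => ?_)
  simp only [dotMulVecCLM_apply, map_smul, smul_eq_mul]
  rw [Triv.act_act, Matrix.mulVec_mulVec]
  rfl

/-- The seminorm is governed by the $L^2$ norms of matrix coefficients along orbits, and there `f`
acts through `orbitRep`, which the enveloping norm dominates. -/
theorem norm_convAct_le [T2Space M] [CompactSpace M] (f : ConvAlg g) (ξ : Triv g →ᵇ VNat n) :
    ‖toPre (convAct f ξ)‖ ≤ ‖univRep f‖ * ‖toPre ξ‖ := by
  refine norm_le_of_ipOp _ _ (mul_nonneg (norm_nonneg _) (norm_nonneg _)) fun p => ?_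
  rw [LinearEquiv.symm_apply_apply]
  refine ContinuousLinearMap.opNorm_le_bound _ (mul_nonneg (norm_nonneg _) (norm_nonneg _))
    fun w => ?_
  rw [norm_ipOp_apply, orbitFun_convAct, ← orbitRep_toL2]
  refine (ContinuousLinearMap.le_opNorm _ _).trans ?_
  rw [← norm_ipOp_apply, mul_assoc]
  refine mul_le_mul (norm_orbitRep_le_univRep f p) ?_ (norm_nonneg _) (norm_nonneg _)
  exact ((ipOp ξ p).le_opNorm w).trans
    (mul_le_mul_of_nonneg_right (norm_ipOp_le (toPre ξ) p) (norm_nonneg w))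

theorem continuous_ipAt_integrand' (ξ η : Triv g →ᵇ VNat n) (p : Triv g) :
    Continuous fun a : SU n => Matrix.vecMulVec ((a : Mat n).mulVec (η (p.act a)))
      (star ((a : Mat n).mulVec (ξ (p.act a)))) :=
  (continuous_mulVec_act η p).matrix_vecMulVec (continuous_mulVec_act ξ p).star

theorem toEuclideanCLM_injective :
    Function.Injective (Matrix.toEuclideanCLM (n := Fin (spinDim n)) (𝕜 := ℂ)) :=
  EquivLike.injective _

/-- The polarized form of `norm_ipAt`. It reduces Cauchy–Schwarz, sesquilinearity, hermitian
symmetry and positivity of the inner product to operator identities. -/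
theorem toEuclideanCLM_ipAt (ξ η : Triv g →ᵇ VNat n) (p : Triv g) :
    Matrix.toEuclideanCLM (n := Fin (spinDim n)) (𝕜 := ℂ) (ipAt ξ η p) =
      ContinuousLinearMap.adjoint (ipOp η p) ∘L ipOp ξ p := by
  ext1 w
  refine ext_inner_left ℂ fun v => ?_
  rw [ContinuousLinearMap.comp_apply, ContinuousLinearMap.adjoint_inner_right]
  let L : Mat n →ₗ[ℂ] ℂ :=
    { toFun := fun A => (A.mulVec w.ofLp) ⬝ᵥ star v.ofLp
      map_add' := fun A B => by simp [Matrix.add_mulVec, add_dotProduct]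
      map_smul' := fun c A => by simp [Matrix.smul_mulVec] }
  have hL : inner ℂ v (Matrix.toEuclideanCLM (n := Fin (spinDim n)) (𝕜 := ℂ) (ipAt ξ η p) w) =
      LinearMap.toContinuousLinearMap L (ipAt ξ η p) := by
    rw [EuclideanSpace.inner_eq_star_dotProduct]
    rfl
  rw [hL, ipAt_eq, ← ContinuousLinearMap.integral_comp_comm _
    (integrable_haarSU (continuous_ipAt_integrand' ξ η p))]
  refine Eq.trans ?_ (inner_toL2 _ _).symm
  refine integral_congr_ae (ae_of_all _ fun a => ?_)
  change ((Matrix.vecMulVec ((a : Mat n).mulVec (η (p.act a)))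
      (star ((a : Mat n).mulVec (ξ (p.act a))))).mulVec w.ofLp) ⬝ᵥ star v.ofLp =
    (star ((a : Mat n).mulVec (ξ (p.act a))) ⬝ᵥ w.ofLp) *
      (starRingEnd ℂ) (star ((a : Mat n).mulVec (η (p.act a))) ⬝ᵥ v.ofLp)
  rw [Matrix.vecMulVec_mulVec]
  generalize (a : Mat n).mulVec (η (p.act a)) = u
  have e' : (starRingEnd ℂ) (star u ⬝ᵥ v.ofLp) = u ⬝ᵥ star v.ofLp := by
    simp [dotProduct, mul_comm]
  rw [e']
  simp

theorem norm_ipAt_le (ξ η : Triv g →ᵇ VNat n) (p : Triv g) :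
    ‖ipAt ξ η p‖ ≤ ‖toPre ξ‖ * ‖toPre η‖ := by
  rw [Matrix.cstar_norm_def, toEuclideanCLM_ipAt]
  refine (ContinuousLinearMap.opNorm_comp_le _ _).trans ?_
  rw [LinearIsometryEquiv.norm_map, mul_comm]
  exact mul_le_mul (norm_ipOp_le (toPre ξ) p) (norm_ipOp_le (toPre η) p) (norm_nonneg _)
    (norm_nonneg _)

/-- The `Cliff(M)`-valued inner product `(ξ, η)`. -/
def ipElem (ξ η : Triv g →ᵇ VNat n) : CliffAlg g :=
  ⟨BoundedContinuousFunction.ofNormedAddCommGroup (ipAt ξ η) (continuous_ipAt ξ η)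
    (‖toPre ξ‖ * ‖toPre η‖) (norm_ipAt_le ξ η), mem_cliffAlg_of_act (ipAt_act ξ η)⟩

theorem ipElem_apply (ξ η : Triv g →ᵇ VNat n) (p : Triv g) : (ipElem ξ η).1 p = ipAt ξ η p := rfl

theorem norm_ipElem_le (ξ η : Triv g →ᵇ VNat n) : ‖ipElem ξ η‖ ≤ ‖toPre ξ‖ * ‖toPre η‖ :=
  (BoundedContinuousFunction.norm_le (mul_nonneg (norm_nonneg _) (norm_nonneg _))).mpr
    (norm_ipAt_le ξ η)

theorem norm_ipElem_self (ξ : Triv g →ᵇ VNat n) : ‖ipElem ξ ξ‖ = ‖toPre ξ‖ ^ 2 := by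
  refine le_antisymm ((norm_ipElem_le ξ ξ).trans (sq _).ge) ?_
  have h : ‖toPre ξ‖ ≤ √‖ipElem ξ ξ‖ := by
    refine norm_le_of_ipOp _ _ (Real.sqrt_nonneg _) fun p => ?_
    rw [LinearEquiv.symm_apply_apply]
    refine Real.le_sqrt_of_sq_le ?_
    rw [← norm_ipAt]
    exact (ipElem ξ ξ).1.norm_coe_le_norm p
  calc ‖toPre ξ‖ ^ 2 ≤ √‖ipElem ξ ξ‖ ^ 2 := pow_le_pow_left₀ (norm_nonneg _) h 2
    _ = ‖ipElem ξ ξ‖ := Real.sq_sqrt (norm_nonneg _)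

theorem star_ipElem (ξ η : Triv g →ᵇ VNat n) : star (ipElem ξ η) = ipElem η ξ := by
  ext1; ext1 p
  change star (ipAt ξ η p) = ipAt η ξ p
  refine toEuclideanCLM_injective ?_
  rw [map_star, toEuclideanCLM_ipAt, toEuclideanCLM_ipAt, ContinuousLinearMap.star_eq_adjoint,
    ContinuousLinearMap.adjoint_comp, ContinuousLinearMap.adjoint_adjoint]

theorem ipElem_add_right (ξ η η' : Triv g →ᵇ VNat n) :
    ipElem ξ (η + η') = ipElem ξ η + ipElem ξ η' := by
  ext1; ext1 p
  change ipAt ξ (η + η') p = ipAt ξ η p + ipAt ξ η' p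
  refine toEuclideanCLM_injective ?_
  rw [map_add, toEuclideanCLM_ipAt, toEuclideanCLM_ipAt, toEuclideanCLM_ipAt, ipOp_add, map_add,
    ContinuousLinearMap.add_comp]

theorem ipElem_smul_right (c : ℂ) (ξ η : Triv g →ᵇ VNat n) :
    ipElem ξ (c • η) = c • ipElem ξ η := by
  ext1; ext1 p
  change ipAt ξ (c • η) p = c • ipAt ξ η p
  refine toEuclideanCLM_injective ?_
  rw [map_smul, toEuclideanCLM_ipAt, toEuclideanCLM_ipAt, ipOp_smul, map_smulₛₗ,
    ContinuousLinearMap.smul_comp]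
  simp

theorem ipElem_add_left (ξ ξ' η : Triv g →ᵇ VNat n) :
    ipElem (ξ + ξ') η = ipElem ξ η + ipElem ξ' η := by
  rw [← star_ipElem, ipElem_add_right, star_add, star_ipElem, star_ipElem]

theorem ipElem_smul_left (c : ℂ) (ξ η : Triv g →ᵇ VNat n) :
    ipElem (c • ξ) η = star c • ipElem ξ η := by
  rw [← star_ipElem, ipElem_smul_right, star_smul, star_ipElem]

end Operations

end ProjDirac
end

noncomputable section
namespace ProjDirac

/-! ### The action of `Cliff(M)` and the `J_(nat)`-valued inner product -/

section RankOne

universe u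

variable {n : ℕ}

open MeasureTheory

/-- Vectors carry the supremum norm but matrices the Euclidean operator norm. The constant is
irrelevant: it only ensures that a linear map is bounded before its norm is estimated sharply. -/
theorem exists_norm_mulVec_le (n : ℕ) :
    ∃ K : ℝ, 0 ≤ K ∧ ∀ (A : Mat n) (v : VNat n), ‖A.mulVec v‖ ≤ K * ‖A‖ * ‖v‖ := by
  let T : Mat n →ₗ[ℂ] VNat n →L[ℂ] VNat n :=
    { toFun := fun A => LinearMap.toContinuousLinearMap (Matrix.mulVecLin A)
      map_add' := fun A B => by ext1 v; exact Matrix.add_mulVec A B v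
      map_smul' := fun c A => by ext1 v; exact Matrix.smul_mulVec c A v }
  refine ⟨‖LinearMap.toContinuousLinearMap T‖, ContinuousLinearMap.opNorm_nonneg _, fun A v => ?_⟩
  exact (LinearMap.toContinuousLinearMap T).le_opNorm₂ A v

theorem star_mulVec_dotProduct (A : Mat n) (v w : VNat n) :
    star (A.mulVec v) ⬝ᵥ w = star v ⬝ᵥ (star A).mulVec w := by
  rw [Matrix.star_mulVec, Matrix.dotProduct_mulVec, Matrix.star_eq_conjTranspose]

theorem norm_star_dotProduct_le (v w : VNat n) : ‖star v ⬝ᵥ w‖ ≤ spinDim n * ‖v‖ * ‖w‖ := by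
  calc ‖∑ i, star v i * w i‖ ≤ ∑ i, ‖star v i * w i‖ := norm_sum_le _ _
    _ ≤ ∑ _i : Fin (spinDim n), ‖v‖ * ‖w‖ := by
        refine Finset.sum_le_sum fun i _ => ?_
        rw [norm_mul, Pi.star_apply, norm_star]
        exact mul_le_mul (norm_le_pi_norm v i) (norm_le_pi_norm w i) (norm_nonneg _)
          (norm_nonneg _)
    _ = spinDim n * ‖v‖ * ‖w‖ := by simp [mul_assoc]

variable {M : Type u} [TopologicalSpace M] [ChartedSpace (EuclideanSpace ℝ (Fin n)) M]
  [IsManifold (𝓡 n) ∞ M] {g : RiemMetric n M}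

/-- The function `θ(a, p) = ⟨a η(p a), ξ(p)⟩`, which gives the `J_(nat)`-valued inner product. -/
def rankOne (ξ η : Triv g →ᵇ VNat n) : ConvAlg g :=
  BoundedContinuousFunction.ofNormedAddCommGroup
    (fun q => star ((q.1 : Mat n).mulVec (η (q.2.act q.1))) ⬝ᵥ ξ q.2)
    (by
      have h : Continuous fun q : SU n × Triv g => q.2.act q.1 :=
        continuous_act.comp (by fun_prop : Continuous fun q : SU n × Triv g => (q.2, q.1))
      have h' : Continuous fun q : SU n × Triv g => (q.1 : Mat n).mulVec (η (q.2.act q.1)) :=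
        (by fun_prop : Continuous fun q : SU n × Triv g => (q.1 : Mat n)).matrix_mulVec
          (η.continuous.comp h)
      exact h'.star.dotProduct (ξ.continuous.comp continuous_snd))
    (spinDim n * (spinDim n * ‖η‖) * ‖ξ‖)
    (fun q => by
      refine (norm_star_dotProduct_le _ _).trans ?_
      have h1 : ‖(q.1 : Mat n).mulVec (η (q.2.act q.1))‖ ≤ spinDim n * ‖η‖ :=
        (norm_mulVec_le _ _).trans
          (mul_le_mul_of_nonneg_left (η.norm_coe_le_norm _) (Nat.cast_nonneg _))
      exact mul_le_mul (mul_le_mul_of_nonneg_left h1 (Nat.cast_nonneg _)) (ξ.norm_coe_le_norm _)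
        (norm_nonneg _) (by positivity))

theorem rankOne_apply (ξ η : Triv g →ᵇ VNat n) (a : SU n) (p : Triv g) :
    rankOne ξ η (a, p) = star ((a : Mat n).mulVec (η (p.act a))) ⬝ᵥ ξ p := rfl

theorem norm_rankOne_le (ξ η : Triv g →ᵇ VNat n) :
    ‖rankOne ξ η‖ ≤ spinDim n * (spinDim n * ‖η‖) * ‖ξ‖ :=
  BoundedContinuousFunction.norm_ofNormedAddCommGroup_le _ (by positivity) _

theorem rankOne_mem_natFun (ξ η : Triv g →ᵇ VNat n) : rankOne ξ η ∈ natFun g := by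
  intro z hz c hc a p
  rw [rankOne_apply, rankOne_apply, ← Triv.act_act, Triv.act_scalar _ z c hc, Submonoid.coe_mul,
    hc, mul_smul_comm, mul_one, Matrix.smul_mulVec, star_smul, smul_dotProduct, smul_eq_mul]

theorem rankOne_add_left (ξ ξ' η : Triv g →ᵇ VNat n) :
    rankOne (ξ + ξ') η = rankOne ξ η + rankOne ξ' η := by
  ext ⟨a, p⟩
  exact dotProduct_add (star ((a : Mat n).mulVec (η (p.act a)))) (ξ p) (ξ' p)

theorem rankOne_smul_left (c : ℂ) (ξ η : Triv g →ᵇ VNat n) :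
    rankOne (c • ξ) η = c • rankOne ξ η := by
  ext ⟨a, p⟩
  exact dotProduct_smul c (star ((a : Mat n).mulVec (η (p.act a)))) (ξ p)

theorem convStar_rankOne (ξ η : Triv g →ᵇ VNat n) : convStar (rankOne ξ η) = rankOne η ξ := by
  ext ⟨a, p⟩
  change star (rankOne ξ η (a⁻¹, p.act a)) = _
  rw [rankOne_apply, rankOne_apply, Triv.act_act, mul_inv_cancel, Triv.act_one,
    Matrix.star_dotProduct, star_star, coe_inv_SU, star_mulVec_dotProduct]

theorem convStar_add (f f' : ConvAlg g) : convStar (f + f') = convStar f + convStar f' := by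
  ext ⟨a, p⟩
  exact star_add (f (a⁻¹, p.act a)) (f' (a⁻¹, p.act a))

theorem convStar_smul (c : ℂ) (f : ConvAlg g) : convStar (c • f) = star c • convStar f := by
  ext ⟨a, p⟩
  exact star_smul c (f (a⁻¹, p.act a))

theorem rankOne_add_right (ξ η η' : Triv g →ᵇ VNat n) :
    rankOne ξ (η + η') = rankOne ξ η + rankOne ξ η' := by
  rw [← convStar_rankOne, rankOne_add_left, convStar_add, convStar_rankOne, convStar_rankOne]

theorem rankOne_smul_right (c : ℂ) (ξ η : Triv g →ᵇ VNat n) :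
    rankOne ξ (c • η) = star c • rankOne ξ η := by
  rw [← convStar_rankOne, rankOne_smul_left, convStar_smul, convStar_rankOne]

/-- Unitarity of `b` moves it from `ξ (p b)` to the other argument of the pairing, where it combines
with `a` into `b⁻¹ a`. -/
theorem rankOne_convAct (f : ConvAlg g) (ξ η : Triv g →ᵇ VNat n) :
    rankOne (convAct f ξ) η = conv f (rankOne ξ η) := by
  ext ⟨a, p⟩
  change star ((a : Mat n).mulVec (η (p.act a))) ⬝ᵥ
    (∫ b, f (b, p) • ((b : Mat n).mulVec (ξ (p.act b))) ∂haarSU n) =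
    ∫ b, f (b, p) * rankOne ξ η (b⁻¹ * a, p.act b) ∂haarSU n
  have h := (dotMulVecCLM (star ((a : Mat n).mulVec (η (p.act a)))) 1).integral_comp_comm
    (integrable_haarSU (continuous_convAct_integrand f ξ p))
  simp only [dotMulVecCLM_apply, Matrix.one_mulVec] at h
  rw [← h]
  refine integral_congr_ae (ae_of_all _ fun b => ?_)
  simp only
  rw [rankOne_apply, Triv.act_act, mul_inv_cancel_left, dotProduct_smul, smul_eq_mul,
    Submonoid.coe_mul, coe_inv_SU, ← Matrix.mulVec_mulVec,
    star_mulVec_dotProduct (star (b : Mat n)), star_star]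

theorem norm_univRep_le_l1Norm (f : ConvAlg g) : ‖univRep f‖ ≤ l1Norm f :=
  lp.norm_le_of_forall_le (l1Norm_nonneg f) fun ρ => ρ.norm_le f

theorem norm_univRep_le (f : ConvAlg g) : ‖univRep f‖ ≤ ‖f‖ :=
  (norm_univRep_le_l1Norm f).trans (l1Norm_le_norm f)

/-! ### The Clifford action, the imprimitivity relation and the bound on rank one elements -/

variable [T2Space M] [CompactSpace M]

/-- The action of `Cliff(M)` on `C(P, ℂ^N)`. -/
def cliffAct (c : CliffAlg g) (ξ : Triv g →ᵇ VNat n) : Triv g →ᵇ VNat n :=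
  BoundedContinuousFunction.mkOfCompact
    ⟨fun p => (c.1 p).mulVec (ξ p), c.1.continuous.matrix_mulVec ξ.continuous⟩

theorem cliffAct_apply (c : CliffAlg g) (ξ : Triv g →ᵇ VNat n) (p : Triv g) :
    cliffAct c ξ p = (c.1 p).mulVec (ξ p) := rfl

theorem cliffAct_add_left (c c' : CliffAlg g) (ξ : Triv g →ᵇ VNat n) :
    cliffAct (c + c') ξ = cliffAct c ξ + cliffAct c' ξ := by
  ext1 p
  exact Matrix.add_mulVec (c.1 p) (c'.1 p) (ξ p)

theorem cliffAct_smul_left (r : ℂ) (c : CliffAlg g) (ξ : Triv g →ᵇ VNat n) :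
    cliffAct (r • c) ξ = r • cliffAct c ξ := by
  ext1 p
  exact Matrix.smul_mulVec r (c.1 p) (ξ p)

theorem cliffAct_add_right (c : CliffAlg g) (ξ ξ' : Triv g →ᵇ VNat n) :
    cliffAct c (ξ + ξ') = cliffAct c ξ + cliffAct c ξ' := by
  ext1 p
  exact Matrix.mulVec_add (c.1 p) (ξ p) (ξ' p)

theorem cliffAct_smul_right (r : ℂ) (c : CliffAlg g) (ξ : Triv g →ᵇ VNat n) :
    cliffAct c (r • ξ) = r • cliffAct c ξ := by
  ext1 p
  exact Matrix.mulVec_smul (c.1 p) r (ξ p)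

theorem cliffAct_mul (c c' : CliffAlg g) (ξ : Triv g →ᵇ VNat n) :
    cliffAct (c * c') ξ = cliffAct c (cliffAct c' ξ) := by
  ext1 p
  exact (Matrix.mulVec_mulVec (ξ p) (c.1 p) (c'.1 p)).symm

theorem mulVec_cliffAct (c : CliffAlg g) (ξ : Triv g →ᵇ VNat n) (p : Triv g) (a : SU n) :
    (a : Mat n).mulVec (cliffAct c ξ (p.act a)) =
      (c.1 p).mulVec ((a : Mat n).mulVec (ξ (p.act a))) := by
  rw [cliffAct_apply, cliffAlg_act, Matrix.mulVec_mulVec, Matrix.mulVec_mulVec, ← mul_assoc,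
    ← mul_assoc, mul_star_SU, one_mul]

theorem ipOp_cliffAct (c : CliffAlg g) (ξ : Triv g →ᵇ VNat n) (p : Triv g) :
    ipOp (cliffAct c ξ) p = ipOp ξ p ∘L
      Matrix.toEuclideanCLM (n := Fin (spinDim n)) (𝕜 := ℂ) (star (c.1 p)) := by
  ext1 w
  change ContinuousMap.toLp (E := ℂ) 2 (haarSU n) ℂ _ =
    ContinuousMap.toLp (E := ℂ) 2 (haarSU n) ℂ _
  congr 1
  ext a
  change star ((a : Mat n).mulVec (cliffAct c ξ (p.act a))) ⬝ᵥ w.ofLp =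
    star ((a : Mat n).mulVec (ξ (p.act a))) ⬝ᵥ (star (c.1 p)).mulVec w.ofLp
  rw [mulVec_cliffAct, star_mulVec_dotProduct]

theorem ipElem_cliffAct_right (c : CliffAlg g) (ξ η : Triv g →ᵇ VNat n) :
    ipElem ξ (cliffAct c η) = c * ipElem ξ η := by
  ext1; ext1 p
  change ipAt ξ (cliffAct c η) p = c.1 p * ipAt ξ η p
  refine toEuclideanCLM_injective ?_
  rw [map_mul, toEuclideanCLM_ipAt, toEuclideanCLM_ipAt, ipOp_cliffAct,
    ContinuousLinearMap.adjoint_comp, ← ContinuousLinearMap.star_eq_adjoint, ← map_star, star_star]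
  rfl

theorem norm_cliffAct_le (c : CliffAlg g) (ξ : Triv g →ᵇ VNat n) :
    ‖toPre (cliffAct c ξ)‖ ≤ ‖c‖ * ‖toPre ξ‖ := by
  refine norm_le_of_ipOp _ _ (mul_nonneg (norm_nonneg _) (norm_nonneg _)) fun p => ?_
  rw [LinearEquiv.symm_apply_apply, ipOp_cliffAct, mul_comm]
  refine (ContinuousLinearMap.opNorm_comp_le _ _).trans
    (mul_le_mul (norm_ipOp_le (toPre ξ) p) ?_ (norm_nonneg _) (norm_nonneg _))
  rw [← Matrix.cstar_norm_def, norm_star]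
  exact c.1.norm_coe_le_norm p

theorem rankOne_cliffAct (c : CliffAlg g) (ξ η : Triv g →ᵇ VNat n) :
    rankOne (cliffAct c ξ) η = rankOne ξ (cliffAct (star c) η) := by
  ext ⟨a, p⟩
  rw [rankOne_apply, rankOne_apply, mulVec_cliffAct, cliffAct_apply]
  change _ = star ((star (c.1 p)).mulVec _) ⬝ᵥ _
  rw [star_mulVec_dotProduct (star (c.1 p)), star_star]

/-- A scalar `⟨a η, ξ⟩` times `a ζ` is the rank one matrix `a ζ ⊗ (a η)^*` applied to `ξ p`; the
vector `ξ p` does not involve `a` and leaves the integral. -/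
theorem convAct_rankOne (ξ η ζ : Triv g →ᵇ VNat n) :
    convAct (rankOne ξ η) ζ = cliffAct (ipElem η ζ) ξ := by
  ext1 p
  rw [cliffAct_apply, ipElem_apply, ipAt_eq]
  let L : Mat n →ₗ[ℂ] VNat n :=
    { toFun := fun A => A.mulVec (ξ p)
      map_add' := fun A B => Matrix.add_mulVec A B _
      map_smul' := fun c A => Matrix.smul_mulVec c A _ }
  refine Eq.trans ?_ ((LinearMap.toContinuousLinearMap L).integral_comp_comm
    (integrable_haarSU (continuous_ipAt_integrand' η ζ p)))
  refine integral_congr_ae (ae_of_all _ fun a => ?_)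
  change rankOne ξ η (a, p) • (a : Mat n).mulVec (ζ (p.act a)) =
    (Matrix.vecMulVec ((a : Mat n).mulVec (ζ (p.act a)))
      (star ((a : Mat n).mulVec (η (p.act a))))).mulVec (ξ p)
  rw [Matrix.vecMulVec_mulVec, rankOne_apply, op_smul_eq_smul]

theorem star_univRep_rankOne_mul (ξ η : Triv g →ᵇ VNat n) :
    star (univRep (rankOne ξ η)) * univRep (rankOne ξ η) =
      univRep (rankOne (cliffAct (ipElem ξ ξ) η) η) := by
  rw [← univRep_convStar, convStar_rankOne, ← univRep_conv, ← rankOne_convAct, convAct_rankOne]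

/-- The map `L : c ↦ θ(c η, η)` is bounded for crude reasons. The C*-identity gives `‖L c‖² = ‖L (c
η, c η)‖ ≤ ‖L‖ ‖(η, η)‖ ‖c‖²`, so `‖L‖² ≤ ‖L‖ ‖(η, η)‖` and one factor cancels. -/
theorem norm_univRep_rankOne_self (η : Triv g →ᵇ VNat n) (c : CliffAlg g) :
    ‖univRep (rankOne (cliffAct c η) η)‖ ≤ ‖ipElem η η‖ * ‖c‖ := by
  obtain ⟨K, hK, hK'⟩ := exists_norm_mulVec_le n
  let T : CliffAlg g →ₗ[ℂ] UnivTarget g :=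
    { toFun := fun c => univRep (rankOne (cliffAct c η) η)
      map_add' := fun c c' => by rw [cliffAct_add_left, rankOne_add_left, map_add]
      map_smul' := fun r c => by
        rw [cliffAct_smul_left, rankOne_smul_left, map_smul, RingHom.id_apply] }
  let L : CliffAlg g →L[ℂ] UnivTarget g := T.mkContinuous
    (spinDim n * (spinDim n * ‖η‖) * (K * ‖η‖)) fun c => by
      refine (norm_univRep_le _).trans ((norm_rankOne_le _ _).trans ?_)
      rw [mul_assoc _ _ ‖c‖]
      refine mul_le_mul_of_nonneg_left ?_ (by positivity)
      refine (BoundedContinuousFunction.norm_le (by positivity)).mpr fun p => ?_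
      refine (hK' _ _).trans ?_
      rw [mul_assoc, mul_assoc, mul_comm ‖η‖]
      exact mul_le_mul_of_nonneg_left (mul_le_mul (c.1.norm_coe_le_norm p) (η.norm_coe_le_norm p)
        (norm_nonneg _) (norm_nonneg _)) hK
  have h1 : ∀ c, ‖L c‖ ≤ √(‖L‖ * ‖ipElem η η‖) * ‖c‖ := fun c => by
    rw [← sq_le_sq₀ (norm_nonneg _) (by positivity), mul_pow, Real.sq_sqrt (by positivity)]
    have h2 : ‖L c‖ ^ 2 = ‖L (ipElem (cliffAct c η) (cliffAct c η))‖ := by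
      change ‖univRep (rankOne (cliffAct c η) η)‖ ^ 2 = ‖univRep (rankOne _ η)‖
      rw [sq, ← CStarRing.norm_star_mul_self, star_univRep_rankOne_mul]
    rw [h2]
    refine (L.le_opNorm _).trans ?_
    rw [mul_assoc]
    refine mul_le_mul_of_nonneg_left ?_ (norm_nonneg _)
    rw [norm_ipElem_self, norm_ipElem_self, mul_comm, ← mul_pow]
    exact pow_le_pow_left₀ (norm_nonneg (toPre (cliffAct c η))) (norm_cliffAct_le c η) 2
  have h3 : ‖L‖ ≤ √(‖L‖ * ‖ipElem η η‖) := L.opNorm_le_bound (Real.sqrt_nonneg _) h1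
  have h4 : ‖L‖ ≤ ‖ipElem η η‖ := by
    rcases (norm_nonneg L).eq_or_lt with h | h
    · rw [← h]; exact norm_nonneg _
    · have h5 := (Real.le_sqrt' h).mp h3
      rw [sq] at h5
      exact le_of_mul_le_mul_left h5 h
  exact (L.le_opNorm c).trans (mul_le_mul_of_nonneg_right h4 (norm_nonneg _))

theorem norm_univRep_rankOne_le (ξ η : Triv g →ᵇ VNat n) :
    ‖univRep (rankOne ξ η)‖ ≤ ‖toPre ξ‖ * ‖toPre η‖ := by
  rw [← sq_le_sq₀ (norm_nonneg _) (by positivity), sq, ← CStarRing.norm_star_mul_self,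
    star_univRep_rankOne_mul, mul_pow, ← norm_ipElem_self, ← norm_ipElem_self, mul_comm ‖_‖]
  exact norm_univRep_rankOne_self η _

end RankOne

end ProjDirac
end

noncomputable section
namespace ProjDirac

/-! ### Positivity and fullness of the inner products -/

section StoneWeierstrass

/-- A continuous function on a compact space `Y` which is constant on the fibres of a continuous map
`π : Y → Z` is uniformly approximated by the pull-backs of the elements of a point-separating
star subalgebra of `C(Z, ℂ)`. -/
theorem exists_mem_near_of_factorsThrough {Y Z : Type*} [TopologicalSpace Y] [CompactSpace Y]
    [TopologicalSpace Z] [CompactSpace Z] [T2Space Z] {π : Y → Z} (hπ : Continuous π)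
    (S : StarSubalgebra ℂ C(Z, ℂ)) (hS : S.SeparatesPoints) (F : C(Y, ℂ))
    (hF : ∀ y y', π y = π y' → F y = F y') {ε : ℝ} (hε : 0 < ε) :
    ∃ h ∈ S, ∀ y, ‖F y - h (π y)‖ ≤ ε := by
  let ρ : C(Y, Set.range π) := ⟨Set.rangeFactorization π, hπ.subtype_mk _⟩
  have hq : Topology.IsQuotientMap ρ :=
    Topology.IsQuotientMap.of_surjective_continuous Set.rangeFactorization_surjective ρ.continuous
  have hF' : Function.FactorsThrough F ρ := fun y y' h =>
    hF y y' (congrArg Subtype.val h)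
  -- By compactness `Y` has its image in `Z` as a quotient, so `F` descends to the image; Tietze
  -- extends the result to all of `Z`.
  obtain ⟨G, hG⟩ := ContinuousMap.exists_restrict_eq (isCompact_range hπ).isClosed
    (hq.lift F hF')
  have hG' : ∀ y, G (π y) = F y := fun y => by
    have h1 := DFunLike.congr_fun hG (ρ y)
    have h2 := DFunLike.congr_fun (hq.lift_comp F hF') y
    exact h1.trans h2
  have hmem : G ∈ S.topologicalClosure := by
    rw [ContinuousMap.starSubalgebra_topologicalClosure_eq_top_of_separatesPoints S hS]
    trivial
  obtain ⟨h, hh, hd⟩ := Metric.mem_closure_iff.mp hmem ε hε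
  refine ⟨h, hh, fun y => ?_⟩
  rw [← hG', ← dist_eq_norm]
  exact (ContinuousMap.dist_apply_le_dist (π y)).trans hd.le

/-- The functions `(p, q) ↦ φ(p) ψ(q)` on `Z × Z`. -/
def prodFun (Z : Type*) [TopologicalSpace Z] : Set C(Z × Z, ℂ) :=
  {h | ∃ φ ψ : C(Z, ℂ), ∀ q, h q = φ q.1 * ψ q.2}

/-- The star subalgebra of `C(Z × Z, ℂ)` spanned by the products `φ(p) ψ(q)`. -/
def prodAlg (Z : Type*) [TopologicalSpace Z] : StarSubalgebra ℂ C(Z × Z, ℂ) :=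
  { (Submodule.span ℂ (prodFun Z)).toSubalgebra
      (Submodule.subset_span ⟨1, 1, fun q => by simp⟩) (fun x y hx hy => by
        have h := Submodule.mul_mem_mul hx hy
        rw [Submodule.span_mul_span] at h
        refine Submodule.span_mono ?_ h
        rintro _ ⟨_, ⟨φ, ψ, h⟩, _, ⟨φ', ψ', h'⟩, rfl⟩
        refine ⟨φ * φ', ψ * ψ', fun q => ?_⟩
        simp only [ContinuousMap.mul_apply, h, h']
        ring) with
    star_mem' := fun {x} hx => by
      refine Submodule.span_induction (p := fun x _ => star x ∈ Submodule.span ℂ (prodFun Z))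
        ?_ ?_ ?_ ?_ hx
      · rintro x ⟨φ, ψ, h⟩
        refine Submodule.subset_span ⟨star φ, star ψ, fun q => ?_⟩
        simp [h]
      · simp
      · intro x y _ _ hx hy
        rw [star_add]
        exact add_mem hx hy
      · intro c x _ hx
        rw [star_smul]
        exact Submodule.smul_mem _ _ hx }

theorem mem_prodAlg {Z : Type*} [TopologicalSpace Z] {h : C(Z × Z, ℂ)} :
    h ∈ prodAlg Z ↔ h ∈ Submodule.span ℂ (prodFun Z) := Iff.rfl

theorem prodAlg_separatesPoints (Z : Type*) [TopologicalSpace Z] [CompactSpace Z] [T2Space Z] :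
    (prodAlg Z).SeparatesPoints := by
  have key : ∀ x y : Z, x ≠ y → ∃ φ : C(Z, ℂ), φ x ≠ φ y := fun x y hxy => by
    obtain ⟨φ, hφ, hφ', -⟩ := exists_continuous_zero_one_of_isClosed (isClosed_singleton (x := x))
      (isClosed_singleton (x := y)) (by simpa using hxy)
    refine ⟨⟨fun z => (φ z : ℂ), by fun_prop⟩, ?_⟩
    simp [hφ (Set.mem_singleton x), hφ' (Set.mem_singleton y)]
  rintro ⟨x, x'⟩ ⟨y, y'⟩ hne
  by_cases hx : x = y
  · obtain ⟨φ, hφ⟩ := key x' y' (fun h => hne (by rw [hx, h]))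
    exact ⟨_, ⟨⟨fun q => φ q.2, by fun_prop⟩, mem_prodAlg.mpr (Submodule.subset_span
      ⟨1, φ, fun q => by simp⟩), rfl⟩, hφ⟩
  · obtain ⟨φ, hφ⟩ := key x y hx
    exact ⟨_, ⟨⟨fun q => φ q.1, by fun_prop⟩, mem_prodAlg.mpr (Submodule.subset_span
      ⟨φ, 1, fun q => by simp⟩), rfl⟩, hφ⟩

end StoneWeierstrass

/-! ### Positivity in the section algebra and density of rank one functions -/

section Fullness

universe u

variable {n : ℕ}

open MeasureTheory

variable {M : Type u} [TopologicalSpace M] [ChartedSpace (EuclideanSpace ℝ (Fin n)) M]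
  [IsManifold (𝓡 n) ∞ M] {g : RiemMetric n M}

theorem norm_entry_SU_le_one (a : SU n) (i j : Fin (spinDim n)) : ‖(a : Mat n) i j‖ ≤ 1 :=
  entry_norm_bound_of_unitary (Matrix.mem_specialUnitaryGroup_iff.mp a.2).1 i j

theorem sum_entry_mul_star_SU (a : SU n) (j : Fin (spinDim n)) :
    ∑ i, (a : Mat n) i j * star ((a : Mat n) i j) = 1 := by
  have h := congrFun (congrFun (star_mul_SU a) j) j
  rw [Matrix.mul_apply, Matrix.one_apply_eq] at h
  rw [← h]
  exact Finset.sum_congr rfl fun i _ => by rw [Matrix.star_apply, mul_comm]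

theorem star_mul_self_eq_one_of_smul {z : SU n} {c : ℂ} (hc : (z : Mat n) = c • 1) :
    star c * c = 1 := by
  have h := congrFun (congrFun (star_mul_SU z) ⟨0, by positivity⟩) ⟨0, by positivity⟩
  rw [hc, star_smul, star_one, smul_mul_smul_comm, one_mul, Matrix.smul_apply,
    Matrix.one_apply_eq, smul_eq_mul, mul_one] at h
  exact h

/-- The constant function on `P` with value a vector of the standard basis. -/
def constBasis (i : Fin (spinDim n)) : Triv g →ᵇ VNat n :=
  BoundedContinuousFunction.const _ (Pi.single i 1)

/-- The projections onto basis vectors sum to one, which conjugation preserves, and Haar measure has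
mass one. -/
theorem sum_ipElem_constBasis : ∑ i, ipElem (constBasis i) (constBasis i) = (1 : CliffAlg g) := by
  ext1; ext1 p
  have e : (∑ i, ipElem (constBasis i) (constBasis i) : CliffAlg g).1 p =
      ∑ i, ipAt (g := g) (constBasis i) (constBasis i) p := by
    rw [AddSubmonoidClass.coe_finsetSum, BoundedContinuousFunction.sum_apply]
    rfl
  refine e.trans ?_
  change _ = (1 : Mat n)
  unfold ipAt
  rw [← integral_finsetSum _ fun i _ => integrable_haarSU (continuous_ipAt_integrand _ _ p)]
  have e2 : ∀ a : SU n, ∑ i : Fin (spinDim n), adIso a (Matrix.vecMulVec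
      ((constBasis i : Triv g →ᵇ VNat n) (p.act a))
      (star ((constBasis i : Triv g →ᵇ VNat n) (p.act a)))) = 1 := fun a => by
    rw [← map_sum, ← map_one (adIso a)]
    congr 1
    ext k l
    rw [Matrix.sum_apply]
    simp [constBasis, Matrix.vecMulVec_apply, Pi.single_apply, Matrix.one_apply]
  simp [e2]

/-- A self-adjoint element `x` is positive exactly when `‖x‖ - x` has norm at most `‖x‖`. This can
be checked pointwise on `P`, where the inner product is `T^* T`, so no continuous choice of square
roots is needed. -/
theorem exists_ipElem_self_eq (ξ : Triv g →ᵇ VNat n) : ∃ b : CliffAlg g, ipElem ξ ξ = star b * b := by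
  have hsa : IsSelfAdjoint (ipElem ξ ξ) := star_ipElem ξ ξ
  have hsp : SpectrumRestricts (ipElem ξ ξ) ContinuousMap.realToNNReal := by
    rw [SpectrumRestricts.nnreal_iff_nnnorm hsa le_rfl]
    refine (BoundedContinuousFunction.norm_le (norm_nonneg _)).mpr fun p => ?_
    change ‖algebraMap ℝ (Mat n) ‖ipElem ξ ξ‖ - ipAt ξ ξ p‖ ≤ ‖ipElem ξ ξ‖
    have h1 : ‖ipAt ξ ξ p‖ ≤ ‖ipElem ξ ξ‖ := (ipElem ξ ξ).1.norm_coe_le_norm p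
    have hpos := ContinuousLinearMap.isPositive_adjoint_comp_self (ipOp ξ p)
    rw [← toEuclideanCLM_ipAt] at hpos
    rw [Matrix.cstar_norm_def] at h1 ⊢
    have h2 := (SpectrumRestricts.nnreal_iff_nnnorm (t := ‖ipElem ξ ξ‖₊) hpos.isSelfAdjoint
      h1).mp hpos.spectrumRestricts
    refine le_trans (le_of_eq ?_) h2
    rw [map_sub, Algebra.algebraMap_eq_smul_one, Algebra.algebraMap_eq_smul_one]
    congr 2
    rw [← Complex.coe_smul, map_smul, map_one]
    rfl
  let _ := CStarAlgebra.spectralOrder (CliffAlg g)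
  have := CStarAlgebra.spectralOrderedRing (CliffAlg g)
  refine CStarAlgebra.nonneg_iff_eq_star_mul_self.mp ?_
  exact nonneg_iff_isSelfAdjoint_and_quasispectrumRestricts.mpr ⟨hsa, hsp⟩

variable [T2Space M] [CompactSpace M]

/-- The map which takes `h ∈ C(P × P)` to `(a, p) ↦ h(p, p a) conj(a_{ij})`. -/
def entryMul (i j : Fin (spinDim n)) : C(Triv g × Triv g, ℂ) →ₗ[ℂ] ConvAlg g where
  toFun h := BoundedContinuousFunction.mkOfCompact
    ⟨fun q => h (q.2, q.2.act q.1) * star ((q.1 : Mat n) i j), by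
      have h1 : Continuous fun q : SU n × Triv g => q.2.act q.1 :=
        continuous_act.comp (by fun_prop : Continuous fun q : SU n × Triv g => (q.2, q.1))
      have h2 : Continuous fun q : SU n × Triv g => (q.1 : Mat n) i j :=
        (by fun_prop : Continuous fun q : SU n × Triv g => (q.1 : Mat n)).matrix_elem i j
      exact (h.continuous.comp (continuous_snd.prodMk h1)).mul h2.star⟩
  map_add' h h' := by ext q; exact add_mul _ _ _
  map_smul' c h := by ext q; exact mul_assoc _ _ _

theorem entryMul_apply (i j : Fin (spinDim n)) (h : C(Triv g × Triv g, ℂ)) (a : SU n) (p : Triv g) :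
    entryMul i j h (a, p) = h (p, p.act a) * star ((a : Mat n) i j) := rfl

variable (g) in
/-- The span of the functions `rankOne ξ η`. -/
def rankOneSpan : Submodule ℂ (ConvAlg g) := Submodule.span ℂ {f | ∃ ξ η, f = rankOne ξ η}

theorem entryMul_mem_rankOneSpan (i j : Fin (spinDim n)) {h : C(Triv g × Triv g, ℂ)}
    (hh : h ∈ prodAlg (Triv g)) : entryMul i j h ∈ rankOneSpan g := by
  have key : Submodule.span ℂ (prodFun (Triv g)) ≤ (rankOneSpan g).comap (entryMul i j) := by
    refine Submodule.span_le.mpr ?_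
    rintro h ⟨φ, ψ, hh⟩
    -- The pair `φ e_i`, `conj ψ e_j` has rank one function `φ(p) ψ(p a) conj(a_ij)`.
    let ξ : Triv g →ᵇ VNat n := BoundedContinuousFunction.mkOfCompact
      ⟨fun p => φ p • (Pi.single i 1 : VNat n), φ.continuous.smul continuous_const⟩
    let η : Triv g →ᵇ VNat n := BoundedContinuousFunction.mkOfCompact
      ⟨fun p => star (ψ p) • (Pi.single j 1 : VNat n), ψ.continuous.star.smul continuous_const⟩
    refine Submodule.subset_span ⟨ξ, η, ?_⟩
    ext ⟨a, p⟩
    rw [entryMul_apply, hh, rankOne_apply]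
    have e1 : ξ p = φ p • (Pi.single i 1 : VNat n) := rfl
    have e2 : η (p.act a) = star (ψ (p.act a)) • (Pi.single j 1 : VNat n) := rfl
    rw [e1, e2, Matrix.mulVec_smul, star_smul, star_star, smul_dotProduct, dotProduct_smul,
      dotProduct_single, Pi.star_apply, Matrix.mulVec_single_one]
    simp only [smul_eq_mul, mul_one, Matrix.col_apply]
    ring
  exact key hh

/-- Multiplying `f` by an entry `a_ij` cancels its central character, so the product depends only on
`(p, p a)` and can be approximated from `P × P`. The relation `∑ i, |a_ij|² = 1` for one fixed
column reassembles `f`. -/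
theorem exists_mem_rankOneSpan_near {f : ConvAlg g} (hf : f ∈ natFun g) {ε : ℝ} (hε : 0 < ε) :
    ∃ h ∈ rankOneSpan g, ‖f - h‖ ≤ ε := by
  let j : Fin (spinDim n) := ⟨0, by positivity⟩
  have hN : (0 : ℝ) < spinDim n := by positivity
  let π : SU n × Triv g → Triv g × Triv g := fun q => (q.2, q.2.act q.1)
  have hπ : Continuous π := continuous_snd.prodMk
    (continuous_act.comp (by fun_prop : Continuous fun q : SU n × Triv g => (q.2, q.1)))
  have h2 : ∀ i, Continuous fun q : SU n × Triv g => (q.1 : Mat n) i j := fun i =>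
    (by fun_prop : Continuous fun q : SU n × Triv g => (q.1 : Mat n)).matrix_elem i j
  let F : Fin (spinDim n) → C(SU n × Triv g, ℂ) := fun i =>
    ⟨fun q => f q * (q.1 : Mat n) i j, f.continuous.mul (h2 i)⟩
  have hF : ∀ i q q', π q = π q' → F i q = F i q' := by
    rintro i ⟨a, p⟩ ⟨b, p'⟩ h
    obtain rfl : p = p' := congrArg Prod.fst h
    obtain ⟨z, hz, c, hc, rfl⟩ := exists_center_of_act_eq (congrArg Prod.snd h)
    change f (a, p) * (a : Mat n) i j = f (a * z, p) * ((a * z : SU n) : Mat n) i j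
    rw [hf z hz c hc a p, Submonoid.coe_mul, hc, mul_smul_comm, mul_one, Matrix.smul_apply,
      smul_eq_mul]
    calc f (a, p) * (a : Mat n) i j = (star c * c) * (f (a, p) * (a : Mat n) i j) := by
          rw [star_mul_self_eq_one_of_smul hc, one_mul]
      _ = star c * f (a, p) * (c * (a : Mat n) i j) := by ring
  -- Error `ε / N` for each of the `N` rows, since entries of `a` have modulus at most one.
  choose h hh hh' using fun i => exists_mem_near_of_factorsThrough hπ (prodAlg (Triv g))
    (prodAlg_separatesPoints _) (F i) (hF i) (div_pos hε hN)
  refine ⟨∑ i, entryMul i j (h i), sum_mem fun i _ => entryMul_mem_rankOneSpan i j (hh i),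
    (BoundedContinuousFunction.norm_le hε.le).mpr ?_⟩
  rintro ⟨a, p⟩
  have e1 : (f - ∑ i, entryMul i j (h i)) (a, p) =
      ∑ i, (F i (a, p) - h i (π (a, p))) * star ((a : Mat n) i j) := by
    rw [BoundedContinuousFunction.sub_apply, BoundedContinuousFunction.sum_apply]
    simp only [sub_mul, Finset.sum_sub_distrib]
    congr 1
    calc f (a, p) = f (a, p) * ∑ i, (a : Mat n) i j * star ((a : Mat n) i j) := by
          rw [sum_entry_mul_star_SU, mul_one]
      _ = _ := by
          rw [Finset.mul_sum]
          exact Finset.sum_congr rfl fun i _ => (mul_assoc _ _ _).symm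
  rw [e1]
  refine (norm_sum_le _ _).trans ?_
  calc ∑ i, ‖(F i (a, p) - h i (π (a, p))) * star ((a : Mat n) i j)‖
      ≤ ∑ _i : Fin (spinDim n), ε / spinDim n := by
        refine Finset.sum_le_sum fun i _ => ?_
        rw [norm_mul, norm_star]
        exact (mul_le_of_le_one_right (norm_nonneg _) (norm_entry_SU_le_one a i j)).trans
          (hh' i (a, p))
    _ = ε := by
        rw [Finset.sum_const, Finset.card_univ, Fintype.card_fin, nsmul_eq_mul]
        field_simp

end Fullness

end ProjDirac
end

noncomputable section
namespace ProjDirac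

/-! ### The imprimitivity bimodule -/

section Bimodule

universe u

variable {n : ℕ} {M : Type u} [TopologicalSpace M] [ChartedSpace (EuclideanSpace ℝ (Fin n)) M]
  [IsManifold (𝓡 n) ∞ M] {g : RiemMetric n M}

variable (g) in
/-- The map `natFun g → JNat g`, as a linear map. -/
def natMap : natFun g →ₗ[ℂ] JNat g where
  toFun f := toJNat f.1 f.2
  map_add' f f' := Subtype.ext (Subtype.ext (map_add univRep f.1 f'.1))
  map_smul' c f := Subtype.ext (Subtype.ext (map_smul univRep c f.1))

theorem denseRange_natMap : DenseRange (natMap g) := by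
  rintro ⟨y, hy⟩
  refine Metric.mem_closure_iff.mpr fun ε hε => ?_
  obtain ⟨s, ⟨f, hf, hs⟩, hd⟩ := Metric.mem_closure_iff.mp hy ε hε
  refine ⟨natMap g ⟨f, hf⟩, ⟨_, rfl⟩, ?_⟩
  have hs' : toCross f = s := Subtype.ext hs
  change dist y (toCross f) < ε
  rwa [hs']

theorem convAct_add_left (f f' : ConvAlg g) (ξ : Triv g →ᵇ VNat n) :
    convAct (f + f') ξ = convAct f ξ + convAct f' ξ := by
  ext1 p
  refine Eq.trans ?_ (MeasureTheory.integral_add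
    (integrable_haarSU (continuous_convAct_integrand f ξ p))
    (integrable_haarSU (continuous_convAct_integrand f' ξ p)))
  refine MeasureTheory.integral_congr_ae (MeasureTheory.ae_of_all _ fun a => ?_)
  exact add_smul (f (a, p)) (f' (a, p)) _

theorem convAct_smul_left (c : ℂ) (f : ConvAlg g) (ξ : Triv g →ᵇ VNat n) :
    convAct (c • f) ξ = c • convAct f ξ := by
  ext1 p
  refine Eq.trans ?_ (MeasureTheory.integral_smul c
    (fun a => f (a, p) • (a : Mat n).mulVec (ξ (p.act a))))
  refine MeasureTheory.integral_congr_ae (MeasureTheory.ae_of_all _ fun a => ?_)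
  exact smul_assoc c (f (a, p)) _

theorem convAct_add_right (f : ConvAlg g) (ξ ξ' : Triv g →ᵇ VNat n) :
    convAct f (ξ + ξ') = convAct f ξ + convAct f ξ' := by
  ext1 p
  refine Eq.trans ?_ (MeasureTheory.integral_add
    (integrable_haarSU (continuous_convAct_integrand f ξ p))
    (integrable_haarSU (continuous_convAct_integrand f ξ' p)))
  refine MeasureTheory.integral_congr_ae (MeasureTheory.ae_of_all _ fun a => ?_)
  simp only [BoundedContinuousFunction.add_apply, Matrix.mulVec_add, smul_add]

theorem convAct_smul_right (c : ℂ) (f : ConvAlg g) (ξ : Triv g →ᵇ VNat n) :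
    convAct f (c • ξ) = c • convAct f ξ := by
  ext1 p
  refine Eq.trans ?_ (MeasureTheory.integral_smul c
    (fun a => f (a, p) • (a : Mat n).mulVec (ξ (p.act a))))
  refine MeasureTheory.integral_congr_ae (MeasureTheory.ae_of_all _ fun a => ?_)
  simp only [BoundedContinuousFunction.smul_apply, Matrix.mulVec_smul]
  rw [smul_comm]

variable (g) in
/-- The left action of `natFun g` on `C(P, ℂ^N)`. -/
def preLeft : natFun g →ₗ[ℂ] PreMod g →ₗ[ℂ] PreMod g :=
  LinearMap.mk₂ ℂ (fun f ξ => toPre (convAct f.1 (toPre.symm ξ)))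
    (fun f f' ξ => congrArg toPre (convAct_add_left f.1 f'.1 (toPre.symm ξ)))
    (fun c f ξ => congrArg toPre (convAct_smul_left c f.1 (toPre.symm ξ)))
    (fun f ξ ξ' => congrArg toPre (convAct_add_right f.1 (toPre.symm ξ) (toPre.symm ξ')))
    (fun c f ξ => congrArg toPre (convAct_smul_right c f.1 (toPre.symm ξ)))

variable (g) in
/-- The `JNat g`-valued inner product on `C(P, ℂ^N)`. -/
def preLeftInner : PreMod g →ₗ[ℂ] PreMod g →ₗ⋆[ℂ] JNat g :=
  LinearMap.mk₂'ₛₗ (RingHom.id ℂ) (starRingEnd ℂ)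
    (fun ξ η => natMap g ⟨rankOne (toPre.symm ξ) (toPre.symm η), rankOne_mem_natFun _ _⟩)
    (fun ξ ξ' η => (congrArg (natMap g) (Subtype.ext
      (rankOne_add_left (toPre.symm ξ) (toPre.symm ξ') (toPre.symm η)))).trans (map_add _ _ _))
    (fun c ξ η => (congrArg (natMap g) (Subtype.ext
      (rankOne_smul_left c (toPre.symm ξ) (toPre.symm η)))).trans (LinearMap.map_smul (natMap g) c _))
    (fun ξ η η' => (congrArg (natMap g) (Subtype.ext
      (rankOne_add_right (toPre.symm ξ) (toPre.symm η) (toPre.symm η')))).trans (map_add _ _ _))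
    (fun c ξ η => (congrArg (natMap g) (Subtype.ext
      (rankOne_smul_right c (toPre.symm ξ) (toPre.symm η)))).trans
        (LinearMap.map_smul (natMap g) (star c) _))

variable [T2Space M] [CompactSpace M]

variable (g) in
/-- The right action of `Cliff(M)` on `C(P, ℂ^N)`. -/
def preRight : CliffAlg g →ₗ[ℂ] PreMod g →ₗ[ℂ] PreMod g :=
  LinearMap.mk₂ ℂ (fun b ξ => toPre (cliffAct (cliffAlgTranspose b) (toPre.symm ξ)))
    (fun b b' ξ => by rw [map_add, cliffAct_add_left, map_add])
    (fun c b ξ => by rw [map_smul, cliffAct_smul_left, map_smul])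
    (fun b ξ ξ' => by rw [map_add, cliffAct_add_right, map_add])
    (fun c b ξ => by rw [map_smul, cliffAct_smul_right, map_smul])

variable (g) in
/-- The `Cliff(M)`-valued inner product on `C(P, ℂ^N)`. -/
def preRightInner : PreMod g →ₗ⋆[ℂ] PreMod g →ₗ[ℂ] CliffAlg g :=
  LinearMap.mk₂'ₛₗ (starRingEnd ℂ) (RingHom.id ℂ)
    (fun ξ η => cliffAlgTranspose (ipElem (toPre.symm ξ) (toPre.symm η)))
    (fun ξ ξ' η => by rw [map_add, ipElem_add_left, map_add])
    (fun c ξ η => by rw [map_smul, ipElem_smul_left, map_smul]; rfl)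
    (fun ξ η η' => by rw [map_add, ipElem_add_right, map_add])
    (fun c ξ η => by rw [map_smul, ipElem_smul_right, map_smul]; rfl)

/-- The enveloping norm is at most the supremum norm, so uniform approximation by rank one functions
suffices. -/
theorem preLeftInner_full :
    Dense (Submodule.span ℂ {a | ∃ x y, a = preLeftInner g x y} : Set (JNat g)) := by
  have key : ∀ h ∈ rankOneSpan g, ∃ hh : h ∈ natFun g, natMap g ⟨h, hh⟩ ∈
      Submodule.span ℂ {a | ∃ x y, a = preLeftInner g x y} := by
    have h1 : rankOneSpan g ≤ ((Submodule.span ℂ {a | ∃ x y, a = preLeftInner g x y}).comap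
        (natMap g)).map (natFun g).subtype := by
      refine Submodule.span_le.mpr ?_
      rintro _ ⟨ξ, η, rfl⟩
      exact ⟨⟨rankOne ξ η, rankOne_mem_natFun ξ η⟩,
        Submodule.subset_span ⟨toPre ξ, toPre η, rfl⟩, rfl⟩
    intro h hh
    obtain ⟨f, hf, rfl⟩ := h1 hh
    exact ⟨f.2, hf⟩
  refine Dense.of_closure (Dense.mono ?_ denseRange_natMap)
  rintro _ ⟨f, rfl⟩
  refine Metric.mem_closure_iff.mpr fun ε hε => ?_
  obtain ⟨h, hh, hd⟩ := exists_mem_rankOneSpan_near f.2 (half_pos hε)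
  obtain ⟨hh', hm⟩ := key h hh
  refine ⟨_, hm, ?_⟩
  change dist (univRep f.1) (univRep h) < ε
  rw [dist_eq_norm, ← map_sub]
  exact ((norm_univRep_le _).trans hd).trans_lt (half_lt_self hε)

/-- The identity `∑ i, (e_i, e_i) = 1`, multiplied by `τ(b)` and transposed, writes every `b` as a
finite sum of inner products; the span is the whole algebra. -/
theorem preRightInner_full :
    Dense (Submodule.span ℂ {b | ∃ x y, b = preRightInner g x y} : Set (CliffAlg g)) := by
  have key : ∀ b : CliffAlg g, b ∈ Submodule.span ℂ {b | ∃ x y, b = preRightInner g x y} :=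
    fun b => by
      have h : b = ∑ i, preRightInner g (toPre (constBasis i))
          (toPre (cliffAct (cliffAlgTranspose b) (constBasis i))) := by
        change b = ∑ i, cliffAlgTranspose (ipElem (constBasis i)
          (cliffAct (cliffAlgTranspose b) (constBasis i)))
        simp only [ipElem_cliffAct_right]
        rw [← map_sum, ← Finset.mul_sum, sum_ipElem_constBasis, mul_one,
          cliffAlgTranspose_cliffAlgTranspose]
      rw [h]
      exact sum_mem fun i _ => Submodule.subset_span ⟨_, _, rfl⟩
  exact fun b => subset_closure (key b)

variable (g) in
/-- `C(P, ℂ^N)` as a pre-imprimitivity bimodule between `JNat g` and `CliffAlg g`. -/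
def preMorita : PreMorita (JNat g) (CliffAlg g) (PreMod g) (natFun g) where
  ι := natMap g
  dense := denseRange_natMap
  l := preLeft g
  r := preRight g
  li := preLeftInner g
  ri := preRightInner g
  norm_l f ξ := norm_convAct_le f.1 (toPre.symm ξ)
  norm_r b ξ := (norm_cliffAct_le _ _).trans (by rw [norm_cliffAlgTranspose]; rfl)
  norm_li ξ η := norm_univRep_rankOne_le (toPre.symm ξ) (toPre.symm η)
  norm_ri ξ η := (norm_cliffAlgTranspose _).trans_le (norm_ipElem_le _ _)
  norm_ri_self ξ := (norm_cliffAlgTranspose _).trans (norm_ipElem_self _)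
  r_mul b b' ξ := by
    change toPre (cliffAct (cliffAlgTranspose (b * b')) (toPre.symm ξ)) = _
    rw [cliffAlgTranspose_mul, cliffAct_mul]
    rfl
  li_l f ξ η := by
    refine Subtype.ext (Subtype.ext ?_)
    change univRep (rankOne (convAct f.1 (toPre.symm ξ)) (toPre.symm η)) = _
    rw [rankOne_convAct, univRep_conv]
    rfl
  li_r b ξ η := by
    refine congrArg (natMap g) (Subtype.ext ?_)
    change rankOne (cliffAct (cliffAlgTranspose b) (toPre.symm ξ)) (toPre.symm η) =
      rankOne (toPre.symm ξ) (cliffAct (cliffAlgTranspose (star b)) (toPre.symm η))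
    rw [rankOne_cliffAct, cliffAlgTranspose_star]
  ri_r b ξ η := by
    change cliffAlgTranspose (ipElem (toPre.symm ξ)
      (cliffAct (cliffAlgTranspose b) (toPre.symm η))) = _
    rw [ipElem_cliffAct_right, cliffAlgTranspose_mul, cliffAlgTranspose_cliffAlgTranspose]
    rfl
  star_li ξ η := by
    refine Subtype.ext (Subtype.ext ?_)
    change star (univRep (rankOne (toPre.symm ξ) (toPre.symm η))) = univRep (rankOne _ _)
    rw [← univRep_convStar, convStar_rankOne]
  star_ri ξ η := by
    change star (cliffAlgTranspose (ipElem _ _)) = cliffAlgTranspose (ipElem _ _)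
    rw [← cliffAlgTranspose_star, star_ipElem]
  ri_self ξ := by
    obtain ⟨b, hb⟩ := exists_ipElem_self_eq (toPre.symm ξ)
    -- Transposition reverses the product `b* b` into `τ(b) τ(b)*`, so the witness is the adjoint of
    -- `τ(b)`.
    refine ⟨star (cliffAlgTranspose b), ?_⟩
    change cliffAlgTranspose (ipElem (toPre.symm ξ) (toPre.symm ξ)) = _
    rw [hb, cliffAlgTranspose_mul, cliffAlgTranspose_star, star_star]
  li_full := preLeftInner_full
  ri_full := preRightInner_full
  exists_li ξ η := by
    refine ⟨⟨rankOne (toPre.symm ξ) (toPre.symm η), rankOne_mem_natFun _ _⟩, rfl, fun ζ => ?_⟩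
    change toPre (convAct (rankOne (toPre.symm ξ) (toPre.symm η)) (toPre.symm ζ)) =
      toPre (cliffAct (cliffAlgTranspose (cliffAlgTranspose
        (ipElem (toPre.symm η) (toPre.symm ζ)))) (toPre.symm ξ))
    rw [convAct_rankOne, cliffAlgTranspose_cliffAlgTranspose]

end Bimodule

end ProjDirac
end

open ProjDirac in
theorem mainTheorem4 {n : ℕ} (hn : Even n) {M : Type*} [TopologicalSpace M] [T2Space M]
    [CompactSpace M] [ChartedSpace (EuclideanSpace ℝ (Fin n)) M] [IsManifold (𝓡 n) ∞ M]
    (g : RiemMetric n M) :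
    ∃ S : MoritaBimodule (JNat g) (CliffAlg g) (ModF g),
      (∀ (ξ η : Triv g →ᵇ VNat n) (p : Triv g),
        transposeAt (S.rinner (toF ξ) (toF η)) p = ipAt ξ η p) ∧
      (∀ (b : CliffAlg g) (ξ : Triv g →ᵇ VNat n), ∃ η : Triv g →ᵇ VNat n,
        (∀ p : Triv g, η p = (transposeAt b p).mulVec (ξ p)) ∧
          S.rsmul b (toF ξ) = toF η) ∧
      (∀ (f : ConvAlg g) (hf : f ∈ natFun g) (ξ : Triv g →ᵇ VNat n),
        S.lsmul (toJNat f hf) (toF ξ) = toF (convAct f ξ)) := by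
  obtain ⟨S, h1, h2, h3⟩ := (preMorita g).exists_completion
    (e := (UniformSpace.Completion.toComplₗᵢ (𝕜 := ℂ) (E := PreMod g)).toLinearMap)
    UniformSpace.Completion.denseRange_coe UniformSpace.Completion.norm_coe
  refine ⟨S, fun ξ η p => ?_, fun b ξ => ⟨cliffAct (cliffAlgTranspose b) ξ, fun p => rfl,
    h2 b (toPre ξ)⟩, fun f hf ξ => h3 ⟨f, hf⟩ (toPre ξ)⟩
  have h := h1 (toPre ξ) (toPre η)
  change S.rinner (toF ξ) (toF η) = cliffAlgTranspose (ipElem ξ η) at h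
  rw [h, transposeAt_cliffAlgTranspose]
  rfl
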